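/- Let $N\ge 1$ and let $U\subset\mathbb R^N$ be open and bounded. Let $A,B\subset U$ be relatively closed in $U$ and such that $\overline U\setminus A$ and $\overline U\setminus B$ are connected. A variational solution of the obstacle problem $\Delta u=\chi_{\{u>0\}\cap A}$ in $U$ is a function $u\in H^1_{\rm loc}(U)$ with $u\ge 0$ such that $$\int_U\Big[\big(\tfrac12|\nabla w|^2+\chi_A w_+\big)-\big(\tfrac12|\nabla u|^2+\chi_A u\big)\Big]dx\ge 0$$ for all $w\in H^1_{\rm loc}(U)$ for which $\operatorname{supp}(u-w)$ is compact in $U$; here $w_+=\max\{w,0\}$. For functions in $H^1(U)$, "$u=t$ on $\partial U$" means $u-t\in H^1_0(U)$, and "$v\le u$ on $\partial U$" means $(v-u)_+\in H^1_0(U)$. 1. Suppose that $U$ has Lipschitz boundary, let $t>0$, and let $u,v\in H^1(U)$ be variational solutions of $$\Delta u=\chi_{\{u>0\}\cap A}\ \text{ in }U,\quad u=t\ \text{ on }\partial U,\qquad\qquad \Delta v=\chi_{\{v>0\}\cap B}\ \text{ in }U,\quad v=t\ \text{ on }\partial U.$$ Then $u$ and $v$ have continuous representatives in $U$, and the sets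 $A_t=\{x\in U:u(x)=0\}$ and $B_t=\{x\in U:v(x)=0\}$ defined through these satisfy $$A_t\subset A,\qquad B_t\subset B,\qquad |A_t\,\Delta\, B_t|\le|A\,\Delta\, B|,\qquad |(U\setminus A_t)\cap B_t|\le|B\cap(U\setminus A)|,$$ where $|\cdot|$ is Lebesgue measure and $\Delta$ between sets is the symmetric difference. 2. If $A\subset B$ and $u,v\in H^1(U)$ are variational solutions of $\Delta u=\chi_{\{u>0\}\cap A}$ and $\Delta v=\chi_{\{v>0\}\cap B}$ in $U$ with $v\le u$ on $\partial U$, then $v\le u$ almost everywhere in $U$. Moreover, for every $t>0$, every variational solution $u\in H^1(U)$ of $\Delta u=\chi_{\{u>0\}\cap A}$ in $U$ with $u=t$ on $\partial U$ satisfies $0\le u\le t$ almost everywhere in $U$. -/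

import Mathlib

open MeasureTheory Set Filter
open scoped ContDiff Topology

section ObstacleProblem

variable {N : ℕ}

/-- `φ ∈ C_c^∞(U)`. -/
def IsTestFunction (U : Set (EuclideanSpace ℝ (Fin N))) (φ : EuclideanSpace ℝ (Fin N) → ℝ) :
    Prop :=
  ContDiff ℝ ∞ φ ∧ HasCompactSupport φ ∧ tsupport φ ⊆ U

/-- `G` is the distributional gradient of `w` in the open set `U` (both locally integrable):
for every test function `φ` and every direction `e`, `∫_U w ∂_e φ = - ∫_U φ (G · e)`. -/
def HasWeakGradient (U : Set (EuclideanSpace ℝ (Fin N))) (w : EuclideanSpace ℝ (Fin N) → ℝ)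
    (G : EuclideanSpace ℝ (Fin N) → EuclideanSpace ℝ (Fin N)) : Prop :=
  LocallyIntegrableOn w U volume ∧ LocallyIntegrableOn G U volume ∧
    ∀ φ : EuclideanSpace ℝ (Fin N) → ℝ, IsTestFunction U φ →
      ∀ e : EuclideanSpace ℝ (Fin N),
        ∫ x in U, w x * fderiv ℝ φ x e = - ∫ x in U, φ x * inner ℝ (G x) e

/-- `w ∈ H¹(U)` with weak gradient `G`. -/
def HasH1Gradient (U : Set (EuclideanSpace ℝ (Fin N))) (w : EuclideanSpace ℝ (Fin N) → ℝ)
    (G : EuclideanSpace ℝ (Fin N) → EuclideanSpace ℝ (Fin N)) : Prop :=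
  HasWeakGradient U w G ∧ MemLp w 2 (volume.restrict U) ∧ MemLp G 2 (volume.restrict U)

/-- `w ∈ H¹(U)`. -/
def MemH1 (U : Set (EuclideanSpace ℝ (Fin N))) (w : EuclideanSpace ℝ (Fin N) → ℝ) : Prop :=
  ∃ G : EuclideanSpace ℝ (Fin N) → EuclideanSpace ℝ (Fin N), HasH1Gradient U w G

/-- `w ∈ H¹_loc(U)` with weak gradient `G`. -/
def HasH1LocGradient (U : Set (EuclideanSpace ℝ (Fin N))) (w : EuclideanSpace ℝ (Fin N) → ℝ)
    (G : EuclideanSpace ℝ (Fin N) → EuclideanSpace ℝ (Fin N)) : Prop :=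
  HasWeakGradient U w G ∧ ∀ K : Set (EuclideanSpace ℝ (Fin N)), IsCompact K → K ⊆ U →
    MemLp w 2 (volume.restrict K) ∧ MemLp G 2 (volume.restrict K)

/-- `w ∈ H¹_0(U)`, the closure of `C_c^∞(U)` in `H¹(U)`. -/
def MemH10 (U : Set (EuclideanSpace ℝ (Fin N))) (w : EuclideanSpace ℝ (Fin N) → ℝ) : Prop :=
  ∃ G : EuclideanSpace ℝ (Fin N) → EuclideanSpace ℝ (Fin N), HasH1Gradient U w G ∧
    ∀ ε : ENNReal, 0 < ε → ∃ φ : EuclideanSpace ℝ (Fin N) → ℝ, IsTestFunction U φ ∧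
      eLpNorm (fun x => w x - φ x) 2 (volume.restrict U) < ε ∧
      eLpNorm (fun x => G x - gradient φ x) 2 (volume.restrict U) < ε

/-- `u` is a variational solution of the obstacle problem `Δu = χ_{A ∩ {u > 0}}` in `U`:
`u ∈ H¹_loc(U)`, `u ≥ 0`, and
`∫_U [(½ |∇v|² + χ_A v₊) - (½ |∇u|² + χ_A u)] ≥ 0` for all `v ∈ H¹_loc(U)` such that `u - v`
has compact (essential) support in `U`. -/
def IsVariationalSolution (U A : Set (EuclideanSpace ℝ (Fin N)))
    (u : EuclideanSpace ℝ (Fin N) → ℝ) : Prop :=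
  (∀ᵐ x ∂(volume.restrict U), 0 ≤ u x) ∧
  ∃ Gu : EuclideanSpace ℝ (Fin N) → EuclideanSpace ℝ (Fin N), HasH1LocGradient U u Gu ∧
    ∀ (v : EuclideanSpace ℝ (Fin N) → ℝ)
      (Gv : EuclideanSpace ℝ (Fin N) → EuclideanSpace ℝ (Fin N)), HasH1LocGradient U v Gv →
      (∃ K : Set (EuclideanSpace ℝ (Fin N)), IsCompact K ∧ K ⊆ U ∧
        ∀ᵐ x ∂(volume.restrict (U \ K)), u x = v x) →
      0 ≤ ∫ x in U,
        ((1 / 2 * ‖Gv x‖ ^ 2 + A.indicator (fun y => max (v y) 0) x)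
          - (1 / 2 * ‖Gu x‖ ^ 2 + A.indicator u x))

/-- The Dirichlet condition `u = t` on `∂U`, i.e. `u - t ∈ H¹_0(U)`. -/
def EqConstOnBoundary (U : Set (EuclideanSpace ℝ (Fin N))) (u : EuclideanSpace ℝ (Fin N) → ℝ)
    (t : ℝ) : Prop :=
  MemH10 U (fun x => u x - t)

/-- The inequality `v ≤ u` on `∂U` for `u, v ∈ H¹(U)`, i.e. `(v - u)₊ ∈ H¹_0(U)`. -/
def LeOnBoundary (U : Set (EuclideanSpace ℝ (Fin N))) (v u : EuclideanSpace ℝ (Fin N) → ℝ) :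
    Prop :=
  MemH10 U (fun x => max (v x - u x) 0)

/-- `U` has Lipschitz boundary: near each boundary point `y`, and for a suitable unit vector `e`,
`U` is the part of space strictly above the graph, in the direction `e`, of a Lipschitz function
`γ` on the hyperplane orthogonal to `e` (`γ` is only evaluated at projections to it). -/
def HasLipschitzBoundary (U : Set (EuclideanSpace ℝ (Fin N))) : Prop :=
  ∀ y ∈ frontier U, ∃ (e : EuclideanSpace ℝ (Fin N)) (γ : EuclideanSpace ℝ (Fin N) → ℝ)
    (L : NNReal) (r : ℝ), ‖e‖ = 1 ∧ LipschitzWith L γ ∧ 0 < r ∧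
      ∀ x ∈ Metric.ball y r, (x ∈ U ↔ γ (x - inner ℝ e x • e) < inner ℝ e x)

/-- `A` is a relatively closed subset of `U`. -/
def IsRelClosedIn (U A : Set (EuclideanSpace ℝ (Fin N))) : Prop :=
  ∃ F : Set (EuclideanSpace ℝ (Fin N)), IsClosed F ∧ A = U ∩ F

/-- `w` is a continuous representative in `U` of the almost everywhere defined function `u`. -/
def IsContinuousRep (U : Set (EuclideanSpace ℝ (Fin N))) (u w : EuclideanSpace ℝ (Fin N) → ℝ) :
    Prop :=
  ContinuousOn w U ∧ ∀ᵐ x ∂(volume.restrict U), w x = u x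

/-- The set `{x ∈ U : w x = 0}`. -/
def zeroSetIn (U : Set (EuclideanSpace ℝ (Fin N))) (w : EuclideanSpace ℝ (Fin N) → ℝ) :
    Set (EuclideanSpace ℝ (Fin N)) :=
  {x | x ∈ U ∧ w x = 0}

end ObstacleProblem

/-! Varying `u` to `u + s ψ` with `ψ ≥ 0` and letting `s` tend to `0` from the two sides gives the
weak inequalities χ_{A ∩ {u > 0}} ≤ Δu ≤ χ_A (`IsVariationalSolution.le_integral_lapl`,
`IsVariationalSolution.integral_lapl_le`). These and the boundary conditions carry the rest.

Since 0 ≤ Δu ≤ 1, averages of `u` against a radial kernel of scale r change by O(r²), so they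
converge locally uniformly to a continuous representative g (`exists_continuous_rep`). At a zero of
g the same estimates give quadratic growth (`IsObstacleRep.exists_quadratic_growth`). At almost
every zero {g > 0} also has density zero, so the Laplacians of the averages tend to zero there. On
{g > 0} the two inequalities coincide. Hence Δg = χ_{A ∩ {g > 0}} in the sense of distributions
(`IsObstacleRep.integral_mul_lapl_eq`), without second-order Sobolev regularity.

The zero set lies in A by connectedness. With boundary value t > 0, g is positive near a Lipschitz
boundary (`IsObstacleRep.exists_pos_near_frontier`): a truncation of t - g, extended by zero, has
Laplacian at least -1 on the whole space, and exterior balls force its averages strictly below its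
maximal value. Off A, g is harmonic and nonnegative, so its zeros form an open set. Thus the zeros
off A and a neighbourhood of the rest of `closure U \ A` are disjoint open sets covering a connected
set, and the former misses it.

For the measure estimates, z = u - v has zero trace and Δz = h, the difference of the two sources.
Testing with increasing functions of z yields ∫_{z > 0} h ≤ 0 (`MemH10.setIntegral_pos_nonpos`). A
pointwise comparison of h with indicators gives the one-sided bound, and exchanging the roles of u
and v gives the symmetric difference.

For A ⊆ B, (v - u)₊ is subharmonic with zero trace, hence zero by the weak maximum principle
(`MemH10.nonpos_of_lapl_nonneg`). The bound u ≤ t is the same principle applied to u - t. The chain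
rule in H¹ is never used: smooth functions are composed with test functions φₙ approximating z, and
the errors containing ∇z - ∇φₙ vanish by Cauchy–Schwarz. -/

/-! ### Partial derivatives, Laplacians and test functions. -/

section Calculus

variable {N : ℕ}

local notation "𝔼" => EuclideanSpace ℝ (Fin N)

/-- The `i`-th partial derivative of `f`. -/
noncomputable def partialDeriv (i : Fin N) (f : 𝔼 → ℝ) (x : 𝔼) : ℝ :=
  fderiv ℝ f x (EuclideanSpace.single i 1)

/-- The Laplacian of `f`, as the sum of the second partial derivatives. -/
noncomputable def lapl (f : 𝔼 → ℝ) (x : 𝔼) : ℝ :=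
  ∑ i, partialDeriv i (partialDeriv i f) x

theorem ContDiff.partialDeriv {f : 𝔼 → ℝ} (hf : ContDiff ℝ ∞ f) (i : Fin N) :
    ContDiff ℝ ∞ (partialDeriv i f) :=
  (hf.fderiv_right (m := ∞) (by simp)).clm_apply contDiff_const

theorem ContDiff.lapl {f : 𝔼 → ℝ} (hf : ContDiff ℝ ∞ f) : ContDiff ℝ ∞ (lapl f) :=
  ContDiff.sum fun i _ => (hf.partialDeriv i).partialDeriv i

theorem tsupport_partialDeriv_subset (f : 𝔼 → ℝ) (i : Fin N) :
    tsupport (partialDeriv i f) ⊆ tsupport f :=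
  tsupport_fderiv_apply_subset ℝ _

theorem HasCompactSupport.partialDeriv {f : 𝔼 → ℝ} (hf : HasCompactSupport f) (i : Fin N) :
    HasCompactSupport (partialDeriv i f) :=
  hf.of_isClosed_subset (isClosed_tsupport _) (tsupport_partialDeriv_subset f i)

theorem tsupport_lapl_subset (f : 𝔼 → ℝ) : tsupport (lapl f) ⊆ tsupport f := by
  refine closure_minimal (fun x hx => ?_) (isClosed_tsupport f)
  by_contra h
  refine hx (Finset.sum_eq_zero fun i _ => ?_)
  exact image_eq_zero_of_notMem_tsupport fun h' =>
    h (tsupport_partialDeriv_subset f i (tsupport_partialDeriv_subset _ i h'))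

theorem HasCompactSupport.lapl {f : 𝔼 → ℝ} (hf : HasCompactSupport f) :
    HasCompactSupport (lapl f) :=
  hf.of_isClosed_subset (isClosed_tsupport _) (tsupport_lapl_subset f)

theorem IsTestFunction.partialDeriv {U : Set 𝔼} {φ : 𝔼 → ℝ} (hφ : IsTestFunction U φ)
    (i : Fin N) : IsTestFunction U (partialDeriv i φ) :=
  ⟨hφ.1.partialDeriv i, hφ.2.1.partialDeriv i, (tsupport_partialDeriv_subset φ i).trans hφ.2.2⟩

theorem IsTestFunction.lapl {U : Set 𝔼} {φ : 𝔼 → ℝ} (hφ : IsTestFunction U φ) :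
    IsTestFunction U (lapl φ) :=
  ⟨hφ.1.lapl, hφ.2.1.lapl, (tsupport_lapl_subset φ).trans hφ.2.2⟩

theorem IsTestFunction.mono {U V : Set 𝔼} {φ : 𝔼 → ℝ} (hφ : IsTestFunction U φ) (h : U ⊆ V) :
    IsTestFunction V φ :=
  ⟨hφ.1, hφ.2.1, hφ.2.2.trans h⟩

theorem IsTestFunction.mul_left {U : Set 𝔼} {φ f : 𝔼 → ℝ} (hφ : IsTestFunction U φ)
    (hf : ContDiff ℝ ∞ f) : IsTestFunction U (fun x => f x * φ x) :=
  ⟨hf.mul hφ.1, hφ.2.1.mul_left, (tsupport_mul_subset_right).trans hφ.2.2⟩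

theorem IsTestFunction.comp {U : Set 𝔼} {φ : 𝔼 → ℝ} (hφ : IsTestFunction U φ) {H : ℝ → ℝ}
    (hH : ContDiff ℝ ∞ H) (h0 : H 0 = 0) : IsTestFunction U (fun x => H (φ x)) :=
  ⟨hH.comp hφ.1, hφ.2.1.comp_left h0, (tsupport_comp_subset h0 φ).trans hφ.2.2⟩

theorem IsTestFunction.sub {U : Set 𝔼} {φ ψ : 𝔼 → ℝ} (hφ : IsTestFunction U φ)
    (hψ : IsTestFunction U ψ) : IsTestFunction U (fun x => φ x - ψ x) :=
  ⟨hφ.1.sub hψ.1, hφ.2.1.sub hψ.2.1,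
    (tsupport_sub φ ψ).trans (union_subset hφ.2.2 hψ.2.2)⟩

theorem IsTestFunction.continuous {U : Set 𝔼} {φ : 𝔼 → ℝ} (hφ : IsTestFunction U φ) :
    Continuous φ := hφ.1.continuous

theorem IsTestFunction.integrable {U : Set 𝔼} {φ : 𝔼 → ℝ} (hφ : IsTestFunction U φ) :
    Integrable φ := hφ.1.continuous.integrable_of_hasCompactSupport hφ.2.1

theorem IsTestFunction.exists_bound {U : Set 𝔼} {φ : 𝔼 → ℝ} (hφ : IsTestFunction U φ) :
    ∃ C, 0 ≤ C ∧ ∀ x, |φ x| ≤ C := by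
  obtain ⟨C, hC⟩ := hφ.2.1.exists_bound_of_continuous hφ.1.continuous
  exact ⟨C, (norm_nonneg _).trans (hC 0), hC⟩

theorem IsTestFunction.eq_zero_of_notMem {U : Set 𝔼} {φ : 𝔼 → ℝ} (hφ : IsTestFunction U φ) {x : 𝔼}
    (hx : x ∉ U) : φ x = 0 :=
  image_eq_zero_of_notMem_tsupport fun h => hx (hφ.2.2 h)

theorem integral_mul_partialDeriv {f ψ : 𝔼 → ℝ} (hf : ContDiff ℝ ∞ f) (hψ : ContDiff ℝ ∞ ψ)
    (hc : HasCompactSupport ψ) (i : Fin N) :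
    ∫ x, f x * partialDeriv i ψ x = - ∫ x, partialDeriv i f x * ψ x := by
  refine integral_mul_fderiv_eq_neg_fderiv_mul_of_integrable ?_ ?_ ?_ ?_ ?_
  · exact ((hf.partialDeriv i).continuous.mul hψ.continuous).integrable_of_hasCompactSupport
      hc.mul_left
  · exact (hf.continuous.mul (hψ.partialDeriv i).continuous).integrable_of_hasCompactSupport
      (hc.partialDeriv i).mul_left
  · exact (hf.continuous.mul hψ.continuous).integrable_of_hasCompactSupport hc.mul_left
  · exact fun x _ => hf.contDiffAt.differentiableAt (by simp)
  · exact fun x _ => hψ.contDiffAt.differentiableAt (by simp)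

/-- Compact support is asked of `ψ` only, so that `f` may be a mollification or a constant. -/
theorem integral_mul_lapl {f ψ : 𝔼 → ℝ} (hf : ContDiff ℝ ∞ f) (hψ : ContDiff ℝ ∞ ψ)
    (hc : HasCompactSupport ψ) :
    ∫ x, f x * lapl ψ x = ∫ x, lapl f x * ψ x := by
  simp only [lapl, Finset.mul_sum, Finset.sum_mul]
  rw [integral_finsetSum, integral_finsetSum]
  · refine Finset.sum_congr rfl fun i _ => ?_
    rw [integral_mul_partialDeriv hf (hψ.partialDeriv i) (hc.partialDeriv i),
      integral_mul_partialDeriv (hf.partialDeriv i) hψ hc, neg_neg]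
  · exact fun i _ => (((hf.partialDeriv i).partialDeriv i).continuous.mul
      hψ.continuous).integrable_of_hasCompactSupport hc.mul_left
  · exact fun i _ => (hf.continuous.mul
      ((hψ.partialDeriv i).partialDeriv i).continuous).integrable_of_hasCompactSupport
      ((hc.partialDeriv i).partialDeriv i).mul_left

theorem partialDeriv_comp {f : 𝔼 → ℝ} (hf : ContDiff ℝ ∞ f) {H : ℝ → ℝ} (hH : ContDiff ℝ ∞ H)
    (i : Fin N) (x : 𝔼) :
    partialDeriv i (fun y => H (f y)) x = deriv H (f x) * partialDeriv i f x := by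
  have h1 : HasDerivAt H (deriv H (f x)) (f x) :=
    (hH.contDiffAt.differentiableAt (by simp)).hasDerivAt
  have h2 : HasFDerivAt f (fderiv ℝ f x) x :=
    (hf.contDiffAt.differentiableAt (by simp)).hasFDerivAt
  simp only [partialDeriv]
  have h3 := (h1.comp_hasFDerivAt x h2).fderiv
  simp only [Function.comp_def] at h3
  rw [h3]; simp

theorem partialDeriv_mul {f g : 𝔼 → ℝ} (hf : ContDiff ℝ ∞ f) (hg : ContDiff ℝ ∞ g)
    (i : Fin N) (x : 𝔼) :
    partialDeriv i (fun y => f y * g y) x =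
      f x * partialDeriv i g x + g x * partialDeriv i f x := by
  simp only [partialDeriv]
  rw [fderiv_fun_mul (hf.contDiffAt.differentiableAt (by simp))
    (hg.contDiffAt.differentiableAt (by simp))]
  simp

theorem ContDiff.deriv_top {H : ℝ → ℝ} (hH : ContDiff ℝ ∞ H) : ContDiff ℝ ∞ (deriv H) :=
  hH.iterate_deriv 1

theorem lapl_comp {f : 𝔼 → ℝ} (hf : ContDiff ℝ ∞ f) {H : ℝ → ℝ} (hH : ContDiff ℝ ∞ H) (x : 𝔼) :
    lapl (fun y => H (f y)) x =
      deriv H (f x) * lapl f x + deriv (deriv H) (f x) * ∑ i, partialDeriv i f x ^ 2 := by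
  simp only [lapl, Finset.mul_sum, ← Finset.sum_add_distrib]
  refine Finset.sum_congr rfl fun i _ => ?_
  have : partialDeriv i (fun y => H (f y)) = fun y => deriv H (f y) * partialDeriv i f y :=
    funext fun y => partialDeriv_comp hf hH i y
  rw [this, partialDeriv_mul (f := fun y => deriv H (f y)) (hH.deriv_top.comp hf) (hf.partialDeriv i),
    partialDeriv_comp hf hH.deriv_top]
  ring

theorem lapl_sub {f g : 𝔼 → ℝ} (hf : ContDiff ℝ ∞ f) (hg : ContDiff ℝ ∞ g) (x : 𝔼) :
    lapl (fun y => f y - g y) x = lapl f x - lapl g x := by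
  have key : ∀ (i : Fin N) {f g : 𝔼 → ℝ}, ContDiff ℝ ∞ f → ContDiff ℝ ∞ g →
      partialDeriv i (fun y => f y - g y) = fun y => partialDeriv i f y - partialDeriv i g y := by
    intro i f g hf hg
    funext y
    simp only [partialDeriv]
    rw [fderiv_fun_sub (hf.contDiffAt.differentiableAt (by simp))
      (hg.contDiffAt.differentiableAt (by simp))]
    simp
  simp only [lapl, ← Finset.sum_sub_distrib]
  refine Finset.sum_congr rfl fun i _ => ?_
  rw [key i hf hg, key i (hf.partialDeriv i) (hg.partialDeriv i)]

theorem partialDeriv_comp_sub_left {f : 𝔼 → ℝ} (hf : ContDiff ℝ ∞ f) (i : Fin N) (x : 𝔼) :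
    partialDeriv i (fun y => f (x - y)) = fun y => - partialDeriv i f (x - y) := by
  funext y
  have h2 : HasFDerivAt f (fderiv ℝ f (x - y)) (x - y) :=
    (hf.contDiffAt.differentiableAt (by simp)).hasFDerivAt
  have h3 := (h2.comp y ((hasFDerivAt_id y).const_sub x)).fderiv
  simp only [Function.comp_def] at h3
  simp only [partialDeriv]
  rw [h3]; simp

theorem lapl_comp_sub_left {f : 𝔼 → ℝ} (hf : ContDiff ℝ ∞ f) (x y : 𝔼) :
    lapl (fun y => f (x - y)) y = lapl f (x - y) := by
  simp only [lapl]
  refine Finset.sum_congr rfl fun i _ => ?_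
  rw [partialDeriv_comp_sub_left hf]
  have h := partialDeriv_comp_sub_left (hf.partialDeriv i) i x
  have h4 : partialDeriv i (fun y => - partialDeriv i f (x - y)) y =
      - partialDeriv i (fun y => partialDeriv i f (x - y)) y := by
    simp only [partialDeriv]
    rw [fderiv_fun_neg]; simp
  rw [h4, h]; simp

theorem inner_gradient_eq_sum (f : 𝔼 → ℝ) (x : 𝔼) (v : 𝔼) :
    inner ℝ v (gradient f x) = ∑ i, v i * partialDeriv i f x := by
  have hv : v = ∑ i, v i • EuclideanSpace.single i (1 : ℝ) := by
    ext j; simp [Pi.single_apply]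
  rw [real_inner_comm, inner_gradient_left]
  conv_lhs => rw [hv]
  simp [map_sum, partialDeriv]

theorem continuous_gradient {f : 𝔼 → ℝ} (hf : ContDiff ℝ ∞ f) : Continuous (gradient f) :=
  (LinearIsometryEquiv.continuous _).comp (hf.continuous_fderiv (by simp))

theorem tsupport_gradient_subset (f : 𝔼 → ℝ) : tsupport (gradient f) ⊆ tsupport f := by
  refine closure_minimal (fun x hx => ?_) (isClosed_tsupport f)
  by_contra h
  refine hx ?_
  have h1 : fderiv ℝ f x = 0 := by
    by_contra h2
    exact h (tsupport_fderiv_subset ℝ (subset_tsupport _ h2))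
  simp [gradient, h1]

theorem HasCompactSupport.gradient {f : 𝔼 → ℝ} (hf : HasCompactSupport f) :
    HasCompactSupport (gradient f) :=
  hf.of_isClosed_subset (isClosed_tsupport _) (tsupport_gradient_subset f)

end Calculus

/-! ### A radial mollifier, its potential, and their dilations. -/

section Kernel

variable {N : ℕ}

local notation "𝔼" => EuclideanSpace ℝ (Fin N)

/-- The `L¹`-normalized dilation `z ↦ r⁻ᴺ f (z / r)`. -/
noncomputable def dilate (r : ℝ) (f : 𝔼 → ℝ) (z : 𝔼) : ℝ := (r ^ N)⁻¹ * f (r⁻¹ • z)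

theorem ContDiff.dilate {f : 𝔼 → ℝ} (hf : ContDiff ℝ ∞ f) (r : ℝ) : ContDiff ℝ ∞ (dilate r f) :=
  contDiff_const.mul (hf.comp (contDiff_id.const_smul r⁻¹))

theorem partialDeriv_dilate {f : 𝔼 → ℝ} (hf : ContDiff ℝ ∞ f) (r : ℝ) (i : Fin N) :
    partialDeriv i (dilate r f) = fun z => r⁻¹ * dilate r (partialDeriv i f) z := by
  funext z
  have h2 : HasFDerivAt f (fderiv ℝ f (r⁻¹ • z)) (r⁻¹ • z) :=
    (hf.contDiffAt.differentiableAt (by simp)).hasFDerivAt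
  have h3 := ((h2.comp z ((hasFDerivAt_id z).const_smul r⁻¹)).const_mul (r ^ N)⁻¹).fderiv
  simp only [Function.comp_def] at h3
  have h4 : dilate r f = fun y => (r ^ N)⁻¹ * f (r⁻¹ • y) := rfl
  rw [partialDeriv, h4, h3]
  simp [dilate, partialDeriv]
  ring

theorem lapl_dilate {f : 𝔼 → ℝ} (hf : ContDiff ℝ ∞ f) (r : ℝ) (z : 𝔼) :
    lapl (dilate r f) z = r⁻¹ ^ 2 * dilate r (lapl f) z := by
  have h : ∀ i : Fin N, partialDeriv i (partialDeriv i (dilate r f)) z =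
      r⁻¹ ^ 2 * dilate r (partialDeriv i (partialDeriv i f)) z := by
    intro i
    rw [partialDeriv_dilate hf]
    have h4 : partialDeriv i (fun z => r⁻¹ * dilate r (partialDeriv i f) z) z =
        r⁻¹ * partialDeriv i (dilate r (partialDeriv i f)) z := by
      simp only [partialDeriv]
      rw [fderiv_const_mul]
      · simp
      · exact ((hf.partialDeriv i).dilate r).contDiffAt.differentiableAt (by simp)
    rw [h4, partialDeriv_dilate (hf.partialDeriv i)]
    ring
  simp only [lapl, h, dilate, Finset.mul_sum]

theorem integral_dilate (f : 𝔼 → ℝ) {r : ℝ} (hr : 0 < r) : ∫ z, dilate r f z = ∫ z, f z := by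
  simp only [dilate]
  rw [integral_const_mul, Measure.integral_comp_smul_of_nonneg _ _ _ (hR := inv_nonneg.2 hr.le)]
  simp only [finrank_euclideanSpace, Fintype.card_fin, smul_eq_mul]
  rw [inv_pow, inv_inv, ← mul_assoc, inv_mul_cancel₀ (pow_pos hr N).ne', one_mul]

theorem dilate_eq_zero {f : 𝔼 → ℝ} (hf : ∀ z, 1 ≤ ‖z‖ → f z = 0) {r : ℝ} (hr : 0 < r) {z : 𝔼}
    (hz : r ≤ ‖z‖) : dilate r f z = 0 := by
  rw [dilate, hf, mul_zero]
  rw [norm_smul, norm_inv, Real.norm_of_nonneg hr.le, ← div_eq_inv_mul]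
  exact (one_le_div hr).2 hz

theorem tsupport_dilate_subset {f : 𝔼 → ℝ} (hf : ∀ z, 1 ≤ ‖z‖ → f z = 0) {r : ℝ} (hr : 0 < r) :
    tsupport (dilate r f) ⊆ Metric.closedBall 0 r := by
  refine closure_minimal (fun z hz => ?_) Metric.isClosed_closedBall
  by_contra h
  rw [mem_closedBall_zero_iff, not_le] at h
  exact hz (dilate_eq_zero hf hr h.le)

theorem abs_dilate_le {f : 𝔼 → ℝ} {C : ℝ} (hf : ∀ z, |f z| ≤ C) {r : ℝ} (hr : 0 < r) (z : 𝔼) :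
    |dilate r f z| ≤ (r ^ N)⁻¹ * C := by
  rw [dilate, abs_mul, abs_of_pos (by positivity : 0 < (r ^ N)⁻¹)]
  gcongr
  exact hf _

theorem isTestFunction_dilate {f : 𝔼 → ℝ} (hs : ContDiff ℝ ∞ f) (hf : ∀ z, 1 ≤ ‖z‖ → f z = 0)
    {r : ℝ} (hr : 0 < r) (x : 𝔼) {V : Set 𝔼} (hV : Metric.closedBall x r ⊆ V) :
    IsTestFunction V (fun y => dilate r f (x - y)) := by
  have h1 : tsupport (fun y => dilate r f (x - y)) ⊆ Metric.closedBall x r := by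
    refine closure_minimal (fun z hz => ?_) Metric.isClosed_closedBall
    by_contra h
    rw [Metric.mem_closedBall, not_le, dist_comm, dist_eq_norm] at h
    exact hz (dilate_eq_zero hf hr h.le)
  exact ⟨(hs.dilate r).comp (contDiff_const.sub contDiff_id),
    (isCompact_closedBall x r).of_isClosed_subset (isClosed_tsupport _) h1, h1.trans hV⟩

theorem hasCompactSupport_dilate {f : 𝔼 → ℝ} (hf : ∀ z, 1 ≤ ‖z‖ → f z = 0) {r : ℝ} (hr : 0 < r) :
    HasCompactSupport (dilate r f) :=
  (isCompact_closedBall 0 r).of_isClosed_subset (isClosed_tsupport _) (tsupport_dilate_subset hf hr)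

/-- A smooth nonincreasing profile supported in `(-∞, 1]`. -/
noncomputable def profile (s : ℝ) : ℝ := expNegInvGlue (1 - s)

theorem contDiff_profile : ContDiff ℝ ∞ profile :=
  expNegInvGlue.contDiff.comp (contDiff_const.sub contDiff_id)

theorem hasDerivAt_profile (s : ℝ) :
    HasDerivAt profile (-((1 - s)⁻¹ ^ 2 * expNegInvGlue (1 - s))) s := by
  have h := expNegInvGlue.hasDerivAt_polynomial_eval_inv_mul 1 (1 - s)
  simp only [Polynomial.eval_one, one_mul, Polynomial.derivative_one, sub_zero, mul_one,
    Polynomial.eval_pow, Polynomial.eval_X] at h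
  have h2 := h.comp s ((hasDerivAt_id s).const_sub 1)
  refine h2.congr_deriv ?_
  simp

theorem deriv_profile_of_one_le {s : ℝ} (hs : 1 ≤ s) : deriv profile s = 0 := by
  rw [(hasDerivAt_profile s).deriv, expNegInvGlue.zero_of_nonpos (by linarith)]; simp

theorem deriv_profile_neg {s : ℝ} (hs : s < 1) : deriv profile s < 0 := by
  rw [(hasDerivAt_profile s).deriv, neg_lt_zero]
  have h1 : 0 < 1 - s := by linarith
  have := expNegInvGlue.pos_of_pos h1
  positivity

variable (N) in
/-- The unnormalized mollifier `-2 q'(‖z‖²)`, `q` the profile. -/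
noncomputable def preEta (z : 𝔼) : ℝ := -2 * deriv profile (‖z‖ ^ 2)

theorem contDiff_preEta : ContDiff ℝ ∞ (preEta N) :=
  contDiff_const.mul (contDiff_profile.deriv_top.comp (contDiff_norm_sq ℝ))

theorem preEta_eq_zero {z : 𝔼} (hz : 1 ≤ ‖z‖) : preEta N z = 0 := by
  rw [preEta, deriv_profile_of_one_le (one_le_pow₀ hz), mul_zero]

theorem preEta_pos {z : 𝔼} (hz : ‖z‖ < 1) : 0 < preEta N z := by
  have := deriv_profile_neg (pow_lt_one₀ (norm_nonneg z) hz two_ne_zero)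
  rw [preEta]; linarith

theorem preEta_nonneg (z : 𝔼) : 0 ≤ preEta N z := by
  rcases lt_or_ge ‖z‖ 1 with h | h
  · exact (preEta_pos h).le
  · exact (preEta_eq_zero h).ge

theorem hasCompactSupport_of_eq_zero {f : 𝔼 → ℝ} (hf : ∀ z, 1 ≤ ‖z‖ → f z = 0) :
    HasCompactSupport f :=
  HasCompactSupport.intro (isCompact_closedBall (0 : 𝔼) 1) fun z hz => hf z (by
    rw [mem_closedBall_zero_iff, not_le] at hz; exact hz.le)

theorem integral_preEta_pos : 0 < ∫ z, preEta N z := by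
  have hc : Continuous (preEta N) := contDiff_preEta.continuous
  refine hc.integral_pos_of_hasCompactSupport_nonneg_nonzero
    (hasCompactSupport_of_eq_zero fun _ => preEta_eq_zero) preEta_nonneg (x := 0) ?_
  exact (preEta_pos (by simp)).ne'

variable (N) in
/-- The radial mollifier. -/
noncomputable def eta (z : 𝔼) : ℝ := (∫ z, preEta N z)⁻¹ * preEta N z

variable (N) in
/-- The radial potential `Q` of the mollifier: `∇Q(z) = - eta(z) z`. -/
noncomputable def etaPot (z : 𝔼) : ℝ := (∫ z, preEta N z)⁻¹ * profile (‖z‖ ^ 2)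

theorem contDiff_eta : ContDiff ℝ ∞ (eta N) := contDiff_const.mul contDiff_preEta

theorem contDiff_etaPot : ContDiff ℝ ∞ (etaPot N) :=
  contDiff_const.mul (contDiff_profile.comp (contDiff_norm_sq ℝ))

theorem eta_eq_zero (z : 𝔼) (hz : 1 ≤ ‖z‖) : eta N z = 0 := by
  rw [eta, preEta_eq_zero hz, mul_zero]

theorem etaPot_eq_zero (z : 𝔼) (hz : 1 ≤ ‖z‖) : etaPot N z = 0 := by
  have : 1 ≤ ‖z‖ ^ 2 := one_le_pow₀ hz
  rw [etaPot, profile, expNegInvGlue.zero_of_nonpos (by linarith), mul_zero]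

theorem eta_pos {z : 𝔼} (hz : ‖z‖ < 1) : 0 < eta N z :=
  mul_pos (inv_pos.2 integral_preEta_pos) (preEta_pos hz)

theorem eta_nonneg (z : 𝔼) : 0 ≤ eta N z :=
  mul_nonneg (inv_pos.2 integral_preEta_pos).le (preEta_nonneg z)

theorem etaPot_nonneg (z : 𝔼) : 0 ≤ etaPot N z :=
  mul_nonneg (inv_pos.2 integral_preEta_pos).le (expNegInvGlue.nonneg _)

variable (N) in
theorem integral_eta : ∫ z, eta N z = 1 := by
  simp only [eta]
  rw [integral_const_mul, inv_mul_cancel₀ integral_preEta_pos.ne']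

/-- The factor -2 in `preEta` is there to absorb the 2 coming from the derivative of ‖z‖². -/
theorem fderiv_etaPot (z v : 𝔼) : fderiv ℝ (etaPot N) z v = - eta N z * inner ℝ z v := by
  have h1 : HasDerivAt profile (deriv profile (‖z‖ ^ 2)) (‖z‖ ^ 2) :=
    (contDiff_profile.contDiffAt.differentiableAt (by simp)).hasDerivAt
  have h2 := ((h1.comp_hasFDerivAt z (hasStrictFDerivAt_norm_sq z).hasFDerivAt).const_mul
    (∫ z, preEta N z)⁻¹).fderiv
  simp only [Function.comp_def] at h2
  change fderiv ℝ (fun z => (∫ z, preEta N z)⁻¹ * profile (‖z‖ ^ 2)) z v = _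
  rw [h2]
  simp [eta, preEta]
  ring

theorem partialDeriv_etaPot (i : Fin N) :
    partialDeriv i (etaPot N) = fun z => - (z i) * eta N z := by
  funext z
  rw [partialDeriv, fderiv_etaPot, EuclideanSpace.inner_single_right]
  simp; ring

theorem fderiv_apply_eq_sum (f : 𝔼 → ℝ) (x v : 𝔼) :
    fderiv ℝ f x v = ∑ i, v i * partialDeriv i f x := by
  rw [← inner_gradient_eq_sum, real_inner_comm, inner_gradient_left]

theorem lapl_etaPot (z : 𝔼) :
    lapl (etaPot N) z = - (N * eta N z + fderiv ℝ (eta N) z z) := by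
  have h : ∀ i : Fin N, partialDeriv i (partialDeriv i (etaPot N)) z =
      - eta N z - z i * partialDeriv i (eta N) z := by
    intro i
    have hp : ContDiff ℝ ∞ (fun z : 𝔼 => -(z i)) :=
      ((EuclideanSpace.proj i : 𝔼 →L[ℝ] ℝ).contDiff).neg
    rw [partialDeriv_etaPot, partialDeriv_mul hp contDiff_eta]
    have : partialDeriv i (fun z : 𝔼 => -(z i)) z = -1 := by
      have h1 : HasFDerivAt (fun z : 𝔼 => -(z i)) (-(EuclideanSpace.proj i : 𝔼 →L[ℝ] ℝ)) z :=
        ((EuclideanSpace.proj i : 𝔼 →L[ℝ] ℝ).hasFDerivAt).neg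
      rw [partialDeriv, h1.fderiv]; simp
    rw [this]; ring
  simp only [lapl, h, fderiv_apply_eq_sum, Finset.sum_sub_distrib]
  simp; ring

/-- Differentiating r⁻ᴺ η(z/r) in r produces -r⁻¹ times the dilation of N η + z · ∇η, which is the
divergence of η(z) z, that is, -ΔQ. So the change of an average with its scale is a pairing with a
Laplacian, and bounds on Δg become monotonicity in r. -/
theorem hasDerivAt_dilate_eta {r : ℝ} (hr : 0 < r) (z : 𝔼) :
    HasDerivAt (fun s => dilate s (eta N) z) (r * lapl (dilate r (etaPot N)) z) r := by
  have h1 : HasDerivAt (fun s : ℝ => (s ^ N)⁻¹) (-(N * r ^ (N - 1)) / (r ^ N) ^ 2) r :=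
    (hasDerivAt_pow N r).inv (pow_pos hr N).ne'
  have h2 : HasDerivAt (fun s : ℝ => s⁻¹ • z) ((-(r ^ 2)⁻¹) • z) r :=
    (hasDerivAt_inv hr.ne').smul_const z
  have h3 : HasFDerivAt (eta N) (fderiv ℝ (eta N) (r⁻¹ • z)) (r⁻¹ • z) :=
    (contDiff_eta.contDiffAt.differentiableAt (by simp)).hasFDerivAt
  have h4 := h1.mul (h3.comp_hasDerivAt r h2)
  refine h4.congr_deriv ?_
  rw [lapl_dilate contDiff_etaPot, dilate, lapl_etaPot]
  -- The case `N = 0` is separate because `N - 1` truncates.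
  have h5 : (N * r ^ (N - 1) : ℝ) = N * r ^ N * r⁻¹ := by
    rcases N with _ | n
    · simp
    · rw [Nat.add_sub_cancel, pow_succ]; field_simp
  rw [h5]
  simp only [map_smul, smul_eq_mul, Function.comp_def]
  field_simp
  ring

/-- The kernel has a positive minimum on any smaller concentric ball. The ratio 3/4 serves kernels
of scale 4r, which are then bounded below within distance 3r. -/
theorem exists_eta_lower_bound : ∃ m : ℝ, 0 < m ∧ ∀ {r : ℝ}, 0 < r → ∀ z : 𝔼, ‖z‖ ≤ 3 / 4 * r →
    (r ^ N)⁻¹ * m ≤ dilate r (eta N) z := by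
  obtain ⟨z₀, hz₀, hmin⟩ := (isCompact_closedBall (0 : 𝔼) (3 / 4)).exists_isMinOn
    ⟨0, by simp; norm_num⟩ (contDiff_eta (N := N)).continuous.continuousOn
  rw [mem_closedBall_zero_iff] at hz₀
  refine ⟨eta N z₀, eta_pos (by linarith), fun {r} hr z hz => ?_⟩
  rw [dilate]
  gcongr
  refine hmin ?_
  rw [mem_closedBall_zero_iff, norm_smul, norm_inv, Real.norm_of_nonneg hr.le]
  rw [inv_mul_le_iff₀ hr]; linarith

theorem dilate_eta_nonneg {r : ℝ} (hr : 0 < r) (z : 𝔼) : 0 ≤ dilate r (eta N) z :=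
  mul_nonneg (by positivity) (eta_nonneg _)

theorem dilate_eta_pos {r : ℝ} {z : 𝔼} (hr : ‖z‖ < r) : 0 < dilate r (eta N) z := by
  have hr' : 0 < r := (norm_nonneg z).trans_lt hr
  refine mul_pos (by positivity) (eta_pos ?_)
  rw [norm_smul, norm_inv, Real.norm_of_nonneg hr'.le, inv_mul_lt_iff₀ hr']; linarith

theorem dilate_etaPot_nonneg {r : ℝ} (hr : 0 < r) (z : 𝔼) : 0 ≤ dilate r (etaPot N) z :=
  mul_nonneg (by positivity) (etaPot_nonneg _)

theorem integral_dilate_eta_sub {r : ℝ} (hr : 0 < r) (x : 𝔼) :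
    ∫ y, dilate r (eta N) (x - y) = 1 := by
  rw [integral_sub_left_eq_self (dilate r (eta N)), integral_dilate _ hr, integral_eta]

end Kernel

/-! ### Mean value estimates and continuous representatives. -/

section Averages

variable {N : ℕ}

local notation "𝔼" => EuclideanSpace ℝ (Fin N)

/-- The mollification of `g` at scale `r`. -/
noncomputable def avg (g : 𝔼 → ℝ) (r : ℝ) (x : 𝔼) : ℝ := ∫ y, g y * dilate r (eta N) (x - y)

/-- `Δg ≥ a` in the sense of distributions in `V`. -/
def WeakLaplGe (V : Set 𝔼) (g : 𝔼 → ℝ) (a : ℝ) : Prop :=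
  ∀ ψ : 𝔼 → ℝ, IsTestFunction V ψ → (∀ x, 0 ≤ ψ x) → a * ∫ x, ψ x ≤ ∫ x, g x * lapl ψ x

theorem lapl_eq_zero_of_one_le (z : 𝔼) (hz : 1 ≤ ‖z‖) (f : 𝔼 → ℝ) (hs : ContDiff ℝ ∞ f)
    (hf : ∀ z, 1 ≤ ‖z‖ → f z = 0) : lapl f z = 0 := by
  have h : tsupport f ⊆ Metric.closedBall 0 1 := by
    refine closure_minimal (fun z hz => ?_) Metric.isClosed_closedBall
    by_contra h
    rw [mem_closedBall_zero_iff, not_le] at h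
    exact hz (hf z h.le)
  -- The unit sphere may meet the support of `f`, so there the value is obtained by continuity from
  -- the points `t • z` with t > 1.
  rcases hz.eq_or_lt with h1 | h1
  · have hz0 : z ≠ 0 := fun h0 => by simp [h0] at h1
    have hcl : z ∈ closure {w : 𝔼 | 1 < ‖w‖} := by
      have ht : Tendsto (fun t : ℝ => t • z) (𝓝[>] 1) (𝓝 z) := by
        have : Continuous (fun t : ℝ => t • z) := by fun_prop
        simpa using (this.tendsto 1).mono_left nhdsWithin_le_nhds
      refine mem_closure_of_tendsto ht ?_
      filter_upwards [self_mem_nhdsWithin] with t ht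
      rw [mem_Ioi] at ht
      simp only [norm_smul, ← h1, mul_one, Real.norm_eq_abs]
      exact lt_of_lt_of_le ht (le_abs_self t)
    have hclosed : IsClosed {w | lapl f w = 0} := isClosed_eq hs.lapl.continuous continuous_const
    refine closure_minimal (fun w hw => ?_) hclosed hcl
    refine image_eq_zero_of_notMem_tsupport fun h' => ?_
    have := h (tsupport_lapl_subset f h')
    rw [mem_closedBall_zero_iff] at this
    exact absurd hw (not_lt.2 this)
  · refine image_eq_zero_of_notMem_tsupport fun h' => ?_
    have := h (tsupport_lapl_subset f h')
    rw [mem_closedBall_zero_iff] at this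
    exact absurd h1 (not_lt.2 this)

theorem exists_bound_of_eq_zero {f : 𝔼 → ℝ} (hs : Continuous f) (hf : ∀ z, 1 ≤ ‖z‖ → f z = 0) :
    ∃ C, 0 ≤ C ∧ ∀ z, |f z| ≤ C := by
  obtain ⟨C, hC⟩ := (hasCompactSupport_of_eq_zero hf).exists_bound_of_continuous hs
  exact ⟨C, (norm_nonneg _).trans (hC 0), hC⟩

theorem integrable_mul_of_bound {g k : 𝔼 → ℝ} (hg : Integrable g) (hk : Continuous k) {C : ℝ}
    (hC : ∀ y, |k y| ≤ C) : Integrable fun y => g y * k y :=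
  hg.mul_bdd hk.aestronglyMeasurable (Eventually.of_forall hC)

theorem avg_eq_convolution (g : 𝔼 → ℝ) (r : ℝ) :
    avg g r = convolution g (dilate r (eta N)) (ContinuousLinearMap.mul ℝ ℝ) volume := by
  funext x
  simp [avg, convolution_def]

theorem partialDeriv_convolution {g k : 𝔼 → ℝ} (hg : Integrable g) (hk : ContDiff ℝ ∞ k)
    (hc : HasCompactSupport k) (i : Fin N) :
    partialDeriv i (convolution g k (ContinuousLinearMap.mul ℝ ℝ) volume) =
      convolution g (partialDeriv i k) (ContinuousLinearMap.mul ℝ ℝ) volume := by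
  funext x
  rw [partialDeriv, (hc.hasFDerivAt_convolution_right (ContinuousLinearMap.mul ℝ ℝ)
    hg.locallyIntegrable (hk.of_le (by simp)) x).fderiv,
    convolution_precompR_apply (ContinuousLinearMap.mul ℝ ℝ) hg.locallyIntegrable
      (hc.fderiv ℝ) (hk.continuous_fderiv (by simp))]
  rfl

theorem contDiff_avg {g : 𝔼 → ℝ} (hg : Integrable g) {r : ℝ} (hr : 0 < r) :
    ContDiff ℝ ∞ (avg g r) := by
  rw [avg_eq_convolution]
  exact (hasCompactSupport_dilate eta_eq_zero hr).contDiff_convolution_right _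
    hg.locallyIntegrable (n := ⊤) (contDiff_eta.dilate r)

theorem lapl_avg {g : 𝔼 → ℝ} (hg : Integrable g) {r : ℝ} (hr : 0 < r) (x : 𝔼) :
    lapl (avg g r) x = ∫ y, g y * lapl (dilate r (eta N)) (x - y) := by
  have hk : ContDiff ℝ ∞ (dilate r (eta N)) := contDiff_eta.dilate r
  have hc : HasCompactSupport (dilate r (eta N)) := hasCompactSupport_dilate eta_eq_zero hr
  simp only [lapl, Finset.mul_sum]
  rw [integral_finsetSum]
  · refine Finset.sum_congr rfl fun i _ => ?_
    rw [avg_eq_convolution, partialDeriv_convolution hg hk hc,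
      partialDeriv_convolution hg (hk.partialDeriv i) (hc.partialDeriv i)]
    simp [convolution_def]
  · intro i _
    obtain ⟨C, hC⟩ := ((hc.partialDeriv i).partialDeriv i).exists_bound_of_continuous
      ((hk.partialDeriv i).partialDeriv i).continuous
    exact integrable_mul_of_bound hg (((hk.partialDeriv i).partialDeriv i).continuous.comp
      (continuous_const.sub continuous_id)) fun y => hC _

theorem avg_neg (g : 𝔼 → ℝ) (r : ℝ) (x : 𝔼) : avg (fun y => - g y) r x = - avg g r x := by
  simp [avg, integral_neg]

theorem integrable_mul_dilate {g : 𝔼 → ℝ} (hg : Integrable g) {f : 𝔼 → ℝ} (hs : Continuous f)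
    (hf : ∀ z, 1 ≤ ‖z‖ → f z = 0) {r : ℝ} (hr : 0 < r) (x : 𝔼) :
    Integrable fun y => g y * dilate r f (x - y) := by
  obtain ⟨C, -, hC⟩ := exists_bound_of_eq_zero hs hf
  refine integrable_mul_of_bound hg ?_ (fun y => abs_dilate_le hC hr (x - y))
  unfold dilate; fun_prop

/-- The integral is differentiated over scales above r / 2, where the negative powers of the scale
are bounded. -/
theorem hasDerivAt_avg {g : 𝔼 → ℝ} (hg : Integrable g) {r : ℝ} (hr : 0 < r) (x : 𝔼) :
    HasDerivAt (fun s => avg g s x)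
      (r * ∫ y, g y * lapl (fun y => dilate r (etaPot N) (x - y)) y) r := by
  obtain ⟨C, hC0, hC⟩ := exists_bound_of_eq_zero contDiff_etaPot.lapl.continuous
    fun z hz => lapl_eq_zero_of_one_le z hz (etaPot N) contDiff_etaPot etaPot_eq_zero
  have hcont : ∀ s, Continuous fun y => dilate s (eta N) (x - y) := fun s =>
    (contDiff_eta.dilate s).continuous.comp (continuous_const.sub continuous_id)
  have hcont' : ∀ s, Continuous fun y => lapl (dilate s (etaPot N)) (x - y) := fun s =>
    (contDiff_etaPot.dilate s).lapl.continuous.comp (continuous_const.sub continuous_id)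
  have key := (hasDerivAt_integral_of_dominated_loc_of_deriv_le (μ := (volume : Measure 𝔼))
    (F := fun s y => g y * dilate s (eta N) (x - y))
    (F' := fun s y => g y * (s * lapl (dilate s (etaPot N)) (x - y)))
    (bound := fun y => |g y| * ((r / 2)⁻¹ * (((r / 2) ^ N)⁻¹ * C)))
    (x₀ := r) (s := Ioi (r / 2)) (Ioi_mem_nhds (by linarith)) ?_ ?_ ?_ ?_ ?_ ?_).2
  · refine key.congr_deriv ?_
    rw [← integral_const_mul]
    congr 1; funext y
    rw [lapl_comp_sub_left (contDiff_etaPot.dilate r)]; ring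
  · exact Eventually.of_forall fun s =>
      hg.aestronglyMeasurable.mul (hcont s).aestronglyMeasurable
  · exact integrable_mul_dilate hg contDiff_eta.continuous eta_eq_zero hr x
  · exact hg.aestronglyMeasurable.mul (continuous_const.mul (hcont' r)).aestronglyMeasurable
  · refine Eventually.of_forall fun y s hs => ?_
    rw [mem_Ioi] at hs
    have hs0 : 0 < s := by linarith
    have h2 : (0 : ℝ) < r / 2 := by linarith
    rw [Real.norm_eq_abs, abs_mul, lapl_dilate contDiff_etaPot]
    gcongr
    have h3 : s * (s⁻¹ ^ 2 * dilate s (lapl (etaPot N)) (x - y)) =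
        s⁻¹ * dilate s (lapl (etaPot N)) (x - y) := by field_simp
    rw [h3, abs_mul, abs_of_pos (inv_pos.2 hs0)]
    gcongr
    refine (abs_dilate_le hC hs0 _).trans ?_
    gcongr
  · exact hg.abs.mul_const _
  · refine Eventually.of_forall fun y s hs => ?_
    rw [mem_Ioi] at hs
    exact (hasDerivAt_dilate_eta (by linarith) (x - y)).const_mul (g y)

variable (N) in
/-- The constant `∫ Q` in the mean value estimates. -/
noncomputable def potMass : ℝ := ∫ z, etaPot N z

theorem potMass_nonneg : 0 ≤ potMass N := integral_nonneg etaPot_nonneg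

/-- The potential is a nonnegative test function of mass `potMass N`, so the average plus M ·
potMass · t² / 2 has nonnegative derivative in t. The constant in the conclusion is not optimal. -/
theorem avg_le_avg_add {V : Set 𝔼} {g : 𝔼 → ℝ} (hg : Integrable g) {M : ℝ} (hM : 0 ≤ M)
    (h : WeakLaplGe V g (-M)) {x : 𝔼} {s r : ℝ} (hs : 0 < s) (hsr : s ≤ r)
    (hV : Metric.closedBall x r ⊆ V) : avg g s x ≤ avg g r x + M * potMass N * r ^ 2 := by
  have hd : ∀ t, 0 < t → HasDerivAt (fun t => avg g t x + M * potMass N / 2 * t ^ 2)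
      (t * (∫ y, g y * lapl (fun y => dilate t (etaPot N) (x - y)) y)
        + M * potMass N / 2 * (2 * t)) t := by
    intro t ht
    refine (hasDerivAt_avg hg ht x).add ?_
    simpa using (hasDerivAt_pow 2 t).const_mul (M * potMass N / 2)
  have hmono : MonotoneOn (fun t => avg g t x + M * potMass N / 2 * t ^ 2) (Icc s r) := by
    refine monotoneOn_of_deriv_nonneg (convex_Icc s r)
      (fun t ht => (hd t (hs.trans_le ht.1)).continuousAt.continuousWithinAt)
      (fun t ht => ?_) (fun t ht => ?_)
    · rw [interior_Icc] at ht
      exact (hd t (hs.trans ht.1)).differentiableAt.differentiableWithinAt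
    · rw [interior_Icc] at ht
      have ht0 := hs.trans ht.1
      rw [(hd t ht0).deriv]
      have h1 := h _ (isTestFunction_dilate contDiff_etaPot etaPot_eq_zero ht0 x
        ((Metric.closedBall_subset_closedBall ht.2.le).trans hV))
        (fun y => dilate_etaPot_nonneg ht0 _)
      rw [integral_sub_left_eq_self (dilate t (etaPot N)), integral_dilate _ ht0] at h1
      change -M * potMass N ≤ _ at h1
      have := mul_le_mul_of_nonneg_left h1 ht0.le
      linarith
  have h2 := hmono (left_mem_Icc.2 hsr) (right_mem_Icc.2 hsr) hsr
  simp only at h2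
  have h3 : 0 ≤ M * potMass N := mul_nonneg hM potMass_nonneg
  nlinarith [sq_nonneg s, sq_nonneg r, mul_nonneg h3 (sq_nonneg s), mul_nonneg h3 (sq_nonneg r)]

theorem ae_tendsto_integral_closedBall {g : 𝔼 → ℝ} (hg : Integrable g) :
    ∀ᵐ x, Tendsto (fun r : ℝ => (r ^ N)⁻¹ * ∫ y in Metric.closedBall x r, |g y - g x|)
      (𝓝[>] 0) (𝓝 0) := by
  filter_upwards [IsUnifLocDoublingMeasure.ae_tendsto_average_norm_sub volume
    hg.locallyIntegrable 1] with x hx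
  have h := hx (l := 𝓝[>] (0 : ℝ)) (fun _ => x) id tendsto_id (by
    filter_upwards [self_mem_nhdsWithin] with r hr
    exact Metric.mem_closedBall_self (by simpa using (mem_Ioi.1 hr).le))
  have h2 := h.const_mul (volume.real (Metric.ball (0 : 𝔼) 1))
  rw [mul_zero] at h2
  refine h2.congr' ?_
  filter_upwards [self_mem_nhdsWithin] with r hr
  rw [mem_Ioi] at hr
  have hv : volume.real (Metric.closedBall x r) =
      r ^ N * volume.real (Metric.ball (0 : 𝔼) 1) := by
    rw [Measure.addHaar_real_closedBall _ _ hr.le]; simp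
  have hb : 0 < volume.real (Metric.ball (0 : 𝔼) 1) :=
    ENNReal.toReal_pos (Metric.measure_ball_pos _ _ one_pos).ne' measure_ball_lt_top.ne
  rw [setAverage_eq, id, hv, smul_eq_mul]
  simp only [Real.norm_eq_abs]
  field_simp

/-- The kernel has mass one, is supported in the ball of radius r and is bounded by C r⁻ᴺ.
Convergence of averages thus reduces to the Lebesgue point property. -/
theorem abs_avg_sub_le {g : 𝔼 → ℝ} (hg : Integrable g) : ∃ C, 0 ≤ C ∧ ∀ x, ∀ r : ℝ, 0 < r →
    |avg g r x - g x| ≤ C * ((r ^ N)⁻¹ * ∫ y in Metric.closedBall x r, |g y - g x|) := by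
  obtain ⟨C, hC0, hC⟩ := exists_bound_of_eq_zero (contDiff_eta (N := N)).continuous eta_eq_zero
  refine ⟨C, hC0, fun x r hr => ?_⟩
  have hint := integrable_mul_dilate hg contDiff_eta.continuous eta_eq_zero hr x
  have hcont : Continuous fun y => dilate r (eta N) (x - y) :=
    (contDiff_eta.dilate r).continuous.comp (continuous_const.sub continuous_id)
  have hc : HasCompactSupport fun y => dilate r (eta N) (x - y) :=
    (isTestFunction_dilate contDiff_eta eta_eq_zero hr x (subset_univ _)).2.1
  have h1 : avg g r x - g x = ∫ y, (g y - g x) * dilate r (eta N) (x - y) := by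
    have h2 : g x = ∫ y, g x * dilate r (eta N) (x - y) := by
      rw [integral_const_mul, integral_dilate_eta_sub hr, mul_one]
    conv_lhs => rw [h2]
    rw [avg, ← integral_sub hint ((hcont.integrable_of_hasCompactSupport hc).const_mul _)]
    congr 1; funext y; ring
  have h3 : ∫ y, (g y - g x) * dilate r (eta N) (x - y) =
      ∫ y in Metric.closedBall x r, (g y - g x) * dilate r (eta N) (x - y) := by
    refine (setIntegral_eq_integral_of_forall_compl_eq_zero fun y hy => ?_).symm
    rw [dilate_eq_zero eta_eq_zero hr, mul_zero]
    rw [Metric.mem_closedBall, not_le, dist_comm, dist_eq_norm] at hy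
    exact hy.le
  rw [h1, h3, ← mul_assoc, ← integral_const_mul]
  refine norm_integral_le_of_norm_le (f := fun y => (g y - g x) * dilate r (eta N) (x - y)) ?_ ?_
  · have : IntegrableOn (fun y => g y - g x) (Metric.closedBall x r) :=
      hg.integrableOn.sub (integrableOn_const (by exact measure_closedBall_lt_top.ne))
    exact this.abs.const_mul _
  · refine Eventually.of_forall fun y => ?_
    rw [Real.norm_eq_abs, abs_mul, mul_comm]
    gcongr
    rw [mul_comm]
    exact abs_dilate_le hC hr _

theorem ae_tendsto_avg {g : 𝔼 → ℝ} (hg : Integrable g) :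
    ∀ᵐ x, Tendsto (fun r : ℝ => avg g r x) (𝓝[>] 0) (𝓝 (g x)) := by
  obtain ⟨C, -, hC⟩ := abs_avg_sub_le hg
  filter_upwards [ae_tendsto_integral_closedBall hg] with x hx
  rw [tendsto_iff_norm_sub_tendsto_zero]
  have h2 := hx.const_mul C
  rw [mul_zero] at h2
  refine tendsto_of_tendsto_of_tendsto_of_le_of_le' tendsto_const_nhds h2
    (Eventually.of_forall fun _ => norm_nonneg _) ?_
  filter_upwards [self_mem_nhdsWithin] with r hr using hC x r hr

/-- The two one-sided bounds make the averages Cauchy in r at rate r². The limit is continuous as a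
locally uniform limit of smooth functions, and it agrees with `g` wherever the averages converge to
`g`. -/
theorem exists_continuous_rep {U : Set 𝔼} (hU : IsOpen U) {g : 𝔼 → ℝ} (hg : Integrable g) {M : ℝ}
    (hM : 0 ≤ M) (h1 : WeakLaplGe U g (-M)) (h2 : WeakLaplGe U (fun y => - g y) (-M)) :
    ∃ w : 𝔼 → ℝ, ContinuousOn w U ∧ (∀ᵐ x ∂(volume.restrict U), w x = g x) ∧
      ∀ x r, 0 < r → Metric.closedBall x r ⊆ U → |avg g r x - w x| ≤ M * potMass N * r ^ 2 := by
  have hdiff : ∀ x s r, 0 < s → s ≤ r → Metric.closedBall x r ⊆ U →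
      |avg g r x - avg g s x| ≤ M * potMass N * r ^ 2 := by
    intro x s r hs hsr hV
    have h3 := avg_le_avg_add hg hM h1 hs hsr hV
    have h4 := avg_le_avg_add hg.neg hM h2 hs hsr hV
    change avg (fun y => - g y) s x ≤ avg (fun y => - g y) r x + _ at h4
    rw [avg_neg, avg_neg] at h4
    rw [abs_le]; constructor <;> linarith
  have hsmall : ∀ ε > 0, ∃ δ > 0, ∀ r, 0 < r → r < δ → M * potMass N * r ^ 2 < ε := by
    intro ε hε
    have : Tendsto (fun r : ℝ => M * potMass N * r ^ 2) (𝓝 0) (𝓝 0) := by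
      have : Continuous (fun r : ℝ => M * potMass N * r ^ 2) := by fun_prop
      simpa using this.tendsto 0
    obtain ⟨δ, hδ, hh⟩ := Metric.eventually_nhds_iff.1 (this.eventually (gt_mem_nhds hε))
    exact ⟨δ, hδ, fun r hr hrd => hh (by simpa [abs_of_pos hr] using hrd)⟩
  have hlim : ∀ x ∈ U, ∃ l, Tendsto (fun r => avg g r x) (𝓝[>] 0) (𝓝 l) := by
    intro x hx
    obtain ⟨R, hR, hRU⟩ := Metric.nhds_basis_closedBall.mem_iff.1 (hU.mem_nhds hx)
    refine cauchy_map_iff_exists_tendsto.1 (Metric.cauchy_iff.2 ⟨inferInstance, fun ε hε => ?_⟩)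
    obtain ⟨δ, hδ, hh⟩ := hsmall ε hε
    refine ⟨(fun r => avg g r x) '' Ioo 0 (min δ R), image_mem_map
      (Ioo_mem_nhdsGT (lt_min hδ hR)), ?_⟩
    have hlt : ∀ s r, 0 < s → s ≤ r → r < min δ R → dist (avg g r x) (avg g s x) < ε := by
      intro s r hs hsr hr
      refine (hdiff x s r hs hsr ((Metric.closedBall_subset_closedBall
        (hr.le.trans (min_le_right _ _))).trans hRU)).trans_lt (hh r (hs.trans_le hsr)
        (hr.trans_le (min_le_left _ _)))
    rintro _ ⟨a, ha, rfl⟩ _ ⟨b, hb, rfl⟩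
    rcases le_total a b with hab | hab
    · rw [dist_comm]; exact hlt a b ha.1 hab hb.2
    · exact hlt b a hb.1 hab ha.2
  choose! w hw using hlim
  have hest : ∀ x r, 0 < r → Metric.closedBall x r ⊆ U →
      |avg g r x - w x| ≤ M * potMass N * r ^ 2 := by
    intro x r hr hrU
    have hx : x ∈ U := hrU (Metric.mem_closedBall_self hr.le)
    have ht : Tendsto (fun s => |avg g r x - avg g s x|) (𝓝[>] 0) (𝓝 |avg g r x - w x|) :=
      (tendsto_const_nhds.sub (hw x hx)).abs
    refine le_of_tendsto ht ?_
    filter_upwards [Ioo_mem_nhdsGT hr] with s hs using hdiff x s r hs.1 hs.2.le hrU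
  refine ⟨w, fun x hx => ?_, ?_, hest⟩
  · refine ContinuousAt.continuousWithinAt ?_
    obtain ⟨R, hR, hRU⟩ := Metric.nhds_basis_closedBall.mem_iff.1 (hU.mem_nhds hx)
    refine continuousAt_of_locally_uniform_approx_of_continuousAt fun u hu => ?_
    obtain ⟨ε, hε, hεu⟩ := Metric.mem_uniformity_dist.1 hu
    obtain ⟨δ, hδ, hh⟩ := hsmall ε hε
    -- The first term makes the error less than ε, the second keeps the r-balls about points of the
    -- half-radius ball inside `U`.
    set r := min (δ / 2) (R / 2) with hr
    have hr0 : 0 < r := by positivity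
    refine ⟨Metric.ball x (R / 2), Metric.ball_mem_nhds _ (by linarith), avg g r,
      (contDiff_avg hg hr0).continuous.continuousAt, fun y hy => hεu ?_⟩
    rw [dist_comm]
    refine (hest y r hr0 (subset_trans ?_ hRU)).trans_lt (hh r hr0 ?_)
    · refine Metric.closedBall_subset_closedBall' ?_
      have := min_le_right (δ / 2) (R / 2)
      rw [Metric.mem_ball] at hy
      linarith
    · have := min_le_left (δ / 2) (R / 2)
      linarith
  · filter_upwards [ae_restrict_of_ae (ae_tendsto_avg hg), ae_restrict_mem hU.measurableSet]
      with x hx hxU using tendsto_nhds_unique (hw x hxU) hx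

end Averages

/-! ### The weak differential inequalities satisfied by a variational solution. -/

section EulerLagrange

variable {N : ℕ}

local notation "𝔼" => EuclideanSpace ℝ (Fin N)

theorem MeasureTheory.LocallyIntegrableOn.integrable_smul_test {F : Type*} [NormedAddCommGroup F]
    [NormedSpace ℝ F] {U : Set 𝔼} {w : 𝔼 → F} (hw : LocallyIntegrableOn w U volume) {φ : 𝔼 → ℝ}
    (hφ : IsTestFunction U φ) : Integrable (fun x => φ x • w x) (volume.restrict U) := by
  have h1 : IntegrableOn w (tsupport φ) := hw.integrableOn_compact_subset hφ.2.2 hφ.2.1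
  have h2 : IntegrableOn (fun x => φ x • w x) (tsupport φ) :=
    h1.continuousOn_smul hφ.continuous.continuousOn hφ.2.1
  refine (h2.integrable_of_forall_notMem_eq_zero fun x hx => ?_).integrableOn
  rw [image_eq_zero_of_notMem_tsupport hx, zero_smul]

theorem setIntegral_mul_test {U : Set 𝔼} {φ : 𝔼 → ℝ} (hφ : IsTestFunction U φ) (w : 𝔼 → ℝ) :
    ∫ x in U, w x * φ x = ∫ x, w x * φ x :=
  setIntegral_eq_integral_of_forall_compl_eq_zero fun x hx => by
    rw [hφ.eq_zero_of_notMem hx, mul_zero]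

theorem HasWeakGradient.integral_lapl {U : Set 𝔼} {w : 𝔼 → ℝ} {G : 𝔼 → 𝔼}
    (h : HasWeakGradient U w G) {ψ : 𝔼 → ℝ} (hψ : IsTestFunction U ψ) :
    ∫ x in U, w x * lapl ψ x = - ∫ x in U, inner ℝ (G x) (gradient ψ x) := by
  simp only [inner_gradient_eq_sum, lapl, Finset.mul_sum]
  rw [integral_finsetSum, integral_finsetSum, ← Finset.sum_neg_distrib]
  · refine Finset.sum_congr rfl fun i _ => ?_
    have := h.2.2 _ (hψ.partialDeriv i) (EuclideanSpace.single i 1)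
    change ∫ x in U, w x * partialDeriv i (partialDeriv i ψ) x = _ at this
    rw [this]
    congr 2; funext x
    rw [EuclideanSpace.inner_single_right]
    simp [mul_comm]
  · intro i _
    have := (h.2.1.integrable_smul_test (hψ.partialDeriv i)).inner_const
      (𝕜 := ℝ) (EuclideanSpace.single i 1)
    refine this.congr (Eventually.of_forall fun x => ?_)
    simp [EuclideanSpace.inner_single_right, mul_comm, inner_smul_left]
  · intro i _
    refine (h.1.integrable_smul_test ((hψ.partialDeriv i).partialDeriv i)).congr
      (Eventually.of_forall fun x => ?_)
    simp [mul_comm]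

theorem HasWeakGradient.integrable_inner_gradient {U : Set 𝔼} {w : 𝔼 → ℝ} {G : 𝔼 → 𝔼}
    (h : HasWeakGradient U w G) {ψ : 𝔼 → ℝ} (hψ : IsTestFunction U ψ) :
    Integrable (fun x => inner ℝ (G x) (gradient ψ x)) (volume.restrict U) := by
  simp only [inner_gradient_eq_sum]
  refine integrable_finsetSum _ fun i _ => ?_
  have := (h.2.1.integrable_smul_test (hψ.partialDeriv i)).inner_const
      (𝕜 := ℝ) (EuclideanSpace.single i 1)
  refine this.congr (Eventually.of_forall fun x => ?_)
  simp [EuclideanSpace.inner_single_right, mul_comm, inner_smul_left]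

theorem integral_mul_fderiv_test {U : Set 𝔼} {ψ φ : 𝔼 → ℝ} (hψ : ContDiff ℝ ∞ ψ)
    (hφ : IsTestFunction U φ) (e : 𝔼) :
    ∫ x in U, ψ x * fderiv ℝ φ x e = - ∫ x in U, φ x * inner ℝ (gradient ψ x) e := by
  have hc : HasCompactSupport fun x => fderiv ℝ φ x e := hφ.2.1.fderiv_apply ℝ e
  have hcont : Continuous fun x => fderiv ℝ φ x e :=
    (hφ.1.continuous_fderiv (by simp)).clm_apply continuous_const
  have hcont' : Continuous fun x => fderiv ℝ ψ x e :=
    (hψ.continuous_fderiv (by simp)).clm_apply continuous_const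
  rw [setIntegral_eq_integral_of_forall_compl_eq_zero, setIntegral_eq_integral_of_forall_compl_eq_zero,
    integral_mul_fderiv_eq_neg_fderiv_mul_of_integrable]
  · congr 2; funext x
    rw [inner_gradient_left, mul_comm]
  · exact (hcont'.mul hφ.continuous).integrable_of_hasCompactSupport hφ.2.1.mul_left
  · exact (hψ.continuous.mul hcont).integrable_of_hasCompactSupport hc.mul_left
  · exact (hψ.continuous.mul hφ.continuous).integrable_of_hasCompactSupport hφ.2.1.mul_left
  · exact fun x _ => hψ.contDiffAt.differentiableAt (by simp)
  · exact fun x _ => hφ.1.contDiffAt.differentiableAt (by simp)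
  · intro x hx
    rw [hφ.eq_zero_of_notMem hx, zero_mul]
  · intro x hx
    have : x ∉ tsupport fun x => fderiv ℝ φ x e := fun h =>
      hx (hφ.2.2 (tsupport_fderiv_apply_subset ℝ e h))
    rw [image_eq_zero_of_notMem_tsupport this, mul_zero]

theorem HasH1LocGradient.add_smul_test {U : Set 𝔼} {u : 𝔼 → ℝ} {G : 𝔼 → 𝔼}
    (h : HasH1LocGradient U u G) {ψ : 𝔼 → ℝ} (hψ : IsTestFunction U ψ) (s : ℝ) :
    HasH1LocGradient U (fun x => u x + s * ψ x) (fun x => G x + s • gradient ψ x) := by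
  have hg : Continuous (gradient ψ) := continuous_gradient hψ.1
  refine ⟨⟨h.1.1.add ?_, h.1.2.1.add ?_, fun φ hφ e => ?_⟩, fun K hK hKU => ?_⟩
  · exact (continuous_const.mul hψ.continuous).locallyIntegrable.locallyIntegrableOn U
  · exact (hg.const_smul s).locallyIntegrable.locallyIntegrableOn U
  · have hi1 : Integrable (fun x => u x * fderiv ℝ φ x e) (volume.restrict U) := by
      have ht : IsTestFunction U (fun x => fderiv ℝ φ x e) :=
        ⟨(hφ.1.fderiv_right (m := ∞) (by simp)).clm_apply contDiff_const, hφ.2.1.fderiv_apply ℝ e,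
          (tsupport_fderiv_apply_subset ℝ e).trans hφ.2.2⟩
      refine (h.1.1.integrable_smul_test ht).congr (Eventually.of_forall fun x => ?_)
      simp [mul_comm]
    have hi2 : Integrable (fun x => ψ x * fderiv ℝ φ x e) (volume.restrict U) :=
      ((hψ.continuous.mul ((hφ.1.continuous_fderiv (by simp)).clm_apply
        continuous_const)).integrable_of_hasCompactSupport hψ.2.1.mul_right).integrableOn
    have hi3 : Integrable (fun x => φ x * inner ℝ (G x) e) (volume.restrict U) := by
      refine ((h.1.2.1.integrable_smul_test hφ).inner_const e).congr
        (Eventually.of_forall fun x => ?_)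
      simp [inner_smul_left]
    have hi4 : Integrable (fun x => φ x * inner ℝ (gradient ψ x) e) (volume.restrict U) :=
      ((hφ.continuous.mul (hg.inner continuous_const)).integrable_of_hasCompactSupport
        hφ.2.1.mul_right).integrableOn
    have e1 : ∀ x, (u x + s * ψ x) * fderiv ℝ φ x e =
        u x * fderiv ℝ φ x e + s * (ψ x * fderiv ℝ φ x e) := fun x => by ring
    have e2 : ∀ x, φ x * inner ℝ (G x + s • gradient ψ x) e =
        φ x * inner ℝ (G x) e + s * (φ x * inner ℝ (gradient ψ x) e) := fun x => by
      rw [inner_add_left, real_inner_smul_left]; ring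
    simp only [e1, e2]
    rw [integral_add hi1 (hi2.const_mul s), integral_add hi3 (hi4.const_mul s),
      integral_const_mul, integral_const_mul, h.1.2.2 φ hφ e, integral_mul_fderiv_test hψ.1 hφ e]
    ring
  · obtain ⟨h1, h2⟩ := h.2 K hK hKU
    refine ⟨h1.add ?_, h2.add ?_⟩
    · exact ((hψ.continuous.memLp_of_hasCompactSupport hψ.2.1).restrict K).const_mul s
    · exact ((hg.memLp_of_hasCompactSupport hψ.2.1.gradient).restrict K).const_smul s

/-- Energy comparison along `u + s ψ`. -/
theorem exists_energy_comparison {U A : Set 𝔼} {u : 𝔼 → ℝ} (hU : IsOpen U)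
    (h : IsVariationalSolution U A u) (hAm : MeasurableSet A) (hui : IntegrableOn u U)
    {ψ : 𝔼 → ℝ} (hψ : IsTestFunction U ψ) :
    ∃ b : ℝ, ∀ s : ℝ, 0 ≤ -s * (∫ x in U, u x * lapl ψ x) + s ^ 2 * b +
      ∫ x in U, A.indicator (fun x => max (u x + s * ψ x) 0 - u x) x := by
  obtain ⟨hu0, G, hG, hvar⟩ := h
  have hg : Continuous (gradient ψ) := continuous_gradient hψ.1
  refine ⟨∫ x in U, 1 / 2 * ‖gradient ψ x‖ ^ 2, fun s => ?_⟩
  have h1 := hvar _ _ (hG.add_smul_test hψ s) ⟨tsupport ψ, hψ.2.1, hψ.2.2, by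
    filter_upwards [ae_restrict_mem
      (hU.measurableSet.diff (isClosed_tsupport ψ).measurableSet)] with x hx
    rw [image_eq_zero_of_notMem_tsupport hx.2]; simp⟩
  have e1 : ∀ x, ((1 / 2 * ‖G x + s • gradient ψ x‖ ^ 2 +
      A.indicator (fun y => max (u y + s * ψ y) 0) x) - (1 / 2 * ‖G x‖ ^ 2 + A.indicator u x)) =
      s * inner ℝ (G x) (gradient ψ x) + s ^ 2 * (1 / 2 * ‖gradient ψ x‖ ^ 2) +
        A.indicator (fun x => max (u x + s * ψ x) 0 - u x) x := by
    intro x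
    rw [norm_add_sq_real, real_inner_smul_right, norm_smul, mul_pow, Real.norm_eq_abs, sq_abs]
    by_cases hx : x ∈ A <;> simp [hx] <;> ring
  -- As u ≥ 0, taking the positive part does not increase the displacement beyond |s ψ|.
  have hi3 : Integrable (A.indicator fun x => max (u x + s * ψ x) 0 - u x)
      (volume.restrict U) := by
    refine Integrable.indicator ?_ hAm
    refine ((hψ.integrable.integrableOn (s := U)).abs.const_mul |s|).mono' ?_ ?_
    · exact ((hui.aestronglyMeasurable.add (continuous_const.mul
        hψ.continuous).aestronglyMeasurable).sup aestronglyMeasurable_const).sub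
        hui.aestronglyMeasurable
    · filter_upwards [hu0] with x hx
      rw [Real.norm_eq_abs, ← abs_mul, abs_le]
      have := neg_abs_le (s * ψ x)
      have := le_abs_self (s * ψ x)
      constructor
      · have := le_max_left (u x + s * ψ x) 0
        linarith
      · have : max (u x + s * ψ x) 0 ≤ u x + |s * ψ x| := max_le (by linarith) (by positivity)
        linarith
  have hi1 := (hG.1.integrable_inner_gradient hψ).const_mul s
  have hi2 : Integrable (fun x => s ^ 2 * (1 / 2 * ‖gradient ψ x‖ ^ 2)) (volume.restrict U) := by
    have : Continuous (fun x => s ^ 2 * (1 / 2 * ‖gradient ψ x‖ ^ 2)) := by fun_prop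
    refine (this.integrable_of_hasCompactSupport ?_).integrableOn
    refine HasCompactSupport.intro hψ.2.1.gradient fun x hx => ?_
    rw [image_eq_zero_of_notMem_tsupport hx]; simp
  simp only [e1] at h1
  rw [integral_add (by exact hi1.add hi2) hi3, integral_add hi1 hi2, integral_const_mul,
    integral_const_mul] at h1
  rw [hG.1.integral_lapl hψ]
  linarith

/-- For s > 0 the competitor u + s ψ stays nonnegative, so the obstacle term is linear in s. Divide
the energy comparison by s and let s tend to 0. -/
theorem IsVariationalSolution.integral_lapl_le {U A : Set 𝔼} {u : 𝔼 → ℝ} (hU : IsOpen U)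
    (h : IsVariationalSolution U A u) (hAm : MeasurableSet A) (hui : IntegrableOn u U)
    {ψ : 𝔼 → ℝ} (hψ : IsTestFunction U ψ) (hψ0 : ∀ x, 0 ≤ ψ x) :
    ∫ x in U, u x * lapl ψ x ≤ ∫ x in U, A.indicator ψ x := by
  obtain ⟨b, hb⟩ := exists_energy_comparison hU h hAm hui hψ
  have h1 : ∀ s : ℝ, 0 < s → 0 ≤ -(∫ x in U, u x * lapl ψ x) + s * b +
      ∫ x in U, A.indicator ψ x := by
    intro s hs
    have h2 := hb s
    have h3 : ∫ x in U, A.indicator (fun x => max (u x + s * ψ x) 0 - u x) x =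
        s * ∫ x in U, A.indicator ψ x := by
      rw [← integral_const_mul]
      refine integral_congr_ae ?_
      filter_upwards [h.1] with x hx
      by_cases hxA : x ∈ A
      · simp only [hxA, indicator_of_mem]
        rw [max_eq_left (add_nonneg hx (mul_nonneg hs.le (hψ0 x)))]; ring
      · simp [hxA]
    rw [h3] at h2
    have : 0 ≤ s * (-(∫ x in U, u x * lapl ψ x) + s * b + ∫ x in U, A.indicator ψ x) := by
      linarith
    exact nonneg_of_mul_nonneg_right this hs
  have ht : Tendsto (fun s : ℝ => -(∫ x in U, u x * lapl ψ x) + s * b +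
      ∫ x in U, A.indicator ψ x) (𝓝[>] 0)
      (𝓝 (-(∫ x in U, u x * lapl ψ x) + 0 * b + ∫ x in U, A.indicator ψ x)) := by
    have : Continuous (fun s : ℝ => -(∫ x in U, u x * lapl ψ x) + s * b +
      ∫ x in U, A.indicator ψ x) := by fun_prop
    exact (this.tendsto 0).mono_left nhdsWithin_le_nhds
  have := ge_of_tendsto ht (by filter_upwards [self_mem_nhdsWithin] with s hs using h1 s hs)
  linarith

/-- Taking s = -1/(n+1), the competitor may become negative, and the obstacle term drops by only
min((n+1) u, ψ)/(n+1) on `A`. After division by |s| this tends to ψ where u > 0 and to 0 where u =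
0, which is why the positivity set appears. -/
theorem IsVariationalSolution.le_integral_lapl {U A : Set 𝔼} {u : 𝔼 → ℝ} (hU : IsOpen U)
    (h : IsVariationalSolution U A u) (hAm : MeasurableSet A) (hui : IntegrableOn u U)
    {ψ : 𝔼 → ℝ} (hψ : IsTestFunction U ψ) (hψ0 : ∀ x, 0 ≤ ψ x) :
    ∫ x in U, (A ∩ {x | 0 < u x}).indicator ψ x ≤ ∫ x in U, u x * lapl ψ x := by
  obtain ⟨b, hb⟩ := exists_energy_comparison hU h hAm hui hψ
  have h1 : ∀ n : ℕ, ∫ x in U, A.indicator (fun x => min ((n + 1) * u x) (ψ x)) x ≤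
      (∫ x in U, u x * lapl ψ x) + (1 / ((n : ℝ) + 1)) * b := by
    intro n
    have hn : (0 : ℝ) < n + 1 := by positivity
    have h2 := hb (-(1 / (n + 1)))
    have h3 : ∫ x in U, A.indicator (fun x => max (u x + -(1 / (n + 1)) * ψ x) 0 - u x) x =
        -(1 / (n + 1)) * ∫ x in U, A.indicator (fun x => min ((n + 1) * u x) (ψ x)) x := by
      rw [← integral_const_mul]
      refine integral_congr_ae (Eventually.of_forall fun x => ?_)
      by_cases hxA : x ∈ A
      · simp only [hxA, indicator_of_mem]
        have e1 : (n + 1) * u x - ψ x = (n + 1) * (u x + -(1 / (n + 1)) * ψ x) := by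
          field_simp; ring
        rcases le_total ((n + 1) * u x) (ψ x) with hle | hle
        · rw [min_eq_left hle, max_eq_right (by nlinarith)]
          field_simp; ring
        · rw [min_eq_right hle, max_eq_left (by nlinarith)]
          ring
      · simp [hxA]
    rw [h3] at h2
    have h4 : 0 ≤ (1 / ((n : ℝ) + 1)) * ((∫ x in U, u x * lapl ψ x) + (1 / ((n : ℝ) + 1)) * b -
        ∫ x in U, A.indicator (fun x => min ((n + 1) * u x) (ψ x)) x) := by linarith
    have := nonneg_of_mul_nonneg_right h4 (by positivity)
    linarith
  have hlim : Tendsto (fun n : ℕ => ∫ x in U, A.indicator (fun x => min ((n + 1) * u x) (ψ x)) x)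
      atTop (𝓝 (∫ x in U, (A ∩ {x | 0 < u x}).indicator ψ x)) := by
    refine tendsto_integral_of_dominated_convergence (fun x => |ψ x|) (fun n => ?_)
      hψ.integrable.integrableOn.abs (fun n => ?_) ?_
    · exact ((hui.aestronglyMeasurable.const_mul _).inf
        hψ.continuous.aestronglyMeasurable).indicator hAm
    · filter_upwards [h.1] with x hx
      by_cases hxA : x ∈ A
      · simp only [hxA, indicator_of_mem, Real.norm_eq_abs]
        rw [abs_of_nonneg (le_min (by positivity) (hψ0 x)), abs_of_nonneg (hψ0 x)]
        exact min_le_right _ _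
      · simp [hxA]
    · filter_upwards [h.1] with x hx
      by_cases hxA : x ∈ A
      · rcases hx.eq_or_lt with h0 | h0
        · simp [hxA, ← h0, hψ0 x]
        · have : x ∈ A ∩ {x | 0 < u x} := ⟨hxA, h0⟩
          simp only [hxA, this, indicator_of_mem]
          refine tendsto_const_nhds.congr' ?_
          have ht : Tendsto (fun n : ℕ => ((n : ℝ) + 1) * u x) atTop atTop :=
            (tendsto_natCast_atTop_atTop.atTop_add tendsto_const_nhds).atTop_mul_const h0
          filter_upwards [ht.eventually_ge_atTop (ψ x)] with n hn
          rw [min_eq_right hn]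
      · simp [hxA]
  have hlim2 : Tendsto (fun n : ℕ => (∫ x in U, u x * lapl ψ x) + (1 / ((n : ℝ) + 1)) * b) atTop
      (𝓝 ((∫ x in U, u x * lapl ψ x) + 0 * b)) :=
    tendsto_const_nhds.add (tendsto_one_div_add_atTop_nhds_zero_nat.mul_const b)
  have := le_of_tendsto_of_tendsto' hlim hlim2 h1
  linarith

end EulerLagrange

/-! ### Continuous representatives, quadratic growth and the exact equation. -/

section Regularity

variable {N : ℕ}

local notation "𝔼" => EuclideanSpace ℝ (Fin N)

/-- `g` is the continuous representative in `U` of a solution of the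
obstacle problem, understood as the pair of inequalities `χ_{A ∩ {g > 0}} ≤ Δg ≤ χ_A`. -/
structure IsObstacleRep (U A : Set 𝔼) (g : 𝔼 → ℝ) : Prop where
  isOpen : IsOpen U
  measurableSet : MeasurableSet A
  subset : A ⊆ U
  continuousOn : ContinuousOn g U
  nonneg : ∀ x, 0 ≤ g x
  integrable : Integrable g
  lower : ∀ ψ, IsTestFunction U ψ → (∀ x, 0 ≤ ψ x) →
    ∫ x, (A ∩ {x | 0 < g x}).indicator ψ x ≤ ∫ x, g x * lapl ψ x
  upper : ∀ ψ, IsTestFunction U ψ → (∀ x, 0 ≤ ψ x) →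
    ∫ x, g x * lapl ψ x ≤ ∫ x, A.indicator ψ x
  abs_avg_sub_le : ∀ x r, 0 < r → Metric.closedBall x r ⊆ U →
    |avg g r x - g x| ≤ potMass N * r ^ 2

theorem setIntegral_indicator_test {U A : Set 𝔼} {ψ : 𝔼 → ℝ} (hψ : IsTestFunction U ψ) :
    ∫ x in U, A.indicator ψ x = ∫ x, A.indicator ψ x :=
  setIntegral_eq_integral_of_forall_compl_eq_zero fun x hx => by
    rw [indicator_apply_eq_zero]; exact fun _ => hψ.eq_zero_of_notMem hx

theorem avg_nonneg {g : 𝔼 → ℝ} (hg : ∀ᵐ x, 0 ≤ g x) {r : ℝ} (hr : 0 < r) (x : 𝔼) :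
    0 ≤ avg g r x :=
  integral_nonneg_of_ae (by
    filter_upwards [hg] with y hy using mul_nonneg hy (dilate_eta_nonneg hr _))

theorem tendsto_const_mul_sq_nhdsGT (C : ℝ) :
    Tendsto (fun r : ℝ => C * r ^ 2) (𝓝[>] 0) (𝓝 0) := by
  have : Continuous (fun r : ℝ => C * r ^ 2) := by fun_prop
  simpa using (this.tendsto 0).mono_left nhdsWithin_le_nhds

theorem eventually_closedBall_subset_of_isOpen {U : Set 𝔼} (hU : IsOpen U) {x : 𝔼} (hx : x ∈ U) :
    ∀ᶠ r : ℝ in 𝓝[>] 0, Metric.closedBall x r ⊆ U := by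
  obtain ⟨R, hR, hRU⟩ := Metric.nhds_basis_closedBall.mem_iff.1 (hU.mem_nhds hx)
  filter_upwards [Ioo_mem_nhdsGT hR] with r hr
  exact (Metric.closedBall_subset_closedBall hr.2.le).trans hRU

/-- Extension by zero outside `U` turns all integrals into integrals over the whole space. The limit
of averages is nonnegative everywhere, not merely almost everywhere, because the averages of `u`
are. -/
theorem IsVariationalSolution.exists_isObstacleRep {U A : Set 𝔼} {u : 𝔼 → ℝ} (hU : IsOpen U)
    (h : IsVariationalSolution U A u) (hAm : MeasurableSet A) (hAU : A ⊆ U)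
    (hui : IntegrableOn u U) :
    ∃ g, IsObstacleRep U A g ∧ ∀ᵐ x ∂(volume.restrict U), g x = u x := by
  set g₀ : 𝔼 → ℝ := U.indicator u with hg₀
  have hgi : Integrable g₀ := hui.integrable_indicator hU.measurableSet
  have hlap : ∀ ψ, IsTestFunction U ψ → ∫ x, g₀ x * lapl ψ x = ∫ x in U, u x * lapl ψ x := by
    intro ψ hψ
    rw [← integral_indicator hU.measurableSet]
    congr 1; funext x
    by_cases hx : x ∈ U <;> simp [hg₀, hx]
  have hind : ∀ ψ, IsTestFunction U ψ → (∀ x, 0 ≤ ψ x) → ∫ x, A.indicator ψ x ≤ ∫ x, ψ x :=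
    fun ψ hψ h0 => integral_mono (hψ.integrable.indicator hAm) hψ.integrable
      fun x => indicator_le_self' (fun x _ => h0 x) x
  have hup : ∀ ψ, IsTestFunction U ψ → (∀ x, 0 ≤ ψ x) →
      ∫ x, g₀ x * lapl ψ x ≤ ∫ x, A.indicator ψ x := fun ψ hψ h0 => by
    rw [hlap ψ hψ, ← setIntegral_indicator_test hψ]
    exact h.integral_lapl_le hU hAm hui hψ h0
  have hlo : ∀ ψ, IsTestFunction U ψ → (∀ x, 0 ≤ ψ x) →
      ∫ x, (A ∩ {x | 0 < u x}).indicator ψ x ≤ ∫ x, g₀ x * lapl ψ x := fun ψ hψ h0 => by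
    rw [hlap ψ hψ, ← setIntegral_indicator_test hψ]
    exact h.le_integral_lapl hU hAm hui hψ h0
  have hw1 : WeakLaplGe U g₀ (-1) := fun ψ hψ h0 => by
    have h1 : 0 ≤ ∫ x, (A ∩ {x | 0 < u x}).indicator ψ x :=
      integral_nonneg fun x => indicator_nonneg (fun x _ => h0 x) x
    have h2 : 0 ≤ ∫ x, ψ x := integral_nonneg h0
    linarith [hlo ψ hψ h0]
  have hw2 : WeakLaplGe U (fun y => - g₀ y) (-1) := fun ψ hψ h0 => by
    simp only [neg_mul, one_mul]
    rw [integral_neg]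
    exact neg_le_neg ((hup ψ hψ h0).trans (hind ψ hψ h0))
  obtain ⟨w, hwc, hwae, hwest⟩ := exists_continuous_rep hU hgi zero_le_one hw1 hw2
  simp only [one_mul] at hwest
  have hg0 : ∀ᵐ x, 0 ≤ g₀ x := by
    have := h.1
    rw [ae_restrict_iff' hU.measurableSet] at this
    filter_upwards [this] with x hx
    exact indicator_apply_nonneg hx
  set g : 𝔼 → ℝ := U.indicator w with hg
  have hgU : ∀ x ∈ U, g x = w x := fun x hx => indicator_of_mem hx w
  have hgg₀ : g =ᵐ[volume] g₀ := by
    rw [ae_restrict_iff' hU.measurableSet] at hwae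
    filter_upwards [hwae] with x hx
    by_cases hxU : x ∈ U
    · rw [hgU x hxU, hx hxU]
    · simp [hg, hg₀, hxU]
  have hgu : ∀ᵐ x ∂(volume.restrict U), g x = u x := by
    filter_upwards [ae_restrict_of_ae hgg₀, ae_restrict_mem hU.measurableSet] with x hx hxU
    rw [hx, hg₀, indicator_of_mem hxU]
  have havg : ∀ r x, avg g r x = avg g₀ r x := fun r x => integral_congr_ae (by
    filter_upwards [hgg₀] with y hy; rw [hy])
  have hlap' : ∀ ψ : 𝔼 → ℝ, ∫ x, g x * lapl ψ x = ∫ x, g₀ x * lapl ψ x := fun ψ =>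
    integral_congr_ae (by filter_upwards [hgg₀] with y hy; rw [hy])
  refine ⟨g, ⟨hU, hAm, hAU, hwc.congr hgU, fun x => ?_,
    hgi.congr hgg₀.symm, fun ψ hψ h0 => ?_, fun ψ hψ h0 => ?_, fun x r hr hrU => ?_⟩, hgu⟩
  · refine indicator_apply_nonneg fun hx => ?_
    have ht := (tendsto_const_mul_sq_nhdsGT (potMass N)).add_const (w x)
    rw [zero_add] at ht
    refine ge_of_tendsto ht ?_
    filter_upwards [self_mem_nhdsWithin, eventually_closedBall_subset_of_isOpen hU hx] with r hr hrU
    have h1 := (abs_le.1 (hwest x r hr hrU)).2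
    have h2 := avg_nonneg hg0 hr x
    linarith
  · rw [hlap']
    refine le_trans (le_of_eq ?_) (hlo ψ hψ h0)
    refine integral_congr_ae ?_
    rw [Filter.EventuallyEq]
    rw [ae_restrict_iff' hU.measurableSet] at hgu
    filter_upwards [hgu] with x hx
    by_cases hxA : x ∈ A
    · have := hx (hAU hxA)
      simp [indicator, hxA, this]
    · simp [indicator, hxA]
  · rw [hlap']; exact hup ψ hψ h0
  · rw [havg, hgU x (hrU (Metric.mem_closedBall_self hr.le))]
    exact hwest x r hr hrU

namespace IsObstacleRep

theorem weakLaplGe_zero {U A : Set 𝔼} {g : 𝔼 → ℝ} (h : IsObstacleRep U A g) : WeakLaplGe U g 0 := fun ψ hψ h0 => by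
  rw [zero_mul]
  exact (integral_nonneg fun x => indicator_nonneg (fun x _ => h0 x) x).trans (h.lower ψ hψ h0)

theorem tendsto_avg {U A : Set 𝔼} {g : 𝔼 → ℝ} (h : IsObstacleRep U A g) {x : 𝔼} (hx : x ∈ U) :
    Tendsto (fun r => avg g r x) (𝓝[>] 0) (𝓝 (g x)) := by
  rw [tendsto_iff_norm_sub_tendsto_zero]
  refine tendsto_of_tendsto_of_tendsto_of_le_of_le' tendsto_const_nhds
    (tendsto_const_mul_sq_nhdsGT (potMass N)) (Eventually.of_forall fun _ => norm_nonneg _) ?_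
  filter_upwards [self_mem_nhdsWithin, eventually_closedBall_subset_of_isOpen h.isOpen hx] with r hr hrU
  exact h.abs_avg_sub_le x r hr hrU

theorem le_avg {U A : Set 𝔼} {g : 𝔼 → ℝ} (h : IsObstacleRep U A g) {x : 𝔼} {r : ℝ} (hr : 0 < r)
    (hrU : Metric.closedBall x r ⊆ U) : g x ≤ avg g r x := by
  refine le_of_tendsto (h.tendsto_avg (hrU (Metric.mem_closedBall_self hr.le))) ?_
  filter_upwards [Ioo_mem_nhdsGT hr] with s hs
  simpa using avg_le_avg_add h.integrable le_rfl (by simpa using h.weakLaplGe_zero) hs.1 hs.2.le hrU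

theorem avg_le {U A : Set 𝔼} {g : 𝔼 → ℝ} (h : IsObstacleRep U A g) {x : 𝔼} {r : ℝ} (hr : 0 < r)
    (hrU : Metric.closedBall x r ⊆ U) : avg g r x ≤ g x + potMass N * r ^ 2 := by
  have := (abs_le.1 (h.abs_avg_sub_le x r hr hrU)).2
  linarith

/-- Strong maximum principle: off `A`, the zero set is open. -/
theorem eventually_eq_zero {U A : Set 𝔼} {g : 𝔼 → ℝ} (h : IsObstacleRep U A g) {V : Set 𝔼} (hV : IsOpen V) (hVU : V ⊆ U)
    (hVA : Disjoint V A) {x : 𝔼} (hx : x ∈ V) (hgx : g x = 0) : ∀ᶠ y in 𝓝 x, g y = 0 := by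
  have hw : WeakLaplGe V (fun y => - g y) (-0) := fun ψ hψ h0 => by
    simp only [neg_mul, neg_zero, zero_mul]
    rw [integral_neg, neg_nonneg]
    refine (h.upper ψ (hψ.mono hVU) h0).trans (le_of_eq ?_)
    refine integral_eq_zero_of_ae (Eventually.of_forall fun y => ?_)
    rw [Pi.zero_apply, indicator_apply_eq_zero]
    exact fun hyA => hψ.eq_zero_of_notMem fun hyV => hVA.le_bot ⟨hyV, hyA⟩
  obtain ⟨r, hr, hrV⟩ := Metric.nhds_basis_closedBall.mem_iff.1 (hV.mem_nhds hx)
  -- Off `A` the function is superharmonic too, so its average at a zero vanishes. The integrand is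
  -- nonnegative and the kernel positive in the open ball, which forces g = 0 there.
  have h1 : avg g r x ≤ g x := by
    refine ge_of_tendsto (h.tendsto_avg (hVU hx)) ?_
    filter_upwards [Ioo_mem_nhdsGT hr] with s hs
    have := avg_le_avg_add h.integrable.neg le_rfl hw hs.1 hs.2.le hrV
    change avg (fun y => - g y) s x ≤ avg (fun y => - g y) r x + _ at this
    rw [avg_neg, avg_neg] at this
    linarith
  have hnn : ∀ y, 0 ≤ g y * dilate r (eta N) (x - y) := fun y =>
    mul_nonneg (h.nonneg y) (dilate_eta_nonneg hr _)
  have h2 : ∫ y, g y * dilate r (eta N) (x - y) = 0 :=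
    le_antisymm (h1.trans hgx.le) (integral_nonneg hnn)
  rw [integral_eq_zero_iff_of_nonneg hnn
    (integrable_mul_dilate h.integrable contDiff_eta.continuous eta_eq_zero hr x)] at h2
  have hbU : Metric.ball x r ⊆ U := Metric.ball_subset_closedBall.trans (hrV.trans hVU)
  have h3 : EqOn g 0 (Metric.ball x r) := by
    refine Measure.eqOn_open_of_ae_eq (μ := volume) ?_ Metric.isOpen_ball (h.continuousOn.mono hbU)
      continuousOn_const
    filter_upwards [ae_restrict_of_ae h2, ae_restrict_mem Metric.isOpen_ball.measurableSet]
      with y hy hyb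
    rcases mul_eq_zero.1 hy with h4 | h4
    · exact h4
    · rw [Metric.mem_ball, dist_comm, dist_eq_norm] at hyb
      exact absurd h4 (dilate_eta_pos hyb).ne'
  filter_upwards [Metric.ball_mem_nhds x hr] with y hy using h3 hy

/-- The kernel of scale r at x is dominated by a fixed multiple of the kernel of scale 4r at x₀.
Subharmonicity bounds g(x) by the first average, and Δg ≤ 1 bounds the second by g(x₀) + O(r²). -/
theorem exists_quadratic_growth {U A : Set 𝔼} {g : 𝔼 → ℝ} (h : IsObstacleRep U A g) :
    ∃ C, 0 ≤ C ∧ ∀ x₀ r, 0 < r → Metric.closedBall x₀ (4 * r) ⊆ U → g x₀ = 0 →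
      ∀ x ∈ Metric.closedBall x₀ r, g x ≤ C * r ^ 2 := by
  obtain ⟨m, hm, hlow⟩ := exists_eta_lower_bound (N := N)
  obtain ⟨K, hK0, hK⟩ := exists_bound_of_eq_zero (contDiff_eta (N := N)).continuous eta_eq_zero
  -- Here K bounds the kernel above and m below, 4ᴺ is the ratio of the normalizations at scales r
  -- and 4r, and 16 r² is (4r)².
  refine ⟨K * 4 ^ N / m * (potMass N * 16), by have := potMass_nonneg (N := N); positivity,
    fun x₀ r hr hrU hx₀ x hx => ?_⟩
  have h4 : (0 : ℝ) < 4 * r := by linarith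
  have hxr : Metric.closedBall x r ⊆ U := (Metric.closedBall_subset_closedBall' (by
    rw [Metric.mem_closedBall] at hx; linarith)).trans hrU
  have hcmp : avg g r x ≤ K * 4 ^ N / m * avg g (4 * r) x₀ := by
    rw [avg, avg, ← integral_const_mul]
    refine integral_mono
      (integrable_mul_dilate h.integrable contDiff_eta.continuous eta_eq_zero hr x)
      ((integrable_mul_dilate h.integrable contDiff_eta.continuous eta_eq_zero h4 x₀).const_mul _)
      fun y => ?_
    have hgy := h.nonneg y
    have key : dilate r (eta N) (x - y) ≤ K * 4 ^ N / m * dilate (4 * r) (eta N) (x₀ - y) := by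
      rcases lt_or_ge ‖x - y‖ r with hxy | hxy
      · have h5 : ‖x₀ - y‖ ≤ 3 / 4 * (4 * r) := by
          rw [Metric.mem_closedBall, dist_comm, dist_eq_norm] at hx
          have : x₀ - y = (x₀ - x) + (x - y) := by abel
          rw [this]
          exact (norm_add_le _ _).trans (by linarith)
        have h6 := hlow h4 _ h5
        have h7 := (le_abs_self _).trans (abs_dilate_le hK hr (x - y))
        calc dilate r (eta N) (x - y) ≤ (r ^ N)⁻¹ * K := h7
          _ = K * 4 ^ N / m * (((4 * r) ^ N)⁻¹ * m) := by
            rw [mul_pow]; field_simp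
          _ ≤ _ := by gcongr
      · rw [dilate_eq_zero eta_eq_zero hr hxy]
        have := dilate_eta_nonneg h4 (x₀ - y)
        positivity
    calc g y * dilate r (eta N) (x - y)
        ≤ g y * (K * 4 ^ N / m * dilate (4 * r) (eta N) (x₀ - y)) := by gcongr
      _ = _ := by ring
  have h8 := h.avg_le h4 hrU
  rw [hx₀] at h8
  calc g x ≤ avg g r x := h.le_avg hr hxr
    _ ≤ K * 4 ^ N / m * avg g (4 * r) x₀ := hcmp
    _ ≤ K * 4 ^ N / m * (0 + potMass N * (4 * r) ^ 2) := by gcongr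
    _ = _ := by ring

theorem integrableOn_pos {U A : Set 𝔼} {g : 𝔼 → ℝ} (h : IsObstacleRep U A g) (hUf : volume U ≠ ⊤) :
    Integrable ((U ∩ {x | 0 < g x}).indicator (fun _ => (1 : ℝ))) := by
  refine IntegrableOn.integrable_indicator (integrableOn_const
    (measure_ne_top_of_subset inter_subset_left hUf)) ?_
  exact (h.continuousOn.isOpen_inter_preimage h.isOpen isOpen_Ioi).measurableSet

theorem measurableSet_pos {U A : Set 𝔼} {g : 𝔼 → ℝ} (h : IsObstacleRep U A g) : MeasurableSet (A ∩ {x | 0 < g x}) := by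
  have h1 : A ∩ {x | 0 < g x} = A ∩ (U ∩ {x | 0 < g x}) := by
    rw [← inter_assoc, inter_eq_left.2 h.subset]
  rw [h1]
  exact h.measurableSet.inter
    (h.continuousOn.isOpen_inter_preimage h.isOpen isOpen_Ioi).measurableSet

theorem lapl_avg_eq {U A : Set 𝔼} {g : 𝔼 → ℝ} (h : IsObstacleRep U A g) {r : ℝ} (hr : 0 < r) (x : 𝔼) :
    lapl (avg g r) x = ∫ y, g y * lapl (fun y => dilate r (eta N) (x - y)) y := by
  rw [lapl_avg h.integrable hr]
  simp only [lapl_comp_sub_left (contDiff_eta.dilate r)]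

theorem lapl_avg_nonneg {U A : Set 𝔼} {g : 𝔼 → ℝ} (h : IsObstacleRep U A g) {r : ℝ} (hr : 0 < r) {x : 𝔼}
    (hrU : Metric.closedBall x r ⊆ U) : 0 ≤ lapl (avg g r) x := by
  have := h.weakLaplGe_zero _ (isTestFunction_dilate contDiff_eta eta_eq_zero hr x hrU)
    fun y => dilate_eta_nonneg hr _
  rwa [zero_mul, ← h.lapl_avg_eq hr] at this

theorem lapl_avg_le_one {U A : Set 𝔼} {g : 𝔼 → ℝ} (h : IsObstacleRep U A g) {r : ℝ} (hr : 0 < r) {x : 𝔼}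
    (hrU : Metric.closedBall x r ⊆ U) : lapl (avg g r) x ≤ 1 := by
  have ht := isTestFunction_dilate contDiff_eta eta_eq_zero hr x hrU
  rw [h.lapl_avg_eq hr, ← integral_dilate_eta_sub (N := N) hr x]
  refine (h.upper _ ht fun y => dilate_eta_nonneg hr _).trans ?_
  exact integral_mono (ht.integrable.indicator h.measurableSet) ht.integrable
      fun y => indicator_le_self' (fun y _ => dilate_eta_nonneg hr _) y

/-- The Laplacians of the mollifications converge to `χ_{A ∩ {g > 0}}`: on the zero set by
quadratic growth and Lebesgue density, on the positivity set by the equation. -/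
theorem ae_tendsto_lapl_avg {U A : Set 𝔼} {g : 𝔼 → ℝ} (h : IsObstacleRep U A g) (hUf : volume U ≠ ⊤) :
    ∀ᵐ x, x ∈ U → Tendsto (fun r => lapl (avg g r) x) (𝓝[>] 0)
      (𝓝 ((A ∩ {x | 0 < g x}).indicator (fun _ => (1 : ℝ)) x)) := by
  have hAi : Integrable (A.indicator (fun _ => (1 : ℝ))) :=
    IntegrableOn.integrable_indicator (integrableOn_const
      (measure_ne_top_of_subset h.subset hUf)) h.measurableSet
  obtain ⟨C, hC0, hC⟩ := h.exists_quadratic_growth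
  obtain ⟨K, hK0, hK⟩ := exists_bound_of_eq_zero (contDiff_eta (N := N)).lapl.continuous
    fun z hz => lapl_eq_zero_of_one_le z hz (eta N) contDiff_eta eta_eq_zero
  filter_upwards [ae_tendsto_integral_closedBall (h.integrableOn_pos hUf), ae_tendsto_avg hAi]
    with x hx1 hx2 hxU
  -- At a zero, quadratic growth cancels the r⁻² of the second derivatives, leaving C K r⁻ᴺ times
  -- the volume of {g > 0} in the ball. This tends to zero at a Lebesgue point of the indicator.
  rcases (h.nonneg x).eq_or_lt with h0 | h0
  · have hnot : x ∉ A ∩ {x | 0 < g x} := fun hh => h0.not_lt hh.2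
    have hnot' : x ∉ U ∩ {x | 0 < g x} := fun hh => h0.not_lt hh.2
    rw [indicator_of_notMem hnot]
    have hlim := hx1.const_mul (C * K)
    rw [mul_zero] at hlim
    refine squeeze_zero_norm' ?_ hlim
    have h4 : ∀ᶠ r : ℝ in 𝓝[>] 0, Metric.closedBall x (4 * r) ⊆ U := by
      have ht : Tendsto (fun r : ℝ => 4 * r) (𝓝[>] 0) (𝓝[>] 0) := by
        refine tendsto_nhdsWithin_of_tendsto_nhds_of_eventually_within _ ?_ ?_
        · have : Continuous (fun r : ℝ => 4 * r) := by fun_prop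
          simpa using (this.tendsto 0).mono_left nhdsWithin_le_nhds
        · filter_upwards [self_mem_nhdsWithin] with r hr
          rw [mem_Ioi] at hr ⊢; linarith
      exact ht.eventually (eventually_closedBall_subset_of_isOpen h.isOpen hxU)
    filter_upwards [self_mem_nhdsWithin, h4] with r hr hrU
    rw [mem_Ioi] at hr
    have hz : ∀ y ∉ Metric.closedBall x r, g y * lapl (dilate r (eta N)) (x - y) = 0 := by
      intro y hy
      rw [lapl_dilate contDiff_eta, dilate_eq_zero (fun z hz => lapl_eq_zero_of_one_le z hz _
        contDiff_eta eta_eq_zero) hr, mul_zero, mul_zero]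
      rw [Metric.mem_closedBall, not_le, dist_comm, dist_eq_norm] at hy
      exact hy.le
    rw [lapl_avg h.integrable hr, ← setIntegral_eq_integral_of_forall_compl_eq_zero hz,
      ← mul_assoc, ← integral_const_mul]
    refine norm_integral_le_of_norm_le ?_ ?_
    · refine Integrable.const_mul ?_ _
      exact ((h.integrableOn_pos hUf).integrableOn.sub
        (integrableOn_const (by exact measure_closedBall_lt_top.ne))).abs
    · filter_upwards [ae_restrict_mem Metric.isClosed_closedBall.measurableSet] with y hy
      have hyU : y ∈ U := hrU (Metric.closedBall_subset_closedBall (by linarith) hy)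
      have hgy := hC x r hr hrU h0.symm y hy
      rw [indicator_of_notMem hnot', sub_zero, lapl_dilate contDiff_eta, Real.norm_eq_abs, abs_mul,
        abs_of_nonneg (h.nonneg y), abs_mul, abs_of_nonneg (by positivity : 0 ≤ r⁻¹ ^ 2)]
      rcases (h.nonneg y).eq_or_lt with hy0 | hy0
      · rw [← hy0, zero_mul]; positivity
      · rw [indicator_of_mem (show y ∈ U ∩ {x | 0 < g x} from ⟨hyU, hy0⟩), abs_one, mul_one]
        calc g y * (r⁻¹ ^ 2 * |dilate r (lapl (eta N)) (x - y)|)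
            ≤ (C * r ^ 2) * (r⁻¹ ^ 2 * ((r ^ N)⁻¹ * K)) := by
              gcongr
              exact abs_dilate_le hK hr _
          _ = C * K * (r ^ N)⁻¹ := by field_simp
  -- Small balls about a point of positivity stay in {g > 0}, where the lower and upper inequalities
  -- agree. The Laplacian of the average is then exactly the average of χ_A.
  · have hind : (A ∩ {x | 0 < g x}).indicator (fun _ => (1 : ℝ)) x =
        A.indicator (fun _ => (1 : ℝ)) x := by
      by_cases hxA : x ∈ A <;> simp [indicator, hxA, h0]
    rw [hind]
    refine hx2.congr' ?_
    have hO : IsOpen (U ∩ {x | 0 < g x}) :=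
      h.continuousOn.isOpen_inter_preimage h.isOpen isOpen_Ioi
    filter_upwards [self_mem_nhdsWithin, eventually_closedBall_subset_of_isOpen hO ⟨hxU, h0⟩] with r hr hrU
    rw [mem_Ioi] at hr
    have ht := isTestFunction_dilate contDiff_eta eta_eq_zero hr x hrU
    have e1 : ∫ y, A.indicator (fun y => dilate r (eta N) (x - y)) y =
        avg (A.indicator fun _ => (1 : ℝ)) r x := by
      rw [avg]; congr 1; funext y
      by_cases hy : y ∈ A <;> simp [hy]
    have e2 : ∀ y, (A ∩ {x | 0 < g x}).indicator (fun y => dilate r (eta N) (x - y)) y =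
        A.indicator (fun y => dilate r (eta N) (x - y)) y := by
      intro y
      by_cases hy : y ∈ A
      · by_cases hgy : 0 < g y
        · simp [indicator, hy, hgy]
        · have : y ∉ U ∩ {x | 0 < g x} := fun hh => hgy hh.2
          have := ht.eq_zero_of_notMem this
          simp only [indicator, this, ite_self]
      · simp [indicator, hy]
    have hlow := h.lower _ (ht.mono inter_subset_left) fun y => dilate_eta_nonneg hr _
    have hupp := h.upper _ (ht.mono inter_subset_left) fun y => dilate_eta_nonneg hr _
    simp only [e2] at hlow
    rw [h.lapl_avg_eq hr, ← e1]
    exact le_antisymm hlow hupp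

end IsObstacleRep

theorem eventually_closedBall_subset_of_isCompact {U K : Set 𝔼} (hU : IsOpen U) (hK : IsCompact K)
    (hKU : K ⊆ U) : ∀ᶠ r : ℝ in 𝓝[>] 0, ∀ x ∈ K, Metric.closedBall x r ⊆ U := by
  obtain ⟨δ, hδ, hh⟩ := hK.exists_cthickening_subset_open hU hKU
  filter_upwards [Ioo_mem_nhdsGT hδ] with r hr x hx
  exact (Metric.closedBall_subset_cthickening hx r).trans
    ((Metric.cthickening_mono hr.2.le K).trans hh)

/-- The equation `Δg = χ_{A ∩ {g > 0}}` in the sense of distributions. -/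
theorem IsObstacleRep.integral_mul_lapl_eq {U A : Set 𝔼} {g : 𝔼 → ℝ} (h : IsObstacleRep U A g)
    (hUf : volume U ≠ ⊤) {ψ : 𝔼 → ℝ} (hψ : IsTestFunction U ψ) :
    ∫ x, g x * lapl ψ x = ∫ x, (A ∩ {x | 0 < g x}).indicator (fun _ => (1 : ℝ)) x * ψ x := by
  have hball := eventually_closedBall_subset_of_isCompact h.isOpen hψ.2.1 hψ.2.2
  have hzero : ∀ x ∉ tsupport ψ, lapl ψ x = 0 := fun x hx =>
    image_eq_zero_of_notMem_tsupport fun h' => hx (tsupport_lapl_subset ψ h')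
  have hzero' : ∀ x ∉ tsupport ψ, ψ x = 0 := fun x hx => image_eq_zero_of_notMem_tsupport hx
  obtain ⟨L, hL0, hL⟩ := hψ.lapl.exists_bound
  have h1 : Tendsto (fun r => ∫ x, avg g r x * lapl ψ x) (𝓝[>] 0) (𝓝 (∫ x, g x * lapl ψ x)) := by
    refine tendsto_integral_filter_of_dominated_convergence
      (fun x => |g x * lapl ψ x| + potMass N * |lapl ψ x|) ?_ ?_ ?_ ?_
    · filter_upwards [self_mem_nhdsWithin] with r hr
      exact ((contDiff_avg h.integrable hr).continuous.mul
        hψ.lapl.continuous).aestronglyMeasurable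
    · filter_upwards [hball, Ioo_mem_nhdsGT one_pos] with r hr hr1
      refine Eventually.of_forall fun x => ?_
      by_cases hx : x ∈ tsupport ψ
      · have h2 := h.abs_avg_sub_le x r hr1.1 (hr x hx)
        have h3 : potMass N * r ^ 2 ≤ potMass N * 1 :=
          mul_le_mul_of_nonneg_left (pow_le_one₀ hr1.1.le hr1.2.le) potMass_nonneg
        have h4 : |avg g r x| ≤ |g x| + potMass N := by
          have := abs_sub_abs_le_abs_sub (avg g r x) (g x)
          linarith
        rw [Real.norm_eq_abs, abs_mul, abs_mul, ← add_mul]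
        gcongr
      · simp [hzero x hx]
    · exact (integrable_mul_of_bound h.integrable hψ.lapl.continuous hL).abs.add
        (hψ.lapl.integrable.abs.const_mul _)
    · refine Eventually.of_forall fun x => ?_
      by_cases hx : x ∈ tsupport ψ
      · exact (h.tendsto_avg (hψ.2.2 hx)).mul_const _
      · simp [hzero x hx]
  have h2 : Tendsto (fun r => ∫ x, lapl (avg g r) x * ψ x) (𝓝[>] 0)
      (𝓝 (∫ x, (A ∩ {x | 0 < g x}).indicator (fun _ => (1 : ℝ)) x * ψ x)) := by
    refine tendsto_integral_filter_of_dominated_convergence (fun x => |ψ x|) ?_ ?_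
      hψ.integrable.abs ?_
    · filter_upwards [self_mem_nhdsWithin] with r hr
      exact ((contDiff_avg h.integrable hr).lapl.continuous.mul
        hψ.continuous).aestronglyMeasurable
    · filter_upwards [hball, self_mem_nhdsWithin] with r hr hr1
      refine Eventually.of_forall fun x => ?_
      by_cases hx : x ∈ tsupport ψ
      · rw [Real.norm_eq_abs, abs_mul, abs_of_nonneg (h.lapl_avg_nonneg hr1 (hr x hx))]
        exact mul_le_of_le_one_left (abs_nonneg _) (h.lapl_avg_le_one hr1 (hr x hx))
      · simp [hzero' x hx]
    · filter_upwards [h.ae_tendsto_lapl_avg hUf] with x hxt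
      by_cases hx : x ∈ tsupport ψ
      · exact (hxt (hψ.2.2 hx)).mul_const _
      · simp [hzero' x hx]
  refine tendsto_nhds_unique h1 (h2.congr' ?_)
  filter_upwards [self_mem_nhdsWithin] with r hr
  exact (integral_mul_lapl (contDiff_avg h.integrable hr) hψ.1 hψ.2.1).symm

end Regularity

/-! ### Functions with zero trace: testing, Poincaré's inequality, maximum principle and extension
by zero. -/

section ZeroTrace

variable {N : ℕ}

local notation "𝔼" => EuclideanSpace ℝ (Fin N)

/-- Cauchy–Schwarz in the form that disposes of every error term containing ∇z - ∇φₙ. -/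
theorem tendsto_integral_of_norm_le_mul {α F F' : Type*} [MeasurableSpace α] {μ : Measure α}
    [NormedAddCommGroup F] [NormedAddCommGroup F'] {a : α → F} {b : ℕ → α → F'}
    {f : ℕ → α → ℝ} {K : ℝ} (hK : 0 ≤ K)
    (ha : MemLp a 2 μ) (hb : ∀ n, MemLp (b n) 2 μ)
    (hlim : Tendsto (fun n => ∫ x, ‖b n x‖ ^ 2 ∂μ) atTop (𝓝 0))
    (hf : ∀ n x, |f n x| ≤ K * (‖a x‖ * ‖b n x‖)) :
    Tendsto (fun n => ∫ x, f n x ∂μ) atTop (𝓝 0) := by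
  have hbound : ∀ n, ‖∫ x, f n x ∂μ‖ ≤
      K * ((∫ x, ‖a x‖ ^ (2 : ℝ) ∂μ) ^ (1 / (2 : ℝ)) * (∫ x, ‖b n x‖ ^ 2 ∂μ) ^ (1 / (2 : ℝ))) := by
    intro n
    have h1 := integral_mul_norm_le_Lp_mul_Lq (μ := μ) (f := fun x => ‖a x‖)
      (g := fun x => ‖b n x‖) Real.HolderConjugate.two_two (by simpa using ha.norm)
      (by simpa using (hb n).norm)
    simp only [norm_norm] at h1
    have h2 : ‖∫ x, f n x ∂μ‖ ≤ ∫ x, K * (‖a x‖ * ‖b n x‖) ∂μ := by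
      refine norm_integral_le_of_norm_le ?_ (Eventually.of_forall (hf n))
      exact (ha.norm.integrable_mul (hb n).norm).const_mul K
    rw [integral_const_mul] at h2
    refine h2.trans (mul_le_mul_of_nonneg_left (h1.trans (le_of_eq ?_)) hK)
    congr 2
    simp
  refine squeeze_zero_norm hbound ?_
  have h3 : Tendsto (fun n => (∫ x, ‖b n x‖ ^ 2 ∂μ) ^ (1 / (2 : ℝ))) atTop (𝓝 (0 ^ (1 / (2 : ℝ)))) :=
    hlim.rpow_const (Or.inr (by norm_num))
  rw [Real.zero_rpow (by norm_num)] at h3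
  simpa using (h3.const_mul ((∫ x, ‖a x‖ ^ (2 : ℝ) ∂μ) ^ (1 / (2 : ℝ)))).const_mul K

theorem integrable_mul_inner {μ : Measure 𝔼} {a b : 𝔼 → 𝔼} (ha : MemLp a 2 μ) (hb : MemLp b 2 μ)
    {c : 𝔼 → ℝ} (hc : Continuous c) {K : ℝ} (hcK : ∀ x, |c x| ≤ K) :
    Integrable (fun x => c x * inner ℝ (a x) (b x)) μ := by
  refine ((ha.norm.integrable_mul hb.norm).const_mul K).mono'
    (hc.aestronglyMeasurable.mul (ha.1.inner hb.1)) (Eventually.of_forall fun x => ?_)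
  rw [Real.norm_eq_abs, abs_mul]
  have hK : 0 ≤ K := (abs_nonneg _).trans (hcK x)
  exact mul_le_mul (hcK x) (abs_real_inner_le_norm _ _) (abs_nonneg _) hK

theorem integral_norm_sq_le_of_eLpNorm_lt {F : Type*} [NormedAddCommGroup F] {μ : Measure 𝔼}
    {f : 𝔼 → F} (hf : MemLp f 2 μ) {δ : ℝ} (hδ : 0 < δ) (h : eLpNorm f 2 μ < ENNReal.ofReal δ) :
    ∫ x, ‖f x‖ ^ 2 ∂μ ≤ δ ^ 2 := by
  rw [hf.eLpNorm_eq_integral_rpow_norm two_ne_zero ENNReal.ofNat_ne_top] at h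
  have h1 := (ENNReal.ofReal_lt_ofReal_iff hδ).1 h
  simp only [ENNReal.toReal_ofNat, Real.rpow_two] at h1
  have h0 : 0 ≤ ∫ x, ‖f x‖ ^ 2 ∂μ := integral_nonneg fun x => by positivity
  have h2 : ((∫ x, ‖f x‖ ^ 2 ∂μ) ^ (2 : ℝ)⁻¹) ^ 2 = ∫ x, ‖f x‖ ^ 2 ∂μ := by
    rw [← Real.rpow_natCast, ← Real.rpow_mul h0]; norm_num
  rw [← h2]
  exact pow_le_pow_left₀ (Real.rpow_nonneg h0 _) h1.le 2

theorem IsTestFunction.memLp {U : Set 𝔼} {φ : 𝔼 → ℝ} (hφ : IsTestFunction U φ) (V : Set 𝔼) :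
    MemLp φ 2 (volume.restrict V) :=
  (hφ.continuous.memLp_of_hasCompactSupport hφ.2.1).restrict V

theorem IsTestFunction.memLp_gradient {U : Set 𝔼} {φ : 𝔼 → ℝ} (hφ : IsTestFunction U φ)
    (V : Set 𝔼) : MemLp (gradient φ) 2 (volume.restrict V) :=
  ((continuous_gradient hφ.1).memLp_of_hasCompactSupport hφ.2.1.gradient).restrict V

theorem MemH10.exists_seq {U : Set 𝔼} {z : 𝔼 → ℝ} (hz : MemH10 U z) :
    ∃ (G : 𝔼 → 𝔼) (φ : ℕ → 𝔼 → ℝ), HasH1Gradient U z G ∧ (∀ n, IsTestFunction U (φ n)) ∧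
      Tendsto (fun n => ∫ x in U, ‖z x - φ n x‖ ^ 2) atTop (𝓝 0) ∧
      Tendsto (fun n => ∫ x in U, ‖G x - gradient (φ n) x‖ ^ 2) atTop (𝓝 0) := by
  obtain ⟨G, hG, happ⟩ := hz
  have hpos : ∀ n : ℕ, (0 : ℝ) < 1 / ((n : ℝ) + 1) := fun n => by positivity
  choose φ hφ h1 h2 using fun n : ℕ =>
    happ (ENNReal.ofReal (1 / ((n : ℝ) + 1))) (ENNReal.ofReal_pos.2 (hpos n))
  have hlim : Tendsto (fun n : ℕ => (1 / ((n : ℝ) + 1)) ^ 2) atTop (𝓝 0) := by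
    simpa using (tendsto_one_div_add_atTop_nhds_zero_nat (𝕜 := ℝ)).pow 2
  refine ⟨G, φ, hG, hφ, ?_, ?_⟩
  · exact squeeze_zero (fun n => integral_nonneg fun x => by positivity)
      (fun n => integral_norm_sq_le_of_eLpNorm_lt (hG.2.1.sub ((hφ n).memLp U)) (hpos n) (h1 n)) hlim
  · exact squeeze_zero (fun n => integral_nonneg fun x => by positivity)
      (fun n => integral_norm_sq_le_of_eLpNorm_lt (hG.2.2.sub ((hφ n).memLp_gradient U))
        (hpos n) (h2 n)) hlim

theorem gradient_comp {f : 𝔼 → ℝ} (hf : ContDiff ℝ ∞ f) {H : ℝ → ℝ} (hH : ContDiff ℝ ∞ H)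
    (x : 𝔼) : gradient (fun y => H (f y)) x = deriv H (f x) • gradient f x := by
  refine ext_inner_left ℝ fun v => ?_
  rw [inner_gradient_eq_sum, inner_smul_right, inner_gradient_eq_sum, Finset.mul_sum]
  refine Finset.sum_congr rfl fun i _ => ?_
  rw [partialDeriv_comp hf hH]; ring

theorem gradient_mul {f g : 𝔼 → ℝ} (hf : ContDiff ℝ ∞ f) (hg : ContDiff ℝ ∞ g)
    (x : 𝔼) : gradient (fun y => f y * g y) x = f x • gradient g x + g x • gradient f x := by
  refine ext_inner_left ℝ fun v => ?_
  rw [inner_add_right, inner_smul_right, inner_smul_right]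
  simp only [inner_gradient_eq_sum, Finset.mul_sum, ← Finset.sum_add_distrib]
  refine Finset.sum_congr rfl fun i _ => ?_
  rw [partialDeriv_mul hf hg]; ring

/-- The support of `ψ` may cross the boundary of `U`; that of `φ` does not, so no boundary term
arises. -/
theorem setIntegral_mul_lapl_of_test {U : Set 𝔼} {φ ψ : 𝔼 → ℝ} (hφ : IsTestFunction U φ)
    (hψ : ContDiff ℝ ∞ ψ) (hc : HasCompactSupport ψ) :
    ∫ x in U, φ x * lapl ψ x = - ∫ x in U, inner ℝ (gradient φ x) (gradient ψ x) := by
  have hgrad : ∀ x i, (gradient φ x) i = partialDeriv i φ x := fun x i => by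
    rw [partialDeriv, ← inner_gradient_left, EuclideanSpace.inner_single_right]
    simp
  have h0 : ∀ x ∉ U, ∀ i, partialDeriv i φ x = 0 := fun x hx i =>
    (hφ.partialDeriv i).eq_zero_of_notMem hx
  rw [setIntegral_eq_integral_of_forall_compl_eq_zero, setIntegral_eq_integral_of_forall_compl_eq_zero]
  · simp only [inner_gradient_eq_sum, hgrad, lapl, Finset.mul_sum]
    rw [integral_finsetSum, integral_finsetSum, ← Finset.sum_neg_distrib]
    · exact Finset.sum_congr rfl fun i _ =>
        integral_mul_partialDeriv hφ.1 (hψ.partialDeriv i) (hc.partialDeriv i) i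
    · exact fun i _ => ((hφ.1.partialDeriv i).continuous.mul
        (hψ.partialDeriv i).continuous).integrable_of_hasCompactSupport
        (hc.partialDeriv i).mul_left
    · exact fun i _ => (hφ.continuous.mul
        ((hψ.partialDeriv i).partialDeriv i).continuous).integrable_of_hasCompactSupport
        ((hc.partialDeriv i).partialDeriv i).mul_left
  · intro x hx
    rw [inner_gradient_eq_sum]
    exact Finset.sum_eq_zero fun i _ => by rw [hgrad, h0 x hx, zero_mul]
  · intro x hx
    rw [hφ.eq_zero_of_notMem hx, zero_mul]

theorem abs_sub_le_of_deriv_le {H : ℝ → ℝ} (hH : ContDiff ℝ ∞ H) {K : ℝ}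
    (hK : ∀ s, |deriv H s| ≤ K) (a b : ℝ) : |H a - H b| ≤ K * |a - b| :=
  convex_univ.norm_image_sub_le_of_norm_deriv_le
    (fun x _ => hH.contDiffAt.differentiableAt (by simp)) (fun x _ => hK x) (mem_univ b)
    (mem_univ a)

section

variable {U : Set (EuclideanSpace ℝ (Fin N))} {z : EuclideanSpace ℝ (Fin N) → ℝ}
  {G : EuclideanSpace ℝ (Fin N) → EuclideanSpace ℝ (Fin N)}
  {φ : ℕ → EuclideanSpace ℝ (Fin N) → ℝ} {H : ℝ → ℝ} {K : ℝ}

theorem tendsto_setIntegral_mul_comp (hzm : MemLp z 2 (volume.restrict U))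
    (hφ : ∀ n, IsTestFunction U (φ n))
    (hlim : Tendsto (fun n => ∫ x in U, ‖z x - φ n x‖ ^ 2) atTop (𝓝 0))
    (hH : ContDiff ℝ ∞ H) (h0 : H 0 = 0) (hK : ∀ s, |deriv H s| ≤ K) {h : 𝔼 → ℝ}
    (hh : MemLp h 2 (volume.restrict U)) :
    Tendsto (fun n => ∫ x in U, h x * H (φ n x)) atTop (𝓝 (∫ x in U, h x * H (z x))) := by
  have hK0 : 0 ≤ K := (abs_nonneg _).trans (hK 0)
  have hbd : ∀ s, |H s| ≤ K * |s| := fun s => by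
    simpa [h0] using abs_sub_le_of_deriv_le hH hK s 0
  have hHz : MemLp (fun x => H (z x)) 2 (volume.restrict U) :=
    (hzm.norm.const_mul K).mono (hH.continuous.comp_aestronglyMeasurable hzm.1)
      (Eventually.of_forall fun x => by
        simpa [abs_mul, abs_of_nonneg hK0] using hbd (z x))
  have key := tendsto_integral_of_norm_le_mul (f := fun n x => h x * H (φ n x) - h x * H (z x))
    hK0 hh (fun n => hzm.sub ((hφ n).memLp U)) hlim (fun n x => by
      rw [← mul_sub, abs_mul]
      have := abs_sub_le_of_deriv_le hH hK (φ n x) (z x)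
      rw [abs_sub_comm (φ n x)] at this
      simp only [Real.norm_eq_abs, Pi.sub_apply]
      calc |h x| * |H (φ n x) - H (z x)| ≤ |h x| * (K * |z x - φ n x|) := by gcongr
        _ = _ := by ring)
  rw [← tendsto_sub_nhds_zero_iff]
  refine key.congr fun n => integral_sub ?_ ?_
  · exact hh.integrable_mul (((hφ n).comp hH h0).memLp U)
  · exact hh.integrable_mul hHz

theorem integral_lapl_comp (hG : HasH1Gradient U z G) (hφ : ∀ n, IsTestFunction U (φ n))
    (hH : ContDiff ℝ ∞ H) (h0 : H 0 = 0) (n : ℕ) :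
    ∫ x in U, z x * lapl (fun y => H (φ n y)) x =
      - ∫ x in U, deriv H (φ n x) * inner ℝ (G x) (gradient (φ n) x) := by
  rw [hG.1.integral_lapl ((hφ n).comp hH h0)]
  congr 2; funext x
  rw [gradient_comp (hφ n).1 hH, inner_smul_right]

/-- Formally ∫ h H(z) = -∫ H'(z) |∇z|² ≤ 0. With φₙ inside H one writes ∇z · ∇φₙ = |∇z|² - ∇z · (∇z
- ∇φₙ), discards the first term by sign and lets the second tend to zero. -/
theorem MemH10.integral_mul_comp_nonpos (hz : MemH10 U z) {h : 𝔼 → ℝ}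
    (hh : MemLp h 2 (volume.restrict U))
    (heq : ∀ ψ, IsTestFunction U ψ → ∫ x in U, z x * lapl ψ x = ∫ x in U, h x * ψ x)
    (hH : ContDiff ℝ ∞ H) (h0 : H 0 = 0) (hd : ∀ s, 0 ≤ deriv H s) (hK : ∀ s, deriv H s ≤ K) :
    ∫ x in U, h x * H (z x) ≤ 0 := by
  obtain ⟨G, φ, hG, hφ, hlim, hlim'⟩ := hz.exists_seq
  have hK' : ∀ s, |deriv H s| ≤ K := fun s => by rw [abs_of_nonneg (hd s)]; exact hK s
  have hK0 : 0 ≤ K := (abs_nonneg _).trans (hK' 0)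
  have ht := tendsto_setIntegral_mul_comp hG.2.1 hφ hlim hH h0 hK' hh
  have hcont : ∀ n, Continuous fun x => deriv H (φ n x) := fun n =>
    hH.deriv_top.continuous.comp (hφ n).continuous
  have he := tendsto_integral_of_norm_le_mul (μ := volume.restrict U)
    (f := fun n x => deriv H (φ n x) * inner ℝ (G x) (G x - gradient (φ n) x))
    hK0 hG.2.2 (fun n => hG.2.2.sub ((hφ n).memLp_gradient U)) hlim' (fun n x => by
      rw [abs_mul]
      exact mul_le_mul (hK' _) (abs_real_inner_le_norm _ _) (abs_nonneg _) hK0)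
  refine le_of_tendsto_of_tendsto' ht he fun n => ?_
  rw [← heq _ ((hφ n).comp hH h0), integral_lapl_comp hG hφ hH h0, ← integral_neg]
  refine integral_mono
    (integrable_mul_inner hG.2.2 ((hφ n).memLp_gradient U) (hcont n) fun x => hK' _).neg
    (integrable_mul_inner hG.2.2 (hG.2.2.sub ((hφ n).memLp_gradient U)) (hcont n) fun x => hK' _)
    fun x => ?_
  simp only [inner_sub_right]
  have := mul_nonneg (hd (φ n x)) (real_inner_self_nonneg (x := G x))
  linarith

/-- Poincaré's inequality for test functions. -/
theorem setIntegral_sq_le_of_test (i : Fin N) {R : ℝ} (hUR : U ⊆ Metric.closedBall 0 R)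
    {φ : 𝔼 → ℝ} (hφ : IsTestFunction U φ) :
    ∫ x in U, φ x ^ 2 ≤ 4 * R ^ 2 * ∫ x in U, ‖gradient φ x‖ ^ 2 := by
  have hx : ContDiff ℝ ∞ (fun x : 𝔼 => x i) := (EuclideanSpace.proj i : 𝔼 →L[ℝ] ℝ).contDiff
  have h2 : IsTestFunction U (fun x => φ x * φ x) := hφ.mul_left hφ.1
  have hpx : ∀ x : 𝔼, partialDeriv i (fun x : 𝔼 => x i) x = 1 := fun x => by
    have h1 : HasFDerivAt (fun z : 𝔼 => z i) (EuclideanSpace.proj i : 𝔼 →L[ℝ] ℝ) x :=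
      (EuclideanSpace.proj i : 𝔼 →L[ℝ] ℝ).hasFDerivAt
    rw [partialDeriv, h1.fderiv]; simp
  -- Since ∂ᵢxᵢ = 1, ∫ φ² equals -∫ 2 xᵢ φ ∂ᵢφ.
  have hint := integral_mul_partialDeriv hx h2.1 h2.2.1 i
  simp only [hpx, one_mul, partialDeriv_mul hφ.1 hφ.1] at hint
  have hg : Continuous (gradient φ) := continuous_gradient hφ.1
  have hgi : Integrable (fun x => ‖gradient φ x‖ ^ 2) :=
    (hg.norm.pow 2).integrable_of_hasCompactSupport (HasCompactSupport.intro hφ.2.1.gradient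
      fun x hx => by simp [image_eq_zero_of_notMem_tsupport hx])
  have hmono : -∫ x, x i * (φ x * partialDeriv i φ x + φ x * partialDeriv i φ x) ≤
      ∫ x, (1 / 2 * (φ x * φ x) + 2 * R ^ 2 * ‖gradient φ x‖ ^ 2) := by
    rw [← integral_neg]
    refine integral_mono ?_ ((h2.integrable.const_mul _).add (hgi.const_mul _)) fun x => ?_
    · refine Integrable.neg (Continuous.integrable_of_hasCompactSupport ?_ ?_)
      · exact hx.continuous.mul ((hφ.continuous.mul (hφ.partialDeriv i).continuous).add
          (hφ.continuous.mul (hφ.partialDeriv i).continuous))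
      · exact (HasCompactSupport.add hφ.2.1.mul_right hφ.2.1.mul_right).mul_left
    · simp only
      by_cases hxU : x ∈ U
      · have h3 : |x i| ≤ R := by
          have := hUR hxU
          rw [mem_closedBall_zero_iff] at this
          exact (PiLp.norm_apply_le x i).trans this
        have h4 : |partialDeriv i φ x| ≤ ‖gradient φ x‖ := by
          have : partialDeriv i φ x = inner ℝ (gradient φ x) (EuclideanSpace.single i 1) := by
            rw [inner_gradient_left, partialDeriv]
          rw [this]
          refine (abs_real_inner_le_norm _ _).trans ?_
          simp
        have h5 : (x i * partialDeriv i φ x) ^ 2 ≤ R ^ 2 * ‖gradient φ x‖ ^ 2 := by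
          rw [mul_pow]
          exact mul_le_mul (sq_le_sq.2 (h3.trans (le_abs_self R)))
            (sq_le_sq.2 (h4.trans (le_abs_self _))) (by positivity) (by positivity)
        -- Young's inequality with weights chosen so that half of ∫ φ² can be absorbed on the left,
        -- whence the constant 4 R².
        nlinarith [sq_nonneg (φ x + 2 * (x i * partialDeriv i φ x))]
      · rw [hφ.eq_zero_of_notMem hxU]
        have : 0 ≤ 2 * R ^ 2 * ‖gradient φ x‖ ^ 2 := by positivity
        simpa using this
  rw [integral_add (h2.integrable.const_mul _) (hgi.const_mul _), integral_const_mul,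
    integral_const_mul] at hmono
  have e1 : ∫ x in U, φ x ^ 2 = ∫ x, φ x * φ x := by
    rw [setIntegral_eq_integral_of_forall_compl_eq_zero fun x hx => by
      rw [hφ.eq_zero_of_notMem hx]; simp]
    simp only [sq]
  have e2 : ∫ x in U, ‖gradient φ x‖ ^ 2 = ∫ x, ‖gradient φ x‖ ^ 2 :=
    setIntegral_eq_integral_of_forall_compl_eq_zero fun x hx => by
      rw [image_eq_zero_of_notMem_tsupport fun h' => hx (hφ.2.2 (tsupport_gradient_subset φ h'))]
      simp
  rw [e1, e2]
  linarith

theorem exists_smoothTransition_deriv_bound :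
    ∃ K, 0 ≤ K ∧ ∀ s, deriv Real.smoothTransition s ≤ K := by
  have hc : HasCompactSupport (deriv Real.smoothTransition) := by
    refine HasCompactSupport.intro (isCompact_Icc (a := (0 : ℝ)) (b := 1)) fun s hs => ?_
    rw [mem_Icc, not_and_or, not_le, not_le] at hs
    rcases hs with hs | hs
    · have : Real.smoothTransition =ᶠ[𝓝 s] fun _ => 0 := by
        filter_upwards [Iio_mem_nhds hs] with t ht
        exact Real.smoothTransition.zero_of_nonpos (le_of_lt ht)
      rw [this.deriv_eq]; simp
    · have : Real.smoothTransition =ᶠ[𝓝 s] fun _ => 1 := by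
        filter_upwards [Ioi_mem_nhds hs] with t ht
        exact Real.smoothTransition.one_of_one_le (le_of_lt ht)
      rw [this.deriv_eq]; simp
  obtain ⟨K, hK⟩ := hc.exists_bound_of_continuous
    (Real.smoothTransition.contDiff (n := ⊤)).deriv_top.continuous
  exact ⟨K, (norm_nonneg _).trans (hK 0), fun s => (le_abs_self _).trans (hK s)⟩

theorem smoothTransition_deriv_nonneg (s : ℝ) : 0 ≤ deriv Real.smoothTransition s :=
  Real.smoothTransition.monotone.deriv_nonneg

/-- Weak maximum principle in `H¹₀`. -/
theorem MemH10.nonpos_of_lapl_nonneg (hN : 1 ≤ N) (hUb : Bornology.IsBounded U)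
    (hz : MemH10 U z)
    (hsub : ∀ ψ, IsTestFunction U ψ → (∀ x, 0 ≤ ψ x) → 0 ≤ ∫ x in U, z x * lapl ψ x) :
    ∀ᵐ x ∂(volume.restrict U), z x ≤ 0 := by
  obtain ⟨G, φ, hG, hφ, hlim, hlim'⟩ := hz.exists_seq
  obtain ⟨K, hK0, hK⟩ := exists_smoothTransition_deriv_bound
  obtain ⟨R, hR⟩ := hUb.subset_closedBall 0
  have hfin : IsFiniteMeasure (volume.restrict U) := ⟨by
    rw [Measure.restrict_apply_univ]; exact hUb.measure_lt_top⟩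
  set H := Real.smoothTransition
  have hH : ContDiff ℝ ∞ H := Real.smoothTransition.contDiff
  have h0 : H 0 = 0 := Real.smoothTransition.zero
  have hd := smoothTransition_deriv_nonneg
  have hK' : ∀ s, |deriv H s| ≤ K := fun s => by rw [abs_of_nonneg (hd s)]; exact hK s
  have hcont : ∀ n, Continuous fun x => deriv H (φ n x) := fun n =>
    hH.deriv_top.continuous.comp (hφ n).continuous
  have hbm : ∀ n, MemLp (fun x => G x - gradient (φ n) x) 2 (volume.restrict U) := fun n =>
    hG.2.2.sub ((hφ n).memLp_gradient U)
  have he := tendsto_integral_of_norm_le_mul (μ := volume.restrict U)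
    (f := fun n x => deriv H (φ n x) * inner ℝ (G x) (G x - gradient (φ n) x))
    hK0 hG.2.2 hbm hlim' (fun n x => by
      rw [abs_mul]
      exact mul_le_mul (hK' _) (abs_real_inner_le_norm _ _) (abs_nonneg _) hK0)
  -- With g = ∇φₙ, |g|² = G · g - G · (G - g) + |G - g|². Weighted by H'(φₙ), the first term has
  -- nonpositive integral by subharmonicity tested with H(φₙ), and the other two tend to zero.
  have hgrad : ∀ n, ∫ x in U, ‖gradient (fun y => H (φ n y)) x‖ ^ 2 ≤
      K * (-(∫ x in U, deriv H (φ n x) * inner ℝ (G x) (G x - gradient (φ n) x)) +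
        K * ∫ x in U, ‖G x - gradient (φ n) x‖ ^ 2) := by
    intro n
    have hi1 := integrable_mul_inner hG.2.2 ((hφ n).memLp_gradient U) (hcont n) fun x => hK' (φ n x)
    have hi2 := integrable_mul_inner hG.2.2 (hbm n) (hcont n) fun x => hK' (φ n x)
    have hi3 : Integrable (fun x => ‖G x - gradient (φ n) x‖ ^ 2) (volume.restrict U) :=
      (hbm n).integrable_norm_pow two_ne_zero
    have hi4 : Integrable (fun x => ‖gradient (fun y => H (φ n y)) x‖ ^ 2) (volume.restrict U) :=
      (((hφ n).comp hH h0).memLp_gradient U).integrable_norm_pow two_ne_zero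
    have h1 : ∫ x in U, deriv H (φ n x) * inner ℝ (G x) (gradient (φ n) x) ≤ 0 := by
      have := hsub _ ((hφ n).comp hH h0) fun x => Real.smoothTransition.nonneg _
      rw [integral_lapl_comp hG hφ hH h0] at this
      linarith
    have h2 : ∫ x in U, ‖gradient (fun y => H (φ n y)) x‖ ^ 2 ≤
        ∫ x in U, K * (deriv H (φ n x) * inner ℝ (G x) (gradient (φ n) x) +
          (-(deriv H (φ n x) * inner ℝ (G x) (G x - gradient (φ n) x)) +
            K * ‖G x - gradient (φ n) x‖ ^ 2)) := by
      refine integral_mono hi4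
        ((hi1.add (hi2.neg.add (hi3.const_mul K))).const_mul K) fun x => ?_
      simp only
      set g := gradient (φ n) x
      have e1 : inner ℝ (G x) g - inner ℝ (G x) (G x - g) + ‖G x - g‖ ^ 2 = ‖g‖ ^ 2 := by
        rw [norm_sub_sq_real, inner_sub_right, real_inner_self_eq_norm_sq]; ring
      have e2 : deriv H (φ n x) * ‖g‖ ^ 2 ≤ deriv H (φ n x) * inner ℝ (G x) g +
          (-(deriv H (φ n x) * inner ℝ (G x) (G x - g)) + K * ‖G x - g‖ ^ 2) := by
        rw [← e1]
        have := mul_le_mul_of_nonneg_right (hK (φ n x)) (sq_nonneg ‖G x - g‖)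
        linarith
      rw [gradient_comp (hφ n).1 hH, norm_smul, mul_pow, Real.norm_eq_abs, sq_abs]
      calc deriv H (φ n x) ^ 2 * ‖g‖ ^ 2 = deriv H (φ n x) * (deriv H (φ n x) * ‖g‖ ^ 2) := by ring
        _ ≤ K * (deriv H (φ n x) * ‖g‖ ^ 2) :=
          mul_le_mul_of_nonneg_right (hK _) (mul_nonneg (hd _) (sq_nonneg _))
        _ ≤ _ := mul_le_mul_of_nonneg_left e2 hK0
    rw [integral_const_mul, integral_add hi1 (by exact hi2.neg.add (hi3.const_mul K)),
      integral_add (by exact hi2.neg) (hi3.const_mul K), integral_neg, integral_const_mul] at h2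
    refine h2.trans (mul_le_mul_of_nonneg_left ?_ hK0)
    linarith
  have hsq : Tendsto (fun n => ∫ x in U, ‖H (φ n x)‖ ^ 2) atTop (𝓝 0) := by
    have hup : Tendsto (fun n => 4 * R ^ 2 * (K * (-(∫ x in U, deriv H (φ n x) *
        inner ℝ (G x) (G x - gradient (φ n) x)) + K * ∫ x in U, ‖G x - gradient (φ n) x‖ ^ 2)))
        atTop (𝓝 (4 * R ^ 2 * (K * (-0 + K * 0)))) :=
      ((he.neg.add (hlim'.const_mul K)).const_mul K).const_mul _
    simp only [neg_zero, mul_zero, add_zero] at hup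
    refine squeeze_zero (fun n => integral_nonneg fun x => by positivity) (fun n => ?_) hup
    simp only [Real.norm_eq_abs, sq_abs]
    refine (setIntegral_sq_le_of_test ⟨0, hN⟩ hR ((hφ n).comp hH h0)).trans ?_
    exact mul_le_mul_of_nonneg_left (hgrad n) (by positivity)
  have h1m : MemLp (fun _ : 𝔼 => (1 : ℝ)) 2 (volume.restrict U) := memLp_const 1
  have ht0 := tendsto_integral_of_norm_le_mul (μ := volume.restrict U)
    (f := fun n x => (1 : ℝ) * H (φ n x)) zero_le_one h1m
    (fun n => ((hφ n).comp hH h0).memLp U) hsq (fun n x => by simp)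
  -- The integrals of H(φₙ) tend to that of H(z), and by Poincaré also to zero. As H is positive
  -- exactly on (0, ∞), z ≤ 0 almost everywhere.
  have ht1 := tendsto_setIntegral_mul_comp hG.2.1 hφ hlim hH h0 hK' h1m
  have hzero := tendsto_nhds_unique ht1 ht0
  simp only [one_mul] at hzero
  have hHz : Integrable (fun x => H (z x)) (volume.restrict U) :=
    (integrable_const (1 : ℝ)).mono' (hH.continuous.comp_aestronglyMeasurable hG.2.1.1)
      (Eventually.of_forall fun x => by
        rw [Real.norm_eq_abs, abs_of_nonneg (Real.smoothTransition.nonneg _)]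
        exact Real.smoothTransition.le_one _)
  rw [integral_eq_zero_iff_of_nonneg (fun x => Real.smoothTransition.nonneg _) hHz] at hzero
  filter_upwards [hzero] with x hx
  exact Real.smoothTransition.zero_iff_nonpos.1 hx

/-- If `z ∈ H¹₀(U)` and `Δz ≤ 1`, then `H(-z)`, extended by zero, satisfies `ΔH(-z) ≥ -1` on the
whole space for convex `H` vanishing on the negative half-line. -/
theorem MemH10.weakLaplGe_univ (hU : IsOpen U) (hz : MemH10 U z)
    (hsup : ∀ ψ, IsTestFunction U ψ → (∀ x, 0 ≤ ψ x) →
      ∫ x in U, z x * lapl ψ x ≤ ∫ x in U, ψ x)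
    (hH : ContDiff ℝ ∞ H) (h0 : H 0 = 0) (h0' : deriv H 0 = 0) (hd : ∀ s, 0 ≤ deriv H s)
    (hd1 : ∀ s, deriv H s ≤ 1) (hdd : ∀ s, 0 ≤ deriv (deriv H) s)
    (hK : ∀ s, deriv (deriv H) s ≤ K) :
    WeakLaplGe univ (U.indicator fun x => H (-z x)) (-1) := by
  intro ψ hψ hψ0
  obtain ⟨G, φ, hG, hφ, hlim, hlim'⟩ := hz.exists_seq
  have hH' : ContDiff ℝ ∞ (deriv H) := hH.deriv_top
  have hab1 : ∀ s, |deriv H s| ≤ 1 := fun s => by rw [abs_of_nonneg (hd s)]; exact hd1 s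
  have habK : ∀ s, |deriv (deriv H) s| ≤ K := fun s => by
    rw [abs_of_nonneg (hdd s)]; exact hK s
  have hK0 : 0 ≤ K := (abs_nonneg _).trans (habK 0)
  obtain ⟨P, hP0, hP⟩ := hψ.exists_bound
  have hbm : ∀ n, MemLp (fun x => G x - gradient (φ n) x) 2 (volume.restrict U) := fun n =>
    hG.2.2.sub ((hφ n).memLp_gradient U)
  have hint : ∫ x, U.indicator (fun x => H (-z x)) x * lapl ψ x =
      ∫ x in U, H (-z x) * lapl ψ x := by
    rw [← integral_indicator hU.measurableSet]
    congr 1; funext x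
    by_cases hx : x ∈ U <;> simp [hx]
  rw [hint, neg_mul, one_mul]
  set H₁ : ℝ → ℝ := fun s => H (-s) with hH₁
  have hH₁c : ContDiff ℝ ∞ H₁ := hH.comp contDiff_neg
  have hH₁d : ∀ s, deriv H₁ s = - deriv H (-s) := fun s => by
    rw [hH₁, deriv_comp_neg]
  have ht := tendsto_setIntegral_mul_comp hG.2.1 hφ hlim hH₁c (by simp [hH₁, h0]) (K := 1)
    (fun s => by rw [hH₁d, abs_neg]; exact hab1 _) (hψ.lapl.memLp U)
  have hc1 : ∀ n, Continuous fun x => deriv H (-φ n x) := fun n =>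
    hH'.continuous.comp (hφ n).continuous.neg
  have hc2 : ∀ n, Continuous fun x => ψ x * deriv (deriv H) (-φ n x) := fun n =>
    hψ.continuous.mul (hH'.deriv_top.continuous.comp (hφ n).continuous.neg)
  have hb2 : ∀ n x, |ψ x * deriv (deriv H) (-φ n x)| ≤ P * K := fun n x => by
    rw [abs_mul]; exact mul_le_mul (hP x) (habK _) (abs_nonneg _) hP0
  have he1 := tendsto_integral_of_norm_le_mul (μ := volume.restrict U)
    (f := fun n x => deriv H (-φ n x) * inner ℝ (gradient ψ x) (G x - gradient (φ n) x))
    zero_le_one (hψ.memLp_gradient U) hbm hlim' (fun n x => by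
      rw [abs_mul]
      exact mul_le_mul (hab1 _) (abs_real_inner_le_norm _ _) (abs_nonneg _) zero_le_one)
  have he2 := tendsto_integral_of_norm_le_mul (μ := volume.restrict U)
    (f := fun n x => ψ x * deriv (deriv H) (-φ n x) * inner ℝ (G x) (G x - gradient (φ n) x))
    (mul_nonneg hP0 hK0) hG.2.2 hbm hlim' (fun n x => by
      rw [abs_mul]
      exact mul_le_mul (hb2 n x) (abs_real_inner_le_norm _ _) (abs_nonneg _) (mul_nonneg hP0 hK0))
  have hfin : Tendsto (fun n => -(∫ x, ψ x) -
      (∫ x in U, deriv H (-φ n x) * inner ℝ (gradient ψ x) (G x - gradient (φ n) x)) -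
      ∫ x in U, ψ x * deriv (deriv H) (-φ n x) * inner ℝ (G x) (G x - gradient (φ n) x)) atTop
      (𝓝 (-(∫ x, ψ x) - 0 - 0)) := (tendsto_const_nhds.sub he1).sub he2
  simp only [sub_zero] at hfin
  have hcomm : ∫ x in U, H (-z x) * lapl ψ x = ∫ x in U, lapl ψ x * H₁ (z x) := by
    congr 1; funext x; rw [mul_comm]
  rw [hcomm]
  refine le_of_tendsto_of_tendsto' hfin ht fun n => ?_
  -- testing with `ψ H'(-φₙ)`
  have hχ : IsTestFunction U (fun x => ψ x * deriv H (-φ n x)) :=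
    ((hφ n).comp (H := fun s => deriv H (-s)) (hH'.comp contDiff_neg) (by simp [h0'])).mul_left
      hψ.1
  have hχ1 := hsup _ hχ fun x => mul_nonneg (hψ0 x) (hd _)
  have hχ2 : ∫ x in U, ψ x * deriv H (-φ n x) ≤ ∫ x, ψ x := by
    refine (integral_mono hχ.integrable.integrableOn hψ.integrable.integrableOn fun x =>
      mul_le_of_le_one_right (hψ0 x) (hd1 _)).trans ?_
    exact setIntegral_le_integral hψ.integrable (Eventually.of_forall hψ0)
  have hgχ : ∀ x, gradient (fun x => ψ x * deriv H (-φ n x)) x =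
      -(ψ x * deriv (deriv H) (-φ n x)) • gradient (φ n) x + deriv H (-φ n x) • gradient ψ x := by
    intro x
    rw [gradient_mul (g := fun x => deriv H (-φ n x)) hψ.1
      (hH'.comp (hφ n).1.neg),
      gradient_comp (H := fun s => deriv H (-s)) (hφ n).1 (hH'.comp contDiff_neg)]
    rw [deriv_comp_neg, smul_smul, mul_neg]
  have hH₁t : IsTestFunction U (fun x => H₁ (φ n x)) := (hφ n).comp hH₁c (by simp [hH₁, h0])
  -- Integration by parts over `U` is free of boundary terms because H₁(φₙ) is supported in `U`,
  -- although `ψ` need not be.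
  have hparts : ∫ x in U, lapl ψ x * H₁ (φ n x) =
      ∫ x in U, deriv H (-φ n x) * inner ℝ (gradient ψ x) (gradient (φ n) x) := by
    have := setIntegral_mul_lapl_of_test hH₁t hψ.1 hψ.2.1
    rw [← integral_neg] at this
    simp only [mul_comm (lapl ψ _)]
    rw [this]
    congr 1; funext x
    rw [gradient_comp (hφ n).1 hH₁c, hH₁d, inner_smul_left, real_inner_comm]
    simp
  rw [hG.1.integral_lapl hχ, ← integral_neg] at hχ1
  have hi1 := integrable_mul_inner (hψ.memLp_gradient U) ((hφ n).memLp_gradient U) (hc1 n)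
    fun x => hab1 (-φ n x)
  have hi2 := integrable_mul_inner (hψ.memLp_gradient U) (hbm n) (hc1 n)
    fun x => hab1 (-φ n x)
  have hi3 := integrable_mul_inner hG.2.2 (hbm n) (hc2 n) (hb2 n)
  -- Formally ΔH(-z) = -H'(-z) Δz + H''(-z) |∇z|². The last term, here ψ H''(-φₙ) |G|², is discarded
  -- by convexity; the remaining two differences are errors that vanish in the limit.
  have hmono : ∫ x in U, (-(deriv H (-φ n x) * inner ℝ (gradient ψ x) (gradient (φ n) x)) -
      deriv H (-φ n x) * inner ℝ (gradient ψ x) (G x - gradient (φ n) x) -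
      ψ x * deriv (deriv H) (-φ n x) * inner ℝ (G x) (G x - gradient (φ n) x)) ≤
      ∫ x in U, -inner ℝ (G x) (gradient (fun x => ψ x * deriv H (-φ n x)) x) := by
    refine integral_mono ((hi1.neg.sub hi2).sub hi3)
      (hG.1.integrable_inner_gradient hχ).neg fun x => ?_
    simp only [hgχ, inner_add_right, inner_smul_right, inner_sub_right, real_inner_comm (G x)]
    have : 0 ≤ ψ x * deriv (deriv H) (-φ n x) * inner ℝ (G x) (G x) :=
      mul_nonneg (mul_nonneg (hψ0 x) (hdd _)) real_inner_self_nonneg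
    simp only [real_inner_comm (G x)] at this ⊢
    linarith
  rw [integral_sub (by exact hi1.neg.sub hi2) hi3, integral_sub (by exact hi1.neg) hi2,
    integral_neg, ← hparts] at hmono
  linarith

end

end ZeroTrace

/-! ### A smooth convex approximation of the positive part. -/

section ConvexProfile

/-- A smooth convex function vanishing on `(-∞, 0]`, with derivative the smooth transition. -/
noncomputable def convexProfile (s : ℝ) : ℝ := ∫ x in (0 : ℝ)..s, Real.smoothTransition x

theorem hasDerivAt_convexProfile (s : ℝ) :
    HasDerivAt convexProfile (Real.smoothTransition s) s :=
  intervalIntegral.integral_hasDerivAt_right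
    (Real.smoothTransition.continuous.intervalIntegrable _ _)
    (Real.smoothTransition.continuous.stronglyMeasurableAtFilter _ _)
    Real.smoothTransition.continuousAt

theorem deriv_convexProfile : deriv convexProfile = Real.smoothTransition :=
  funext fun s => (hasDerivAt_convexProfile s).deriv

theorem contDiff_convexProfile : ContDiff ℝ ∞ convexProfile :=
  contDiff_infty_iff_deriv.2 ⟨fun s => (hasDerivAt_convexProfile s).differentiableAt, by
    rw [deriv_convexProfile]; exact Real.smoothTransition.contDiff⟩

theorem convexProfile_zero : convexProfile 0 = 0 := intervalIntegral.integral_same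

theorem monotone_convexProfile : Monotone convexProfile :=
  monotone_of_deriv_nonneg (fun s => (hasDerivAt_convexProfile s).differentiableAt) fun s => by
    rw [deriv_convexProfile]; exact Real.smoothTransition.nonneg s

theorem convexProfile_of_nonpos {s : ℝ} (hs : s ≤ 0) : convexProfile s = 0 := by
  rw [convexProfile, intervalIntegral.integral_congr (g := fun _ => 0)]
  · simp
  · intro x hx
    rw [uIcc_of_ge hs] at hx
    exact Real.smoothTransition.zero_of_nonpos hx.2

theorem convexProfile_pos {s : ℝ} (hs : 0 < s) : 0 < convexProfile s :=
  intervalIntegral.intervalIntegral_pos_of_pos_on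
    (Real.smoothTransition.continuous.intervalIntegrable _ _)
    (fun _ hx => Real.smoothTransition.pos_of_pos hx.1) hs

theorem convexProfile_nonneg (s : ℝ) : 0 ≤ convexProfile s := by
  rcases le_or_gt s 0 with hs | hs
  · exact (convexProfile_of_nonpos hs).ge
  · exact (convexProfile_pos hs).le

theorem convexProfile_le (s : ℝ) : convexProfile s ≤ max s 0 := by
  rcases le_or_gt s 0 with hs | hs
  · rw [convexProfile_of_nonpos hs]; exact le_max_right _ _
  · refine le_trans ?_ (le_max_left _ _)
    have := intervalIntegral.integral_mono_on hs.le
      (Real.smoothTransition.continuous.intervalIntegrable 0 s)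
      (intervalIntegrable_const (μ := volume) (c := (1 : ℝ))) fun x _ => Real.smoothTransition.le_one x
    simpa [convexProfile] using this

/-- With `convexProfile_le` this puts the profile within distance 1 of s₊, so its rescalings
approximate s₊ uniformly. -/
theorem max_sub_one_le_convexProfile (s : ℝ) : max s 0 - 1 ≤ convexProfile s := by
  rcases le_or_gt s 1 with hs | hs
  · have : max s 0 ≤ 1 := max_le hs zero_le_one
    linarith [convexProfile_nonneg s]
  · have h1 : convexProfile s = convexProfile 1 + ∫ x in (1 : ℝ)..s, Real.smoothTransition x :=
      (intervalIntegral.integral_add_adjacent_intervals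
        (Real.smoothTransition.continuous.intervalIntegrable _ _)
        (Real.smoothTransition.continuous.intervalIntegrable _ _)).symm
    have h2 : ∫ x in (1 : ℝ)..s, Real.smoothTransition x = s - 1 := by
      rw [intervalIntegral.integral_congr (g := fun _ => 1)]
      · simp
      · intro x hx
        rw [uIcc_of_le hs.le] at hx
        exact Real.smoothTransition.one_of_one_le hx.1
    rw [h1, h2, max_eq_left (by linarith)]
    linarith [convexProfile_nonneg 1]

end ConvexProfile

/-! ### Positivity near a Lipschitz boundary and location of the zero set. -/

section Boundary

variable {N : ℕ}

local notation "𝔼" => EuclideanSpace ℝ (Fin N)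

theorem tendsto_avg_of_continuousAt {g : 𝔼 → ℝ} (hg : Integrable g) {x : 𝔼}
    (hx : ContinuousAt g x) : Tendsto (fun r : ℝ => avg g r x) (𝓝[>] 0) (𝓝 (g x)) := by
  obtain ⟨C, hC0, hC⟩ := abs_avg_sub_le hg
  rw [Metric.tendsto_nhds]
  intro ε hε
  set v := volume.real (Metric.ball (0 : 𝔼) 1)
  have hv : 0 ≤ v := measureReal_nonneg
  have hδ : 0 < ε / (2 * (C * v + 1)) := by positivity
  obtain ⟨R, hR, hRx⟩ := Metric.nhds_basis_closedBall.mem_iff.1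
    (hx.eventually (Metric.closedBall_mem_nhds (g x) hδ))
  filter_upwards [Ioo_mem_nhdsGT hR] with r hr
  have hr0 : 0 < r := hr.1
  rw [Real.dist_eq]
  have h1 : ∫ y in Metric.closedBall x r, |g y - g x| ≤
      ε / (2 * (C * v + 1)) * (r ^ N * v) := by
    have h2 := norm_setIntegral_le_of_norm_le_const (μ := volume) (s := Metric.closedBall x r)
      (f := fun y => |g y - g x|) (C := ε / (2 * (C * v + 1))) measure_closedBall_lt_top
      (fun y hy => by
        have := hRx (Metric.closedBall_subset_closedBall hr.2.le hy)
        simp only [Real.dist_eq] at this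
        simpa using this)
    rw [Measure.addHaar_real_closedBall _ _ hr0.le] at h2
    simp only [finrank_euclideanSpace, Fintype.card_fin] at h2
    exact (le_abs_self _).trans h2
  calc |avg g r x - g x| ≤ C * ((r ^ N)⁻¹ * ∫ y in Metric.closedBall x r, |g y - g x|) :=
        hC x r hr0
    _ ≤ C * ((r ^ N)⁻¹ * (ε / (2 * (C * v + 1)) * (r ^ N * v))) := by gcongr
    _ = ε / 2 * ((C * v) / (C * v + 1)) := by field_simp
    _ ≤ ε / 2 * 1 := by
        gcongr
        rw [div_le_one (by positivity)]; linarith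
    _ < ε := by linarith

/-- The point y is not in `U`, so it lies on or below the graph. Relative to y - s e, a displacement
z changes the height by at most ‖z‖ and the projection by at most 2‖z‖, so the point stays below the
graph if (2L + 1)‖z‖ < s. This dictates κ = 1/(2L + 1); s < r/2 keeps the ball in the chart. -/
theorem HasLipschitzBoundary.exists_exterior_ball {U : Set 𝔼} (hL : HasLipschitzBoundary U)
    (hU : IsOpen U) {y : 𝔼} (hy : y ∈ frontier U) :
    ∃ (e : 𝔼) (κ s₀ : ℝ), ‖e‖ = 1 ∧ 0 < κ ∧ κ ≤ 1 ∧ 0 < s₀ ∧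
      ∀ s, 0 < s → s < s₀ → Disjoint (Metric.ball (y - s • e) (κ * s)) U := by
  obtain ⟨e, γ, L, r, he, hγ, hr, hUr⟩ := hL y hy
  have hyU : y ∉ U := fun h => by
    rw [hU.frontier_eq] at hy; exact hy.2 h
  have hyγ : inner ℝ e y ≤ γ (y - inner ℝ e y • e) := by
    by_contra hh
    exact hyU ((hUr y (Metric.mem_ball_self hr)).2 (not_le.1 hh))
  have hL0 : (0 : ℝ) ≤ L := L.2
  have hee : inner ℝ e e = (1 : ℝ) := by rw [real_inner_self_eq_norm_sq, he]; norm_num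
  refine ⟨e, 1 / (2 * L + 1), r / 2, he, by positivity, ?_, by linarith, fun s hs hsr => ?_⟩
  · rw [div_le_one (by positivity)]; linarith
  refine Set.disjoint_left.2 fun x hx hxU => ?_
  set κ : ℝ := 1 / (2 * L + 1) with hκ
  have hκ1 : κ ≤ 1 := by rw [hκ, div_le_one (by positivity)]; linarith
  have hκL : κ * (2 * L + 1) = 1 := by rw [hκ]; field_simp
  obtain ⟨z, hz⟩ : ∃ z, z = x - (y - s • e) := ⟨_, rfl⟩
  have hzn : ‖z‖ < κ * s := by rw [hz, ← dist_eq_norm]; exact hx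
  have hxz : x = y - s • e + z := by rw [hz]; abel
  have hxe : inner ℝ e x = inner ℝ e y - s + inner ℝ e z := by
    rw [hxz, inner_add_right, inner_sub_right, inner_smul_right, hee]; ring
  have hez : |inner ℝ e z| ≤ ‖z‖ := by
    have := abs_real_inner_le_norm e z
    rwa [he, one_mul] at this
  have hproj : x - inner ℝ e x • e - (y - inner ℝ e y • e) = z - inner ℝ e z • e := by
    rw [hxe, hxz]; module
  have hdist : dist (γ (x - inner ℝ e x • e)) (γ (y - inner ℝ e y • e)) ≤ L * (2 * ‖z‖) := by
    refine (hγ.dist_le_mul _ _).trans ?_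
    gcongr
    rw [dist_eq_norm, hproj]
    refine (norm_sub_le _ _).trans ?_
    rw [norm_smul, he, mul_one, Real.norm_eq_abs]
    linarith
  have hxball : x ∈ Metric.ball y r := by
    rw [Metric.mem_ball, dist_eq_norm]
    have : x - y = z - s • e := by rw [hxz]; abel
    rw [this]
    refine (norm_sub_le _ _).trans_lt ?_
    rw [norm_smul, he, mul_one, Real.norm_of_nonneg hs.le]
    nlinarith
  have h1 := (hUr x hxball).1 hxU
  rw [Real.dist_eq, abs_le] at hdist
  have h2 := le_abs_self (inner ℝ e z)
  have h3 : (2 * L + 1) * ‖z‖ < s := by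
    calc (2 * L + 1) * ‖z‖ < (2 * L + 1) * (κ * s) := by gcongr
      _ = κ * (2 * L + 1) * s := by ring
      _ = s := by rw [hκL, one_mul]
  linarith [hdist.1]

theorem setIntegral_lapl_eq_zero {U : Set 𝔼} {ψ : 𝔼 → ℝ} (hψ : IsTestFunction U ψ) :
    ∫ x in U, lapl ψ x = 0 := by
  have h1 := integral_mul_lapl (f := fun _ => (1 : ℝ)) contDiff_const hψ.1 hψ.2.1
  have h2 := setIntegral_mul_test hψ.lapl (fun _ => (1 : ℝ))
  have h3 : ∀ x : 𝔼, lapl (fun _ => (1 : ℝ)) x = 0 := fun x => by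
    have h4 : ∀ i : Fin N, partialDeriv i (fun _ : 𝔼 => (1 : ℝ)) = fun _ => 0 := fun i => by
      funext y; simp [partialDeriv]
    refine Finset.sum_eq_zero fun i _ => ?_
    rw [h4]; simp [partialDeriv]
  simp only [one_mul, h3, zero_mul, integral_zero] at h1 h2
  rw [h2, h1]

theorem setIntegral_sub_const_mul_lapl {U : Set 𝔼} {u : 𝔼 → ℝ} (hu : IntegrableOn u U) (t : ℝ)
    {ψ : 𝔼 → ℝ} (hψ : IsTestFunction U ψ) :
    ∫ x in U, (u x - t) * lapl ψ x = ∫ x in U, u x * lapl ψ x := by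
  obtain ⟨C, -, hC⟩ := hψ.lapl.exists_bound
  have h1 : Integrable (fun x => u x * lapl ψ x) (volume.restrict U) :=
    hu.mul_bdd hψ.lapl.continuous.aestronglyMeasurable (Eventually.of_forall hC)
  simp only [sub_mul]
  rw [integral_sub h1 (hψ.lapl.integrable.integrableOn.const_mul t), integral_const_mul,
    setIntegral_lapl_eq_zero hψ, mul_zero, sub_zero]

/-- A solution with positive boundary values is positive near a Lipschitz boundary. -/
theorem IsObstacleRep.exists_pos_near_frontier {U A : Set 𝔼} {g : 𝔼 → ℝ}
    (h : IsObstacleRep U A g) (hUf : volume U ≠ ⊤) (hL : HasLipschitzBoundary U) {t : ℝ} (ht : 0 < t)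
    (hz : MemH10 U fun x => g x - t) {y : 𝔼} (hy : y ∈ frontier U) :
    ∃ ρ > 0, ∀ x ∈ U ∩ Metric.ball y ρ, 0 < g x := by
  obtain ⟨K, hK0, hK⟩ := exists_smoothTransition_deriv_bound
  -- F attains its upper bound `convexProfile t` at the zeros of g in `U`, and vanishes outside `U`.
  set F : 𝔼 → ℝ := U.indicator fun x => convexProfile (-(g x - t)) with hF
  have hw : WeakLaplGe univ F (-1) := by
    refine hz.weakLaplGe_univ h.isOpen (fun ψ hψ h0 => ?_) contDiff_convexProfile
      convexProfile_zero (by rw [deriv_convexProfile]; exact Real.smoothTransition.zero)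
      (fun s => by rw [deriv_convexProfile]; exact Real.smoothTransition.nonneg s)
      (fun s => by rw [deriv_convexProfile]; exact Real.smoothTransition.le_one s)
      (fun s => by rw [deriv_convexProfile]; exact smoothTransition_deriv_nonneg s)
      (fun s => by rw [deriv_convexProfile]; exact hK s)
    rw [setIntegral_sub_const_mul_lapl h.integrable.integrableOn t hψ,
      setIntegral_mul_test hψ.lapl,
      setIntegral_eq_integral_of_forall_compl_eq_zero fun x hx => hψ.eq_zero_of_notMem hx]
    refine (h.upper ψ hψ h0).trans ?_
    exact integral_mono (hψ.integrable.indicator h.measurableSet) hψ.integrable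
      fun x => indicator_le_self' (fun x _ => h0 x) x
  have hFt : ∀ x, F x ≤ convexProfile t := fun x => by
    by_cases hx : x ∈ U
    · rw [hF, indicator_of_mem hx]
      exact monotone_convexProfile (by linarith [h.nonneg x])
    · rw [hF, indicator_of_notMem hx]; exact convexProfile_nonneg t
  have hcU : ContinuousOn (fun x => convexProfile (-(g x - t))) U :=
    contDiff_convexProfile.continuous.comp_continuousOn (h.continuousOn.sub continuousOn_const).neg
  have hFi : Integrable F := by
    refine IntegrableOn.integrable_indicator ?_ h.isOpen.measurableSet
    refine (integrableOn_const (C := convexProfile t) hUf).mono'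
      (hcU.aestronglyMeasurable h.isOpen.measurableSet) ?_
    refine Eventually.of_forall fun x => ?_
    rw [Real.norm_of_nonneg (convexProfile_nonneg _)]
    exact monotone_convexProfile (by linarith [h.nonneg x])
  have hFle : ∀ x ∈ U, ∀ r, 0 < r → F x ≤ avg F r x + potMass N * r ^ 2 := by
    intro x hx r hr
    have hc : ContinuousAt F x := by
      refine (hcU.continuousAt (h.isOpen.mem_nhds hx)).congr ?_
      filter_upwards [h.isOpen.mem_nhds hx] with y hy
      rw [hF, indicator_of_mem hy]
    refine le_of_tendsto (tendsto_avg_of_continuousAt hFi hc) ?_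
    filter_upwards [Ioo_mem_nhdsGT hr] with s hs
    simpa using avg_le_avg_add hFi zero_le_one hw hs.1 hs.2.le (subset_univ _)
  obtain ⟨e, κ, s₀, he, hκ, hκ1, hs₀, hext⟩ := hL.exists_exterior_ball h.isOpen hy
  obtain ⟨m, hm, hlow⟩ := exists_eta_lower_bound (N := N)
  set v := volume.real (Metric.ball (0 : 𝔼) 1)
  have hv : 0 < v := ENNReal.toReal_pos (Metric.measure_ball_pos _ _ one_pos).ne'
    measure_ball_lt_top.ne
  have hHt := convexProfile_pos ht
  have hc0 : 0 < convexProfile t * (m * (κ / 4) ^ N * v) := by positivity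
  have hIoo : ∀ᶠ s in 𝓝[>] (0 : ℝ), s ∈ Ioo 0 s₀ := Ioo_mem_nhdsGT hs₀
  -- At scale 4s the mean value error is potMass · 16 s². It must be beaten by `convexProfile t`
  -- times a lower bound, independent of s, for the kernel mass on the exterior ball of radius κ s.
  obtain ⟨s, ⟨hs, hss₀⟩, hsmall⟩ := (hIoo.and
    ((tendsto_const_mul_sq_nhdsGT (potMass N * 16)).eventually (gt_mem_nhds hc0))).exists
  refine ⟨s, hs, fun x ⟨hxU, hxy⟩ => (h.nonneg x).lt_of_ne' fun hgx => ?_⟩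
  have h4s : (0 : ℝ) < 4 * s := by linarith
  set B := Metric.ball (y - s • e) (κ * s)
  have hBfin : volume B ≠ ⊤ := measure_ball_lt_top.ne
  have hBv : volume.real B = (κ * s) ^ N * v := by
    rw [measureReal_def, Measure.addHaar_ball_of_pos _ _ (by positivity : 0 < κ * s),
      ENNReal.toReal_mul, ENNReal.toReal_ofReal (by positivity)]
    simp [v, measureReal_def]
  have hηi : Integrable fun w => dilate (4 * s) (eta N) (x - w) :=
    (isTestFunction_dilate contDiff_eta eta_eq_zero h4s x (subset_univ _)).integrable
  have hBi : Integrable (B.indicator fun _ => (((4 * s) ^ N)⁻¹ * m)) :=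
    (integrableOn_const hBfin).integrable_indicator Metric.isOpen_ball.measurableSet
  -- The exterior ball contributes nothing to the average of F. It lies within 3s = (3/4)(4s) of x,
  -- so the kernel lower bound applies to it.
  have hpt : ∀ w, F w * dilate (4 * s) (eta N) (x - w) ≤ convexProfile t *
      (dilate (4 * s) (eta N) (x - w) - B.indicator (fun _ => (((4 * s) ^ N)⁻¹ * m)) w) := by
    intro w
    have hη0 := dilate_eta_nonneg h4s (x - w)
    by_cases hw : w ∈ B
    · have hwU : w ∉ U := fun hh => (Set.disjoint_left.1 (hext s hs hss₀)) hw hh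
      have hFw : F w = 0 := by rw [hF, indicator_of_notMem hwU]
      rw [hFw, zero_mul, indicator_of_mem hw]
      refine mul_nonneg hHt.le (sub_nonneg.2 (hlow h4s _ ?_))
      have h1 : x - w = (x - y) + s • e - (w - (y - s • e)) := by abel
      have h2 : ‖w - (y - s • e)‖ < κ * s := by rw [← dist_eq_norm]; exact hw
      have h3 : ‖x - y‖ < s := by rw [← dist_eq_norm]; exact hxy
      rw [h1]
      refine (norm_sub_le _ _).trans ?_
      have h5 := norm_add_le (x - y) (s • e)
      rw [norm_smul, he, mul_one, Real.norm_of_nonneg hs.le] at h5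
      nlinarith
    · rw [indicator_of_notMem hw, sub_zero]
      exact mul_le_mul_of_nonneg_right (hFt w) hη0
  have havg : avg F (4 * s) x ≤ convexProfile t * (1 - m * (κ / 4) ^ N * v) := by
    have h1 := integral_mono
      (integrable_mul_dilate hFi contDiff_eta.continuous eta_eq_zero h4s x)
      ((hηi.sub hBi).const_mul _) hpt
    rw [integral_const_mul, integral_sub' hηi hBi, integral_dilate_eta_sub h4s,
      integral_indicator Metric.isOpen_ball.measurableSet, setIntegral_const,
      hBv, smul_eq_mul] at h1
    refine h1.trans (le_of_eq ?_)
    congr 2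
    rw [mul_pow, mul_pow, div_pow]
    field_simp
  have hFx : F x = convexProfile t := by
    rw [hF, indicator_of_mem hxU]; simp [hgx]
  have := hFle x hxU (4 * s) h4s
  rw [hFx] at this
  nlinarith

theorem IsObstacleRep.zeroSetIn_subset {U A : Set 𝔼} {g : 𝔼 → ℝ} (hN : 1 ≤ N)
    (h : IsObstacleRep U A g) (hUb : Bornology.IsBounded U) (hA : IsRelClosedIn U A)
    (hAc : IsConnected (closure U \ A))
    (hpos : ∀ y ∈ frontier U, ∃ ρ > 0, ∀ x ∈ U ∩ Metric.ball y ρ, 0 < g x) :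
    zeroSetIn U g ⊆ A := by
  obtain ⟨F, hFc, rfl⟩ := hA
  set V := U ∩ Fᶜ
  have hV : IsOpen V := h.isOpen.inter hFc.isOpen_compl
  have hVA : Disjoint V (U ∩ F) := Set.disjoint_left.2 fun x hx hx' => hx.2 hx'.2
  choose! ρ hρ0 hρ using hpos
  -- The connected set `closure U \ A` is covered by the disjoint open sets D and W. It meets W on
  -- the frontier, so it lies in W and D is empty.
  set D := {x | x ∈ V ∧ g x = 0}
  set W := (U ∩ {x | 0 < g x}) ∪ ⋃ y ∈ frontier U, Metric.ball y (ρ y)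
  have hD : IsOpen D := isOpen_iff_mem_nhds.2 fun x hx => by
    filter_upwards [hV.mem_nhds hx.1,
      h.eventually_eq_zero hV inter_subset_left hVA hx.1 hx.2] with y hy1 hy2 using ⟨hy1, hy2⟩
  have hW : IsOpen W := (h.continuousOn.isOpen_inter_preimage h.isOpen isOpen_Ioi).union
    (isOpen_biUnion fun y _ => Metric.isOpen_ball)
  have hWD : Disjoint W D := by
    refine Set.disjoint_left.2 fun x hx hxD => ?_
    rcases hx with hx | hx
    · exact (ne_of_gt hx.2) hxD.2
    · obtain ⟨y, hy, hxy⟩ := mem_iUnion₂.1 hx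
      exact (hρ y hy x ⟨hxD.1.1, hxy⟩).ne' hxD.2
  have hfr : frontier U ⊆ W := fun y hy =>
    Or.inr (mem_iUnion₂.2 ⟨y, hy, Metric.mem_ball_self (hρ0 y hy)⟩)
  have hcover : closure U \ (U ∩ F) ⊆ W ∪ D := by
    intro x hx
    by_cases hxU : x ∈ U
    · rcases (h.nonneg x).eq_or_lt with h0 | h0
      · exact Or.inr ⟨⟨hxU, fun hxF => hx.2 ⟨hxU, hxF⟩⟩, h0.symm⟩
      · exact Or.inl (Or.inl ⟨hxU, h0⟩)
    · refine Or.inl (hfr ?_)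
      rw [h.isOpen.frontier_eq]; exact ⟨hx.1, hxU⟩
  have hne : (closure U \ (U ∩ F) ∩ W).Nonempty := by
    -- An empty frontier would make `U` empty, which nonemptiness of `closure U \ A` excludes, or
    -- the whole space, which is unbounded because `N ≥ 1`.
    have hfne : (frontier U).Nonempty := by
      rw [nonempty_iff_ne_empty, Ne, frontier_eq_empty_iff]
      rintro (hemp | huniv)
      · obtain ⟨x, hx⟩ := hAc.1
        simp [hemp] at hx
      · have : Nontrivial 𝔼 := by
          have : Nonempty (Fin N) := ⟨⟨0, hN⟩⟩
          infer_instance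
        rw [huniv] at hUb
        exact NormedSpace.unbounded_univ ℝ 𝔼 hUb
    obtain ⟨y, hy⟩ := hfne
    refine ⟨y, ⟨frontier_subset_closure hy, fun hyA => ?_⟩, hfr hy⟩
    rw [h.isOpen.frontier_eq] at hy
    exact hy.2 hyA.1
  have hsub := IsPreconnected.subset_left_of_subset_union hW hD hWD hcover hne hAc.2
  intro x hx
  by_contra hxA
  exact Set.disjoint_left.1 hWD (hsub ⟨subset_closure hx.1, hxA⟩)
    ⟨⟨hx.1, fun hxF => hxA ⟨hx.1, hxF⟩⟩, hx.2⟩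

end Boundary

/-! ### Comparison of two solutions. -/

section Comparison

variable {N : ℕ}

local notation "𝔼" => EuclideanSpace ℝ (Fin N)

theorem HasH1Gradient.congr_ae {U : Set 𝔼} (hUf : volume U ≠ ⊤) {w w' : 𝔼 → ℝ} {G : 𝔼 → 𝔼}
    (h : HasH1Gradient U w G) (hw : w =ᵐ[volume.restrict U] w') : HasH1Gradient U w' G := by
  have hfin : IsFiniteMeasure (volume.restrict U) := ⟨by
    rw [Measure.restrict_apply_univ]; exact hUf.lt_top⟩
  have h2 : MemLp w' 2 (volume.restrict U) := h.2.1.ae_eq hw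
  have hi : IntegrableOn w' U := h2.integrable one_le_two
  refine ⟨⟨hi.locallyIntegrableOn, h.1.2.1, fun φ hφ e => ?_⟩, h2, h.2.2⟩
  rw [← h.1.2.2 φ hφ e]
  exact integral_congr_ae (by filter_upwards [hw] with x hx; rw [hx])

theorem MemH10.congr_ae {U : Set 𝔼} (hUf : volume U ≠ ⊤) {w w' : 𝔼 → ℝ} (h : MemH10 U w)
    (hw : w =ᵐ[volume.restrict U] w') : MemH10 U w' := by
  obtain ⟨G, hG, happ⟩ := h
  refine ⟨G, hG.congr_ae hUf hw, fun ε hε => ?_⟩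
  obtain ⟨φ, hφ, h1, h2⟩ := happ ε hε
  refine ⟨φ, hφ, ?_, h2⟩
  rwa [eLpNorm_congr_ae (g := fun x => w x - φ x)]
  filter_upwards [hw] with x hx
  rw [hx]

theorem HasH1Gradient.sub {U : Set 𝔼} {w₁ w₂ : 𝔼 → ℝ} {G₁ G₂ : 𝔼 → 𝔼}
    (h₁ : HasH1Gradient U w₁ G₁) (h₂ : HasH1Gradient U w₂ G₂) :
    HasH1Gradient U (fun x => w₁ x - w₂ x) (fun x => G₁ x - G₂ x) := by
  refine ⟨⟨h₁.1.1.sub h₂.1.1, h₁.1.2.1.sub h₂.1.2.1, fun φ hφ e => ?_⟩, h₁.2.1.sub h₂.2.1,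
    h₁.2.2.sub h₂.2.2⟩
  have ht : IsTestFunction U (fun x => fderiv ℝ φ x e) :=
    ⟨(hφ.1.fderiv_right (m := ∞) (by simp)).clm_apply contDiff_const, hφ.2.1.fderiv_apply ℝ e,
      (tsupport_fderiv_apply_subset ℝ e).trans hφ.2.2⟩
  have hi : ∀ {w : 𝔼 → ℝ}, LocallyIntegrableOn w U volume →
      Integrable (fun x => w x * fderiv ℝ φ x e) (volume.restrict U) := fun hw =>
    (hw.integrable_smul_test ht).congr (Eventually.of_forall fun x => by simp [mul_comm])
  have hi' : ∀ {G : 𝔼 → 𝔼}, LocallyIntegrableOn G U volume →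
      Integrable (fun x => φ x * inner ℝ (G x) e) (volume.restrict U) := fun hG =>
    ((hG.integrable_smul_test hφ).inner_const (𝕜 := ℝ) e).congr
      (Eventually.of_forall fun x => by simp [inner_smul_left])
  simp only [sub_mul, inner_sub_left, mul_sub]
  rw [integral_sub (hi h₁.1.1) (hi h₂.1.1), integral_sub (hi' h₁.1.2.1) (hi' h₂.1.2.1),
    h₁.1.2.2 φ hφ e, h₂.1.2.2 φ hφ e]
  ring

theorem gradient_sub_apply {f g : 𝔼 → ℝ} (hf : ContDiff ℝ ∞ f) (hg : ContDiff ℝ ∞ g) (x : 𝔼) :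
    gradient (fun y => f y - g y) x = gradient f x - gradient g x := by
  simp only [gradient]
  rw [fderiv_fun_sub (hf.contDiffAt.differentiableAt (by simp))
    (hg.contDiffAt.differentiableAt (by simp)), map_sub]

theorem MemH10.sub {U : Set 𝔼} {w₁ w₂ : 𝔼 → ℝ} (h₁ : MemH10 U w₁) (h₂ : MemH10 U w₂) :
    MemH10 U (fun x => w₁ x - w₂ x) := by
  obtain ⟨G₁, hG₁, h₁⟩ := h₁
  obtain ⟨G₂, hG₂, h₂⟩ := h₂
  refine ⟨_, hG₁.sub hG₂, fun ε hε => ?_⟩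
  have hε2 : 0 < ε / 2 := ENNReal.half_pos hε.ne'
  obtain ⟨φ₁, hφ₁, a₁, b₁⟩ := h₁ _ hε2
  obtain ⟨φ₂, hφ₂, a₂, b₂⟩ := h₂ _ hε2
  refine ⟨_, hφ₁.sub hφ₂, ?_, ?_⟩
  · have e : (fun x => w₁ x - w₂ x - (φ₁ x - φ₂ x)) =
        (fun x => w₁ x - φ₁ x) - fun x => w₂ x - φ₂ x := by
      funext x; simp only [Pi.sub_apply]; ring
    rw [e]
    refine (eLpNorm_sub_le (hG₁.2.1.sub (hφ₁.memLp U)).1 (hG₂.2.1.sub (hφ₂.memLp U)).1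
      one_le_two).trans_lt ?_
    rw [← ENNReal.add_halves ε]
    exact ENNReal.add_lt_add a₁ a₂
  · have e : (fun x => G₁ x - G₂ x - gradient (fun y => φ₁ y - φ₂ y) x) =
        (fun x => G₁ x - gradient φ₁ x) - fun x => G₂ x - gradient φ₂ x := by
      funext x; simp only [Pi.sub_apply]; rw [gradient_sub_apply hφ₁.1 hφ₂.1]; abel
    rw [e]
    refine (eLpNorm_sub_le (hG₁.2.2.sub (hφ₁.memLp_gradient U)).1
      (hG₂.2.2.sub (hφ₂.memLp_gradient U)).1 one_le_two).trans_lt ?_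
    rw [← ENNReal.add_halves ε]
    exact ENNReal.add_lt_add b₁ b₂

/-- `L¹`-contraction: if `z ∈ H¹₀(U)` and `Δz = h`, then `∫_{z > 0} h ≤ 0`. -/
theorem MemH10.setIntegral_pos_nonpos {U : Set 𝔼} {z : 𝔼 → ℝ} (hz : MemH10 U z) {h : 𝔼 → ℝ}
    (hh : MemLp h 2 (volume.restrict U)) (hi : IntegrableOn h U)
    (heq : ∀ ψ, IsTestFunction U ψ → ∫ x in U, z x * lapl ψ x = ∫ x in U, h x * ψ x) :
    ∫ x in U, {x | 0 < z x}.indicator h x ≤ 0 := by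
  obtain ⟨K, hK0, hK⟩ := exists_smoothTransition_deriv_bound
  have hzm : AEStronglyMeasurable z (volume.restrict U) := by
    obtain ⟨G, hG, -⟩ := hz; exact hG.2.1.1
  -- As n grows, these increasing functions of z tend pointwise to the indicator of {z > 0}.
  have h1 : ∀ n : ℕ, ∫ x in U, h x * Real.smoothTransition (n * z x) ≤ 0 := by
    intro n
    have hd : ∀ s : ℝ, deriv (fun s => Real.smoothTransition (n * s)) s =
        n * deriv Real.smoothTransition (n * s) := fun s => by
      rw [deriv_comp_mul_left, smul_eq_mul]
    refine hz.integral_mul_comp_nonpos hh heq (H := fun s => Real.smoothTransition (n * s))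
      (K := n * K) (Real.smoothTransition.contDiff.comp (contDiff_const.mul contDiff_id))
      (by simp) (fun s => ?_) (fun s => ?_)
    · rw [hd]; exact mul_nonneg n.cast_nonneg (smoothTransition_deriv_nonneg _)
    · rw [hd]; exact mul_le_mul_of_nonneg_left (hK _) n.cast_nonneg
  refine le_of_tendsto' (tendsto_integral_of_dominated_convergence (fun x => |h x|) (fun n => ?_)
    hi.abs (fun n => Eventually.of_forall fun x => ?_) (Eventually.of_forall fun x => ?_)) h1
  · exact hi.aestronglyMeasurable.mul
      (Real.smoothTransition.continuous.comp_aestronglyMeasurable (hzm.const_mul _))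
  · rw [Real.norm_eq_abs, abs_mul, abs_of_nonneg (Real.smoothTransition.nonneg _)]
    exact mul_le_of_le_one_right (abs_nonneg _) (Real.smoothTransition.le_one _)
  · rcases lt_or_ge 0 (z x) with hx | hx
    · rw [indicator_of_mem (show x ∈ {x | 0 < z x} from hx)]
      refine tendsto_const_nhds.congr' ?_
      have ht : Tendsto (fun n : ℕ => (n : ℝ) * z x) atTop atTop :=
        tendsto_natCast_atTop_atTop.atTop_mul_const hx
      filter_upwards [ht.eventually_ge_atTop 1] with n hn
      rw [Real.smoothTransition.one_of_one_le hn, mul_one]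
    · rw [indicator_of_notMem (show x ∉ {x | 0 < z x} from not_lt.2 hx)]
      refine tendsto_const_nhds.congr fun n => ?_
      rw [Real.smoothTransition.zero_of_nonpos (mul_nonpos_of_nonneg_of_nonpos n.cast_nonneg hx),
        mul_zero]

variable {U A B : Set (EuclideanSpace ℝ (Fin N))} {f g : EuclideanSpace ℝ (Fin N) → ℝ}

theorem IsObstacleRep.integrable_source (h : IsObstacleRep U A g) (hUf : volume U ≠ ⊤) :
    Integrable ((A ∩ {x | 0 < g x}).indicator fun _ => (1 : ℝ)) :=
  (integrableOn_const (measure_ne_top_of_subset (inter_subset_left.trans h.subset)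
    hUf)).integrable_indicator h.measurableSet_pos

theorem IsObstacleRep.measurableSet_zeroSetIn (h : IsObstacleRep U A g) :
    MeasurableSet (zeroSetIn U g) := by
  have : zeroSetIn U g = U \ (U ∩ {x | 0 < g x}) := by
    ext x
    constructor
    · exact fun hx => ⟨hx.1, fun h' => (ne_of_gt h'.2) hx.2⟩
    · exact fun hx => ⟨hx.1, le_antisymm (not_lt.1 fun h' => hx.2 ⟨hx.1, h'⟩) (h.nonneg x)⟩
  rw [this]
  exact h.isOpen.measurableSet.diff
    (h.continuousOn.isOpen_inter_preimage h.isOpen isOpen_Ioi).measurableSet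

/-- The contraction inequality ∫_{f > g} (a - b) ≤ 0 for the sources a, b is combined with a
pointwise lower bound of the integrand by the difference of the indicators of the two sets in the
conclusion. -/
theorem IsObstacleRep.volume_zeroSetIn_diff_le (hf : IsObstacleRep U A f) (hg : IsObstacleRep U B g)
    (hUf : volume U ≠ ⊤) (hz : MemH10 U fun x => f x - g x) (hgB : zeroSetIn U g ⊆ B) :
    volume ((U \ zeroSetIn U f) ∩ zeroSetIn U g) ≤ volume (B ∩ (U \ A)) := by
  have hfin : IsFiniteMeasure (volume.restrict U) := ⟨by
    rw [Measure.restrict_apply_univ]; exact hUf.lt_top⟩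
  set a : 𝔼 → ℝ := (A ∩ {x | 0 < f x}).indicator fun _ => (1 : ℝ)
  set b : 𝔼 → ℝ := (B ∩ {x | 0 < g x}).indicator fun _ => (1 : ℝ)
  have hai : Integrable a := hf.integrable_source hUf
  have hbi : Integrable b := hg.integrable_source hUf
  have hbd : ∀ x, |a x - b x| ≤ 1 := fun x => by
    have ha0 : 0 ≤ a x := indicator_nonneg (fun _ _ => zero_le_one) x
    have hb0 : 0 ≤ b x := indicator_nonneg (fun _ _ => zero_le_one) x
    have ha1 : a x ≤ 1 := indicator_le_self' (f := fun _ => (1 : ℝ)) (fun _ _ => zero_le_one) x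
    have hb1 : b x ≤ 1 := indicator_le_self' (f := fun _ => (1 : ℝ)) (fun _ _ => zero_le_one) x
    rw [abs_le]; constructor <;> linarith
  have hh : MemLp (fun x => a x - b x) 2 (volume.restrict U) :=
    MemLp.of_bound (hai.sub hbi).aestronglyMeasurable.restrict 1 (Eventually.of_forall hbd)
  have heq : ∀ ψ, IsTestFunction U ψ → ∫ x in U, (f x - g x) * lapl ψ x =
      ∫ x in U, (a x - b x) * ψ x := by
    intro ψ hψ
    obtain ⟨C, -, hC⟩ := hψ.exists_bound
    obtain ⟨C', -, hC'⟩ := hψ.lapl.exists_bound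
    rw [setIntegral_mul_test hψ.lapl (fun x => f x - g x),
      setIntegral_mul_test hψ (fun x => a x - b x)]
    simp only [sub_mul]
    rw [integral_sub (integrable_mul_of_bound hf.integrable hψ.lapl.continuous hC')
      (integrable_mul_of_bound hg.integrable hψ.lapl.continuous hC'),
      integral_sub (integrable_mul_of_bound hai hψ.continuous hC)
      (integrable_mul_of_bound hbi hψ.continuous hC), hf.integral_mul_lapl_eq hUf hψ,
      hg.integral_mul_lapl_eq hUf hψ]
  have key := hz.setIntegral_pos_nonpos hh (hai.sub hbi).integrableOn heq
  set S := (U \ zeroSetIn U f) ∩ zeroSetIn U g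
  set T := B ∩ (U \ A)
  have hSU : S ⊆ U := fun x hx => hx.1.1
  have hTU : T ⊆ U := fun x hx => hx.2.1
  have hSm : MeasurableSet S :=
    (hf.isOpen.measurableSet.diff hf.measurableSet_zeroSetIn).inter hg.measurableSet_zeroSetIn
  have hTm : MeasurableSet T :=
    hg.measurableSet.inter (hf.isOpen.measurableSet.diff hf.measurableSet)
  have hSf : volume S ≠ ⊤ := measure_ne_top_of_subset hSU hUf
  have hTf : volume T ≠ ⊤ := measure_ne_top_of_subset hTU hUf
  have hSi : Integrable (S.indicator fun _ => (1 : ℝ)) :=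
    (integrableOn_const hSf).integrable_indicator hSm
  have hTi : Integrable (T.indicator fun _ => (1 : ℝ)) :=
    (integrableOn_const hTf).integrable_indicator hTm
  have hpm : MeasurableSet (U ∩ {x | 0 < f x - g x}) :=
    ((hf.continuousOn.sub hg.continuousOn).isOpen_inter_preimage hf.isOpen isOpen_Ioi).measurableSet
  -- Where f > g = 0 the point is in S and, by `hgB`, in B, so both sides equal χ_A. Where f > g >
  -- 0, a - b = χ_A - χ_B ≥ -χ_T. Where f ≤ g there is no point of S.
  have hle : ∫ x in U, (S.indicator (fun _ => (1 : ℝ)) x - T.indicator (fun _ => (1 : ℝ)) x) ≤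
      ∫ x in U, {x | 0 < f x - g x}.indicator (fun x => a x - b x) x := by
    refine setIntegral_mono_on (hSi.sub hTi).integrableOn ?_ hf.isOpen.measurableSet
      fun x hxU => ?_
    · have : IntegrableOn ((U ∩ {x | 0 < f x - g x}).indicator fun x => a x - b x) U :=
        ((hai.sub hbi).indicator hpm).integrableOn
      refine this.congr_fun (fun x hx => ?_) hf.isOpen.measurableSet
      simp [indicator, hx]
    · have hT0 : 0 ≤ T.indicator (fun _ => (1 : ℝ)) x := indicator_nonneg (fun _ _ => zero_le_one) x
      by_cases hp : 0 < f x - g x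
      · rw [indicator_of_mem (show x ∈ {x | 0 < f x - g x} from hp)]
        have hfx : 0 < f x := by linarith [hg.nonneg x]
        by_cases hg0 : g x = 0
        · have hxB : x ∈ B := hgB ⟨hxU, hg0⟩
          have hxS : x ∈ S := ⟨⟨hxU, fun h' => hfx.ne' h'.2⟩, ⟨hxU, hg0⟩⟩
          by_cases hxA : x ∈ A
          · simp [a, b, T, indicator, hxS, hxA, hfx, hg0]
          · simp [a, b, T, indicator, hxS, hxA, hxB, hg0, hxU]
        · have hxS : x ∉ S := fun h' => hg0 h'.2.2
          by_cases hxA : x ∈ A <;> by_cases hxB : x ∈ B <;> by_cases hgx : 0 < g x <;>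
            simp [a, b, T, indicator, hxS, hxA, hxB, hfx, hgx, hxU]
      · rw [indicator_of_notMem (show x ∉ {x | 0 < f x - g x} from hp)]
        have hxS : x ∉ S := fun h' => by
          have h1 : f x ≠ 0 := fun h0 => h'.1.2 ⟨hxU, h0⟩
          have h2 : g x = 0 := h'.2.2
          have := (hf.nonneg x).lt_of_ne' h1
          rw [h2, sub_zero] at hp
          exact hp this
        rw [indicator_of_notMem hxS]
        linarith
  rw [integral_sub hSi.integrableOn hTi.integrableOn, setIntegral_indicator hSm,
    setIntegral_indicator hTm, inter_eq_right.2 hSU, inter_eq_right.2 hTU] at hle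
  simp only [setIntegral_const, smul_eq_mul, mul_one] at hle
  have : volume.real S ≤ volume.real T := by linarith
  exact (ENNReal.toReal_le_toReal hSf hTf).1 this

theorem IsObstacleRep.volume_symmDiff_zeroSetIn_le (hf : IsObstacleRep U A f)
    (hg : IsObstacleRep U B g)
    (h1 : volume ((U \ zeroSetIn U f) ∩ zeroSetIn U g) ≤ volume (B ∩ (U \ A)))
    (h2 : volume ((U \ zeroSetIn U g) ∩ zeroSetIn U f) ≤ volume (A ∩ (U \ B))) :
    volume (symmDiff (zeroSetIn U f) (zeroSetIn U g)) ≤ volume (symmDiff A B) := by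
  have e1 : symmDiff (zeroSetIn U f) (zeroSetIn U g) ⊆
      ((U \ zeroSetIn U g) ∩ zeroSetIn U f) ∪ ((U \ zeroSetIn U f) ∩ zeroSetIn U g) := by
    rintro x (⟨hx, hx'⟩ | ⟨hx, hx'⟩)
    · exact Or.inl ⟨⟨hx.1, hx'⟩, hx⟩
    · exact Or.inr ⟨⟨hx.1, hx'⟩, hx⟩
  have e2 : symmDiff A B = (A ∩ (U \ B)) ∪ (B ∩ (U \ A)) := by
    ext x
    simp only [Set.mem_symmDiff, mem_union, mem_inter_iff, Set.mem_sdiff]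
    have h3 := @hf.subset x
    have h4 := @hg.subset x
    tauto
  rw [e2, measure_union]
  · exact (measure_mono e1).trans ((measure_union_le _ _).trans (add_le_add h2 h1))
  · exact Set.disjoint_left.2 fun x hx hx' => hx.2.2 hx'.1
  · exact hg.measurableSet.inter (hf.isOpen.measurableSet.diff hf.measurableSet)

/-- If `A ⊆ B`, then smooth convex increasing functions of `g - f` vanishing where `g ≤ f` are
subharmonic. -/
theorem IsObstacleRep.integral_comp_mul_lapl_nonneg (hf : IsObstacleRep U A f)
    (hg : IsObstacleRep U B g) (hUf : volume U ≠ ⊤) (hAB : A ⊆ B) {H : ℝ → ℝ} (hH : ContDiff ℝ ∞ H)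
    (h0 : H 0 = 0) (hneg : ∀ s ≤ 0, deriv H s = 0) (hd : ∀ s, 0 ≤ deriv H s)
    (hd1 : ∀ s, deriv H s ≤ 1) (hdd : ∀ s, 0 ≤ deriv (deriv H) s) {ψ : 𝔼 → ℝ}
    (hψ : IsTestFunction U ψ) (hψ0 : ∀ x, 0 ≤ ψ x) :
    0 ≤ ∫ x, H (g x - f x) * lapl ψ x := by
  have hball := eventually_closedBall_subset_of_isCompact hf.isOpen hψ.2.1 hψ.2.2
  have hzero : ∀ x ∉ tsupport ψ, lapl ψ x = 0 := fun x hx =>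
    image_eq_zero_of_notMem_tsupport fun h' => hx (tsupport_lapl_subset ψ h')
  have hzero' : ∀ x ∉ tsupport ψ, ψ x = 0 := fun x hx => image_eq_zero_of_notMem_tsupport hx
  obtain ⟨L, hL0, hL⟩ := hψ.lapl.exists_bound
  have hab1 : ∀ s, |deriv H s| ≤ 1 := fun s => by rw [abs_of_nonneg (hd s)]; exact hd1 s
  have hH1 : ∀ s, |H s| ≤ |s| := fun s => by
    simpa [h0] using abs_sub_le_of_deriv_le hH hab1 s 0
  -- The classical chain rule applies to the mollified difference; its Laplacian is bounded and
  -- converges almost everywhere to the difference of the sources.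
  set w : ℝ → 𝔼 → ℝ := fun r x => avg g r x - avg f r x
  have hw : ∀ r, 0 < r → ContDiff ℝ ∞ (w r) := fun r hr =>
    (contDiff_avg hg.integrable hr).sub (contDiff_avg hf.integrable hr)
  have hwt : ∀ x ∈ tsupport ψ, Tendsto (fun r => w r x) (𝓝[>] 0) (𝓝 (g x - f x)) := fun x hx =>
    (hg.tendsto_avg (hψ.2.2 hx)).sub (hf.tendsto_avg (hψ.2.2 hx))
  have h1 : Tendsto (fun r => ∫ x, H (w r x) * lapl ψ x) (𝓝[>] 0)
      (𝓝 (∫ x, H (g x - f x) * lapl ψ x)) := by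
    refine tendsto_integral_filter_of_dominated_convergence
      (fun x => (|g x * lapl ψ x| + |f x * lapl ψ x|) + 2 * potMass N * |lapl ψ x|) ?_ ?_ ?_ ?_
    · filter_upwards [self_mem_nhdsWithin] with r hr
      exact ((hH.continuous.comp (hw r hr).continuous).mul
        hψ.lapl.continuous).aestronglyMeasurable
    · filter_upwards [hball, Ioo_mem_nhdsGT one_pos] with r hr hr1
      refine Eventually.of_forall fun x => ?_
      by_cases hx : x ∈ tsupport ψ
      · have h3 : potMass N * r ^ 2 ≤ potMass N * 1 :=
          mul_le_mul_of_nonneg_left (pow_le_one₀ hr1.1.le hr1.2.le) potMass_nonneg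
        have h4 := hg.abs_avg_sub_le x r hr1.1 (hr x hx)
        have h5 := hf.abs_avg_sub_le x r hr1.1 (hr x hx)
        have h6 : |w r x| ≤ |g x| + |f x| + 2 * potMass N := by
          have e1 := abs_sub_abs_le_abs_sub (avg g r x) (g x)
          have e2 := abs_sub_abs_le_abs_sub (avg f r x) (f x)
          have e3 := abs_sub (avg g r x) (avg f r x)
          simp only [w]
          linarith
        rw [Real.norm_eq_abs, abs_mul, abs_mul, abs_mul, ← add_mul, ← add_mul]
        exact mul_le_mul_of_nonneg_right ((hH1 _).trans h6) (abs_nonneg _)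
      · simp [hzero x hx]
    · exact ((integrable_mul_of_bound hg.integrable hψ.lapl.continuous hL).abs.add
        (integrable_mul_of_bound hf.integrable hψ.lapl.continuous hL).abs).add
        (hψ.lapl.integrable.abs.const_mul _)
    · refine Eventually.of_forall fun x => ?_
      by_cases hx : x ∈ tsupport ψ
      · exact ((hH.continuous.tendsto _).comp (hwt x hx)).mul_const _
      · simp [hzero x hx]
  set a : 𝔼 → ℝ := (A ∩ {x | 0 < f x}).indicator fun _ => (1 : ℝ)
  set b : 𝔼 → ℝ := (B ∩ {x | 0 < g x}).indicator fun _ => (1 : ℝ)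
  have h2 : Tendsto (fun r => ∫ x, ψ x * (deriv H (w r x) * (lapl (avg g r) x - lapl (avg f r) x)))
      (𝓝[>] 0) (𝓝 (∫ x, ψ x * (deriv H (g x - f x) * (b x - a x)))) := by
    refine tendsto_integral_filter_of_dominated_convergence (fun x => |ψ x|) ?_ ?_
      hψ.integrable.abs ?_
    · filter_upwards [self_mem_nhdsWithin] with r hr
      exact (hψ.continuous.mul ((hH.deriv_top.continuous.comp (hw r hr).continuous).mul
        ((contDiff_avg hg.integrable hr).lapl.continuous.sub
          (contDiff_avg hf.integrable hr).lapl.continuous))).aestronglyMeasurable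
    · filter_upwards [hball, self_mem_nhdsWithin] with r hr hr1
      refine Eventually.of_forall fun x => ?_
      by_cases hx : x ∈ tsupport ψ
      · have e1 := hg.lapl_avg_nonneg hr1 (hr x hx)
        have e2 := hf.lapl_avg_nonneg hr1 (hr x hx)
        have e3 := hg.lapl_avg_le_one hr1 (hr x hx)
        have e4 := hf.lapl_avg_le_one hr1 (hr x hx)
        have e5 : |lapl (avg g r) x - lapl (avg f r) x| ≤ 1 := by
          rw [abs_le]; constructor <;> linarith
        rw [Real.norm_eq_abs, abs_mul, abs_mul]
        exact mul_le_of_le_one_right (abs_nonneg _)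
          (mul_le_one₀ (hab1 _) (abs_nonneg _) e5)
      · simp [hzero' x hx]
    · filter_upwards [hg.ae_tendsto_lapl_avg hUf, hf.ae_tendsto_lapl_avg hUf] with x hx1 hx2
      by_cases hx : x ∈ tsupport ψ
      · exact (((hH.deriv_top.continuous.tendsto _).comp (hwt x hx)).mul
          ((hx1 (hψ.2.2 hx)).sub (hx2 (hψ.2.2 hx)))).const_mul _
      · simp [hzero' x hx]
  -- H' vanishes unless g > f. There g > 0, so b = χ_B ≥ χ_A ≥ a.
  have h3 : 0 ≤ ∫ x, ψ x * (deriv H (g x - f x) * (b x - a x)) := by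
    refine integral_nonneg fun x => mul_nonneg (hψ0 x) ?_
    rcases le_or_gt (g x - f x) 0 with hx | hx
    · rw [hneg _ hx, zero_mul]
    · refine mul_nonneg (hd _) ?_
      have hgx : 0 < g x := by linarith [hf.nonneg x]
      by_cases hxA : x ∈ A
      · by_cases hfx : 0 < f x <;> simp [a, b, hgx, hfx, hxA, hAB hxA]
      · by_cases hxB : x ∈ B <;> simp [a, b, hgx, hxA, hxB]
  refine h3.trans (le_of_tendsto_of_tendsto h2 h1 ?_)
  filter_upwards [self_mem_nhdsWithin] with r hr
  have hHw : ContDiff ℝ ∞ fun x => H (w r x) := hH.comp (hw r hr)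
  rw [integral_mul_lapl hHw hψ.1 hψ.2.1]
  refine integral_mono ?_ ?_ fun x => ?_
  · refine Continuous.integrable_of_hasCompactSupport ?_ hψ.2.1.mul_right
    exact hψ.continuous.mul ((hH.deriv_top.continuous.comp (hw r hr).continuous).mul
        ((contDiff_avg hg.integrable hr).lapl.continuous.sub
          (contDiff_avg hf.integrable hr).lapl.continuous))
  · exact (hHw.lapl.continuous.mul hψ.continuous).integrable_of_hasCompactSupport
      hψ.2.1.mul_left
  · simp only
    rw [lapl_comp (hw r hr) hH, lapl_sub (contDiff_avg hg.integrable hr)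
      (contDiff_avg hf.integrable hr), mul_comm (ψ x)]
    refine mul_le_mul_of_nonneg_right ?_ (hψ0 x)
    have : 0 ≤ deriv (deriv H) (w r x) * ∑ i, partialDeriv i (w r) x ^ 2 :=
      mul_nonneg (hdd _) (Finset.sum_nonneg fun i _ => sq_nonneg _)
    linarith

/-- If `A ⊆ B`, then `(g - f)₊` is weakly subharmonic. -/
theorem IsObstacleRep.integral_max_mul_lapl_nonneg (hf : IsObstacleRep U A f)
    (hg : IsObstacleRep U B g) (hUf : volume U ≠ ⊤) (hAB : A ⊆ B) {ψ : 𝔼 → ℝ}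
    (hψ : IsTestFunction U ψ) (hψ0 : ∀ x, 0 ≤ ψ x) :
    0 ≤ ∫ x, max (g x - f x) 0 * lapl ψ x := by
  obtain ⟨L, hL0, hL⟩ := hψ.lapl.exists_bound
  -- This rescaling keeps the slope at most 1 and lies between s₊ - 1/(n+1) and s₊.
  set H : ℕ → ℝ → ℝ := fun n s => ((n : ℝ) + 1)⁻¹ * convexProfile ((n + 1) * s)
  have hdH : ∀ n s, HasDerivAt (H n) (Real.smoothTransition ((n + 1) * s)) s := fun n s => by
    have h1 := ((hasDerivAt_convexProfile ((n + 1) * s)).comp s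
      ((hasDerivAt_id s).const_mul ((n : ℝ) + 1))).const_mul ((n : ℝ) + 1)⁻¹
    refine h1.congr_deriv ?_
    field_simp
  have hdH' : ∀ n, deriv (H n) = fun s => Real.smoothTransition ((n + 1) * s) := fun n =>
    funext fun s => (hdH n s).deriv
  have hcH : ∀ n, ContDiff ℝ ∞ (H n) := fun n =>
    contDiff_const.mul (contDiff_convexProfile.comp (contDiff_const.mul contDiff_id))
  have hlo : ∀ (n : ℕ) (s : ℝ), max s 0 - ((n : ℝ) + 1)⁻¹ ≤ H n s := fun n s => by
    have h1 := max_sub_one_le_convexProfile (((n : ℝ) + 1) * s)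
    have h2 : max (((n : ℝ) + 1) * s) 0 = (n + 1) * max s 0 := by
      rw [mul_max_of_nonneg _ _ (by positivity), mul_zero]
    rw [h2] at h1
    have h3 := mul_le_mul_of_nonneg_left h1 (by positivity : 0 ≤ ((n : ℝ) + 1)⁻¹)
    refine le_trans (le_of_eq ?_) h3
    field_simp
  have hup : ∀ n s, H n s ≤ max s 0 := fun n s => by
    have h1 := convexProfile_le (((n : ℝ) + 1) * s)
    have h2 : max (((n : ℝ) + 1) * s) 0 = (n + 1) * max s 0 := by
      rw [mul_max_of_nonneg _ _ (by positivity), mul_zero]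
    rw [h2] at h1
    have h3 := mul_le_mul_of_nonneg_left h1 (by positivity : 0 ≤ ((n : ℝ) + 1)⁻¹)
    refine h3.trans (le_of_eq ?_)
    field_simp
  have hnn : ∀ n s, 0 ≤ H n s := fun n s => mul_nonneg (by positivity) (convexProfile_nonneg _)
  have hpos : ∀ n : ℕ, 0 ≤ ∫ x, H n (g x - f x) * lapl ψ x := by
    intro n
    refine hf.integral_comp_mul_lapl_nonneg hg hUf hAB (hcH n) (by simp [H, convexProfile_zero])
      (fun s hs => ?_) (fun s => ?_) (fun s => ?_) (fun s => ?_) hψ hψ0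
    · rw [hdH']
      exact Real.smoothTransition.zero_of_nonpos
        (mul_nonpos_of_nonneg_of_nonpos (by positivity) hs)
    · rw [hdH']; exact Real.smoothTransition.nonneg _
    · rw [hdH']; exact Real.smoothTransition.le_one _
    · rw [hdH', deriv_comp_mul_left, smul_eq_mul]
      exact mul_nonneg (by positivity) (smoothTransition_deriv_nonneg _)
  have hgf : Integrable fun x => g x - f x := hg.integrable.sub hf.integrable
  refine ge_of_tendsto' (tendsto_integral_of_dominated_convergence
    (fun x => |(g x - f x) * lapl ψ x|) (fun n => ?_)
    (integrable_mul_of_bound hgf hψ.lapl.continuous hL).abs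
    (fun n => Eventually.of_forall fun x => ?_) (Eventually.of_forall fun x => ?_)) hpos
  · exact ((hcH n).continuous.comp_aestronglyMeasurable hgf.aestronglyMeasurable).mul
      hψ.lapl.continuous.aestronglyMeasurable
  · rw [Real.norm_eq_abs, abs_mul (H n _), abs_mul (g x - f x), abs_of_nonneg (hnn n _)]
    exact mul_le_mul_of_nonneg_right ((hup n _).trans (max_le (le_abs_self _) (abs_nonneg _)))
      (abs_nonneg _)
  · refine Tendsto.mul_const _ ?_
    have ht : Tendsto (fun n : ℕ => max (g x - f x) 0 - ((n : ℝ) + 1)⁻¹) atTop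
        (𝓝 (max (g x - f x) 0 - 0)) := by
      refine tendsto_const_nhds.sub ?_
      simpa using tendsto_one_div_add_atTop_nhds_zero_nat (𝕜 := ℝ)
    rw [sub_zero] at ht
    exact tendsto_of_tendsto_of_tendsto_of_le_of_le ht tendsto_const_nhds
      (fun n => hlo n _) (fun n => hup n _)

theorem IsRelClosedIn.measurableSet (hU : IsOpen U) (hA : IsRelClosedIn U A) : MeasurableSet A := by
  obtain ⟨F, hF, rfl⟩ := hA
  exact hU.measurableSet.inter hF.measurableSet

theorem IsRelClosedIn.subset (hA : IsRelClosedIn U A) : A ⊆ U := by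
  obtain ⟨F, hF, rfl⟩ := hA
  exact inter_subset_left

theorem MemH1.integrableOn (hUf : volume U ≠ ⊤) (h : MemH1 U f) : IntegrableOn f U := by
  have hfin : IsFiniteMeasure (volume.restrict U) := ⟨by
    rw [Measure.restrict_apply_univ]; exact hUf.lt_top⟩
  obtain ⟨G, hG⟩ := h
  exact hG.2.1.integrable one_le_two

end Comparison

theorem theorem4p8 {N : ℕ} (hN : 1 ≤ N) (U A B : Set (EuclideanSpace ℝ (Fin N)))
    (hU : IsOpen U) (hUb : Bornology.IsBounded U)
    (hA : IsRelClosedIn U A) (hB : IsRelClosedIn U B)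
    (hAc : IsConnected (closure U \ A)) (hBc : IsConnected (closure U \ B)) :
    (HasLipschitzBoundary U → ∀ (t : ℝ), 0 < t →
      ∀ u v : EuclideanSpace ℝ (Fin N) → ℝ, MemH1 U u → MemH1 U v →
        IsVariationalSolution U A u → EqConstOnBoundary U u t →
        IsVariationalSolution U B v → EqConstOnBoundary U v t →
        ∃ u' v' : EuclideanSpace ℝ (Fin N) → ℝ,
          IsContinuousRep U u u' ∧ IsContinuousRep U v v' ∧
          zeroSetIn U u' ⊆ A ∧ zeroSetIn U v' ⊆ B ∧
          volume (symmDiff (zeroSetIn U u') (zeroSetIn U v')) ≤ volume (symmDiff A B) ∧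
          volume ((U \ zeroSetIn U u') ∩ zeroSetIn U v') ≤ volume (B ∩ (U \ A))) ∧
    (A ⊆ B → ∀ u v : EuclideanSpace ℝ (Fin N) → ℝ, MemH1 U u → MemH1 U v →
        IsVariationalSolution U A u → IsVariationalSolution U B v →
        LeOnBoundary U v u →
        ∀ᵐ x ∂(volume.restrict U), v x ≤ u x) ∧
    (∀ (t : ℝ), 0 < t → ∀ u : EuclideanSpace ℝ (Fin N) → ℝ, MemH1 U u →
        IsVariationalSolution U A u → EqConstOnBoundary U u t →
        ∀ᵐ x ∂(volume.restrict U), 0 ≤ u x ∧ u x ≤ t) := by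
  have hUf : volume U ≠ ⊤ := hUb.measure_lt_top.ne
  have hAm := hA.measurableSet hU
  have hBm := hB.measurableSet hU
  refine ⟨fun hL t ht u v hu1 hv1 hu hut hv hvt => ?_, fun hAB u v hu1 hv1 hu hv hle => ?_,
    fun t ht u hu1 hu hut => ?_⟩
  · obtain ⟨f, hf, hfu⟩ := hu.exists_isObstacleRep hU hAm hA.subset (hu1.integrableOn hUf)
    obtain ⟨g, hg, hgv⟩ := hv.exists_isObstacleRep hU hBm hB.subset (hv1.integrableOn hUf)
    have hft : MemH10 U fun x => f x - t := MemH10.congr_ae hUf hut (by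
      filter_upwards [hfu] with x hx; rw [hx])
    have hgt : MemH10 U fun x => g x - t := MemH10.congr_ae hUf hvt (by
      filter_upwards [hgv] with x hx; rw [hx])
    have hfg : MemH10 U fun x => f x - g x := by simpa using hft.sub hgt
    have hgf : MemH10 U fun x => g x - f x := by simpa using hgt.sub hft
    have hfA := hf.zeroSetIn_subset hN hUb hA hAc fun y hy =>
      hf.exists_pos_near_frontier hUf hL ht hft hy
    have hgB := hg.zeroSetIn_subset hN hUb hB hBc fun y hy =>
      hg.exists_pos_near_frontier hUf hL ht hgt hy
    have h1 := hf.volume_zeroSetIn_diff_le hg hUf hfg hgB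
    have h2 := hg.volume_zeroSetIn_diff_le hf hUf hgf hfA
    exact ⟨f, g, ⟨hf.continuousOn, hfu⟩, ⟨hg.continuousOn, hgv⟩, hfA, hgB,
      hf.volume_symmDiff_zeroSetIn_le hg h1 h2, h1⟩
  · obtain ⟨f, hf, hfu⟩ := hu.exists_isObstacleRep hU hAm hA.subset (hu1.integrableOn hUf)
    obtain ⟨g, hg, hgv⟩ := hv.exists_isObstacleRep hU hBm hB.subset (hv1.integrableOn hUf)
    have hz : MemH10 U fun x => max (g x - f x) 0 := MemH10.congr_ae hUf hle (by
      filter_upwards [hfu, hgv] with x hx hx'; rw [hx, hx'])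
    have := hz.nonpos_of_lapl_nonneg hN hUb fun ψ hψ h0 => by
      rw [setIntegral_mul_test hψ.lapl]
      exact hf.integral_max_mul_lapl_nonneg hg hUf hAB hψ h0
    filter_upwards [this, hfu, hgv] with x hx hx1 hx2
    have := (le_max_left _ _).trans hx
    rw [← hx1, ← hx2]; linarith
  -- For this bound no continuous representative is needed: u - t is weakly subharmonic directly
  -- from the lower differential inequality.
  · have := MemH10.nonpos_of_lapl_nonneg hN hUb hut fun ψ hψ h0 => by
      rw [setIntegral_sub_const_mul_lapl (hu1.integrableOn hUf) t hψ]
      refine le_trans ?_ (hu.le_integral_lapl hU hAm (hu1.integrableOn hUf) hψ h0)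
      exact integral_nonneg fun x => indicator_nonneg (fun x _ => h0 x) x
    filter_upwards [this, hu.1] with x hx hx0
    exact ⟨hx0, by linarith⟩
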